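/- Let $d\ge 2$, $m\ge 1$ be integers and $Y=(-1/2,1/2)^d$; repeated indices are summed, Latin ones from $1$ to $d$ and Greek ones from $1$ to $m$. Let $\omega\subset Y$ be a simply connected domain with Lipschitz boundary and $\mathrm{dist}(\omega,\partial Y)>0$. Let $\mu>0$, and let $A=(a_{ij}^{\alpha\beta}):\mathbb{R}^d\to\mathbb{R}^{(dm)^2}$ be measurable, $\mathbb{Z}^d$-periodic and elliptic, $$\mu|\xi|^2\le a_{ij}^{\alpha\beta}(y)\,\xi_i^\alpha\xi_j^\beta\le\mu^{-1}|\xi|^2\qquad\text{for all } y\in\mathbb{R}^d,\ \xi\in\mathbb{R}^{dm},$$ and either symmetric, $a_{ij}^{\alpha\beta}=a_{ji}^{\beta\alpha}$, or else bounded, $|a_{ij}^{\alpha\beta}|\le M$ with a constant $M$. For $\delta\in(0,\infty)$ put $\Lambda_\delta=\delta\,\mathbf 1_\omega+\mathbf 1_{Y\setminus\overline\omega}$ on $Y$. For every $\delta\in(0,\infty)$ the cell problems have a solution $\chi_\delta=(\chi_{\delta,j}^{\gamma\beta})$: each $\chi_{\delta,j}^{\beta}=(\chi_{\delta,j}^{1\beta},\dots,\chi_{\delta,j}^{m\beta})$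 lies in $H^1(\mathbb{T}^d;\mathbb{R}^m)$, has mean zero over $Y$, and satisfies $$\int_Y\Lambda_\delta\Big(a_{ij}^{\alpha\beta}+a_{ik}^{\alpha\gamma}\frac{\partial\chi_{\delta,j}^{\gamma\beta}}{\partial y_k}\Big)\frac{\partial v^\alpha}{\partial y_i}\,dy=0\qquad\text{for all } v\in H^1(\mathbb{T}^d;\mathbb{R}^m).$$ For any such $\chi_\delta$ define $$\widehat a_{\delta,ij}^{\alpha\beta}=\int_Y\Lambda_\delta\Big(a_{ij}^{\alpha\beta}+a_{ik}^{\alpha\gamma}\frac{\partial\chi_{\delta,j}^{\gamma\beta}}{\partial y_k}\Big)dy,\qquad F_{\delta,ij}^{\alpha\beta}=\Lambda_\delta\Big(a_{ij}^{\alpha\beta}+a_{ik}^{\alpha\gamma}\frac{\partial\chi_{\delta,j}^{\gamma\beta}}{\partial y_k}\Big)-\widehat a_{\delta,ij}^{\alpha\beta}.$$ Let $\Psi_\delta=(\Psi_{\delta,kij}^{\alpha\beta})$ be the flux corrector of $F_\delta$, that is, $\Psi_{\delta,kij}^{\alpha\beta}=\partial_k f_{ij}^{\alpha\beta}-\partial_i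 f_{kj}^{\alpha\beta}$, where $f_{ij}^{\alpha\beta}\in H^1(\mathbb{T}^d)$ is the mean-zero weak solution of $\Delta f_{ij}^{\alpha\beta}=F_{\delta,ij}^{\alpha\beta}$ on $\mathbb{T}^d$. Then $F_\delta\in L^2(Y)$, the tensor $\Psi_\delta$ exists, lies in $L^2(Y)$, and satisfies $$\frac{\partial}{\partial y_k}\Psi_{\delta,kij}^{\alpha\beta}=F_{\delta,ij}^{\alpha\beta}\ \text{ in the sense of distributions on }\mathbb{T}^d,\qquad \Psi_{\delta,kij}^{\alpha\beta}=-\Psi_{\delta,ikj}^{\alpha\beta},$$ and $$\|F_\delta\|_{L^2(Y)}+\|\Psi_\delta\|_{L^2(Y)}\le C,$$ where $C$ is independent of $\delta$ and depends only on $d$, $m$, $\mu$, $\omega$ (and, when $A$ is not symmetric, on $M$). -/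

import Mathlib

open MeasureTheory
open scoped ENNReal NNReal

noncomputable section

namespace HighContrast

/-- The Euclidean space `ℝᵈ`. -/
abbrev Space (d : ℕ) : Type := EuclideanSpace ℝ (Fin d)

/-- The open unit cell `Y = (-1/2, 1/2)ᵈ`. -/
def cell (d : ℕ) : Set (Space d) := {y | ∀ i, |y i| < 1 / 2}

/-- Lebesgue measure on the unit cell. -/
def cellMeasure (d : ℕ) : Measure (Space d) := volume.restrict (cell d)

/-- The vector of `ℝᵈ` with the integer coordinates `n`. -/
def latticeVec {d : ℕ} (n : Fin d → ℤ) : Space d := WithLp.toLp 2 (fun i => (n i : ℝ))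

/-- Periodicity with respect to `ℤᵈ`; such functions are the functions on the flat torus. -/
def IsPeriodic {d : ℕ} {V : Type*} (f : Space d → V) : Prop :=
  ∀ (n : Fin d → ℤ) (y : Space d), f (y + latticeVec n) = f y

/-- The classical partial derivative `∂φ/∂y_k`. -/
def pderiv {d : ℕ} (k : Fin d) (φ : Space d → ℝ) (y : Space d) : ℝ :=
  fderiv ℝ φ y (EuclideanSpace.single k 1)

/-- `u ∈ H¹(𝕋ᵈ)` with weak gradient `Du = (∂_k u)_k`: both are periodic and square integrable
over a period, and `∫_Y u ∂_kφ = -∫_Y (∂_k u) φ` for all smooth periodic `φ`. -/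
structure IsPerH1 {d : ℕ} (u : Space d → ℝ) (Du : Fin d → Space d → ℝ) : Prop where
  periodic : IsPeriodic u
  periodic_grad : ∀ k, IsPeriodic (Du k)
  memLp : MemLp u 2 (cellMeasure d)
  memLp_grad : ∀ k, MemLp (Du k) 2 (cellMeasure d)
  weak_grad : ∀ (k : Fin d) (φ : Space d → ℝ), ContDiff ℝ (⊤ : ℕ∞) φ → IsPeriodic φ →
    ∫ y, u y * pderiv k φ y ∂(cellMeasure d) = -∫ y, Du k y * φ y ∂(cellMeasure d)

/-- Lipschitz boundary: near each boundary point `p`, the set `W` is the part above the graph of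
a Lipschitz function, in the direction of some unit vector `ν`.  Here `⟪ν, x⟫` is the height of
`x` and `x - ⟪ν, x⟫ ν` its projection to the hyperplane orthogonal to `ν`. -/
def HasLipschitzBoundary {d : ℕ} (W : Set (Space d)) : Prop :=
  ∀ p ∈ frontier W, ∃ (ν : Space d) (r : ℝ) (K : ℝ≥0) (h : Space d → ℝ),
    ‖ν‖ = 1 ∧ 0 < r ∧ LipschitzWith K h ∧
    ∀ x ∈ Metric.ball p r, (x ∈ W ↔ h (x - inner ℝ ν x • ν) < inner ℝ ν x)

/-- The assumptions on the inclusion: `W ⊂ Y` is a simply connected domain with Lipschitz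
boundary and `dist(W, ∂Y) > 0`. -/
structure IsInclusion {d : ℕ} (W : Set (Space d)) : Prop where
  isOpen : IsOpen W
  simplyConnected : SimplyConnectedSpace W
  subset_cell : W ⊆ cell d
  lipschitz : HasLipschitzBoundary W
  dist_pos : ∃ c : ℝ, 0 < c ∧ ∀ x ∈ W, ∀ z ∈ frontier (cell d), c ≤ dist x z

/-- Coefficients: `A y i j α β` is `a_{ij}^{αβ}(y)`. -/
abbrev Coeff (d m : ℕ) : Type := Space d → Fin d → Fin d → Fin m → Fin m → ℝ

/-- Symmetry: `a_{ij}^{αβ} = a_{ji}^{βα}`. -/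
def IsSymm {d m : ℕ} (A : Coeff d m) : Prop :=
  ∀ y i j α β, A y i j α β = A y j i β α

/-- Strong ellipticity: `μ|ξ|² ≤ a_{ij}^{αβ}(y) ξ_i^α ξ_j^β ≤ μ⁻¹|ξ|²`. -/
def IsElliptic {d m : ℕ} (μ : ℝ) (A : Coeff d m) : Prop :=
  ∀ (y : Space d) (ξ : Fin d → Fin m → ℝ),
    μ * ∑ i, ∑ α, ξ i α ^ 2 ≤ ∑ i, ∑ j, ∑ α, ∑ β, A y i j α β * ξ i α * ξ j β ∧
    ∑ i, ∑ j, ∑ α, ∑ β, A y i j α β * ξ i α * ξ j β ≤ μ⁻¹ * ∑ i, ∑ α, ξ i α ^ 2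

/-- The contrast function of the unit cell, `Λ_δ = δ 1_W + 1_{Y \ closure W}`. -/
def contrast {d : ℕ} (W : Set (Space d)) (δ : ℝ) (y : Space d) : ℝ :=
  δ * W.indicator 1 y + (cell d \ closure W).indicator 1 y

/-- The total flux `Λ_δ (a_{ij}^{αβ} + a_{ik}^{αγ} ∂_k χ_j^{γβ})`.  In `Dχ j γ β k = ∂_k χ_j^{γβ}`
the index `γ` is the component of the vector-valued function `χ_j^β`. -/
def totalFlux {d m : ℕ} (W : Set (Space d)) (δ : ℝ) (A : Coeff d m)
    (Dχ : Fin d → Fin m → Fin m → Fin d → Space d → ℝ)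
    (i j : Fin d) (α β : Fin m) (y : Space d) : ℝ :=
  contrast W δ y * (A y i j α β + ∑ k, ∑ γ, A y i k α γ * Dχ j γ β k y)

/-- `χ = (χ_j^{γβ})`, with weak gradient `Dχ`, solves the cell problems: each
`χ_j^β = (χ_j^{1β}, …, χ_j^{mβ})` lies in `H¹(𝕋ᵈ; ℝᵐ)`, has mean zero, and is a weak solution of
`-div (Λ_δ A ∇(χ_j^β + y_j e^β)) = 0` on the torus. -/
structure IsCellSolution {d m : ℕ} (W : Set (Space d)) (δ : ℝ) (A : Coeff d m)
    (χ : Fin d → Fin m → Fin m → Space d → ℝ)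
    (Dχ : Fin d → Fin m → Fin m → Fin d → Space d → ℝ) : Prop where
  perH1 : ∀ j γ β, IsPerH1 (χ j γ β) (Dχ j γ β)
  mean_zero : ∀ j γ β, ∫ y, χ j γ β y ∂(cellMeasure d) = 0
  weak_eq : ∀ (j : Fin d) (β : Fin m) (v : Fin m → Space d → ℝ)
    (Dv : Fin m → Fin d → Space d → ℝ), (∀ α, IsPerH1 (v α) (Dv α)) →
    ∫ y, ∑ i, ∑ α, totalFlux W δ A Dχ i j α β y * Dv α i y ∂(cellMeasure d) = 0

/-- The homogenized tensor `â_{δ,ij}^{αβ} = ∫_Y Λ_δ (a_{ij}^{αβ} + a_{ik}^{αγ} ∂_k χ_j^{γβ})`. -/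
def homogenized {d m : ℕ} (W : Set (Space d)) (δ : ℝ) (A : Coeff d m)
    (Dχ : Fin d → Fin m → Fin m → Fin d → Space d → ℝ)
    (i j : Fin d) (α β : Fin m) : ℝ :=
  ∫ y, totalFlux W δ A Dχ i j α β y ∂(cellMeasure d)

/-- `F_{δ,ij}^{αβ} = Λ_δ (a_{ij}^{αβ} + a_{ik}^{αγ} ∂_k χ_j^{γβ}) - â_{δ,ij}^{αβ}`. -/
def fluxF {d m : ℕ} (W : Set (Space d)) (δ : ℝ) (A : Coeff d m)
    (Dχ : Fin d → Fin m → Fin m → Fin d → Space d → ℝ)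
    (i j : Fin d) (α β : Fin m) (y : Space d) : ℝ :=
  totalFlux W δ A Dχ i j α β y - homogenized W δ A Dχ i j α β

/-- The relations of a flux corrector: `Ψ` is a square integrable tensor on the torus,
`Ψ_{kij} = -Ψ_{ikj}`, and `∂_k Ψ_{kij} = F_{ij}` (sum over `k`) in the sense of distributions
on the torus. -/
structure IsFluxTensor {d m : ℕ} (F : Fin d → Fin d → Fin m → Fin m → Space d → ℝ)
    (Ψ : Fin d → Fin d → Fin d → Fin m → Fin m → Space d → ℝ) : Prop where
  periodic : ∀ k i j α β, IsPeriodic (Ψ k i j α β)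
  memLp : ∀ k i j α β, MemLp (Ψ k i j α β) 2 (cellMeasure d)
  skew : ∀ k i j α β, ∀ᵐ y ∂(cellMeasure d), Ψ k i j α β y = -Ψ i k j α β y
  div_eq : ∀ i j α β, ∀ φ : Space d → ℝ, ContDiff ℝ (⊤ : ℕ∞) φ → IsPeriodic φ →
    ∫ y, ∑ k, Ψ k i j α β y * pderiv k φ y ∂(cellMeasure d) =
      -∫ y, F i j α β y * φ y ∂(cellMeasure d)

/-- The relations above determine `Ψ` only up to a divergence-free skew-symmetric tensor.  This
is the usual normalization: `Ψ_{kij} = ∂_k f_{ij} - ∂_i f_{kj}`, where `f_{ij} ∈ H¹(𝕋ᵈ)` is the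
mean-zero weak solution of `Δ f_{ij} = F_{ij}` on the torus.  It determines `Ψ` almost
everywhere. -/
def IsFluxCorrector {d m : ℕ} (F : Fin d → Fin d → Fin m → Fin m → Space d → ℝ)
    (Ψ : Fin d → Fin d → Fin d → Fin m → Fin m → Space d → ℝ) : Prop :=
  (∀ k i j α β, IsPeriodic (Ψ k i j α β)) ∧
  ∃ (f : Fin d → Fin d → Fin m → Fin m → Space d → ℝ)
    (Df : Fin d → Fin d → Fin m → Fin m → Fin d → Space d → ℝ),
    (∀ i j α β, IsPerH1 (f i j α β) (Df i j α β)) ∧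
    (∀ i j α β, ∫ y, f i j α β y ∂(cellMeasure d) = 0) ∧
    (∀ i j α β, ∀ (v : Space d → ℝ) (Dv : Fin d → Space d → ℝ), IsPerH1 v Dv →
      ∫ y, ∑ l, Df i j α β l y * Dv l y ∂(cellMeasure d) =
        -∫ y, F i j α β y * v y ∂(cellMeasure d)) ∧
    ∀ k i j α β, ∀ᵐ y ∂(cellMeasure d), Ψ k i j α β y = Df i j α β k y - Df k j α β i y

/-- The `L²(Y)` norm of a tensor with components `G i j α β`. -/
def norm4 {d m : ℕ} (G : Fin d → Fin d → Fin m → Fin m → Space d → ℝ) : ℝ≥0∞ :=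
  (∑ i, ∑ j, ∑ α, ∑ β, eLpNorm (G i j α β) 2 (cellMeasure d) ^ 2) ^ (1 / 2 : ℝ)

/-- The `L²(Y)` norm of a tensor with components `G k i j α β`. -/
def norm5 {d m : ℕ} (G : Fin d → Fin d → Fin d → Fin m → Fin m → Space d → ℝ) : ℝ≥0∞ :=
  (∑ k, ∑ i, ∑ j, ∑ α, ∑ β, eLpNorm (G k i j α β) 2 (cellMeasure d) ^ 2) ^ (1 / 2 : ℝ)

end HighContrast

end

noncomputable section

namespace HighContrast

open Set Filter Topology

/-! ### The unit cell -/

/-! Write ω for the inclusion `W` and G for the gradient of `y_j e^β + χ_j^β`. The cell problem says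
that the flux Λ_δ A G is orthogonal in L²(Y) to gradients of periodic fields. Since A is bounded,
the flux has size δ|G| on ω and |G| outside, so it suffices to bound ∫_{Y∖ω}|G|² and δ²∫_ω|G|²
independently of δ. Two test functions do this, for small and large δ alike.

Outside ω (`setIntegral_compl_le_of_orthogonal`): let v be periodic with ∇v = ∇y_j on ω. The
gradient of χ + v e^β is G - Z, where Z = ∇(y_j - v) e^β vanishes on ω. Testing with it, the
contribution of ω is δ AG·G ≥ 0 and is dropped; Young's inequality outside bounds ∫_{Y∖ω}|G|² by a
multiple of ∫|Z|², in which δ does not occur.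

Inside ω (`setIntegral_le_of_orthogonal`): extend `y_j e^β + χ_j^β` from ω to a periodic field with
gradient P and ∫_Y|P|² ≤ K∫_ω|P|². Orthogonality gives δ∫_ω AG·G = -∫_{Y∖ω} AG·P, whence
δ‖G‖_{L²(ω)} ≤ C‖G‖_{L²(Y∖ω)}.

The extension (`exists_extension`) reflects in the Lipschitz graphs that describe ∂ω
(`exists_local_retraction`), glues with cutoffs, and subtracts a constant so that the Poincaré
inequality on the connected set ω reduces the H¹ norm to the energy. That inequality is proved in
the two-point form ∫∫|u(x)-u(y)|² ≤ C∫|∇u|²: on balls by integrating over segments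
(`lintegral_enorm_sub_sq_le`), then along chains of overlapping neighbourhoods
(`twoPointBound_self`). All this is for C¹ functions. Periodic Sobolev functions are approximated by
trigonometric polynomials (`trigSpan_topologicalClosure`), and the error is sent to zero with δ
fixed.

Solutions exist by Lax–Milgram (`exists_weak_solution`). For the flux corrector, testing Δf = F with
f bounds ∇f, hence Ψ, by F. Moreover ∂_kΨ_{kij} = Δf_{ij} - ∂_i∂_k f_{kj}, and the last term
vanishes because F is divergence-free, as is seen frequency by frequency
(`sum_integral_grad_mul_eq_zero`). -/

lemma cell_eq_iInter (d : ℕ) : cell d = ⋂ i, {y : Space d | |y i| < 1 / 2} := by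
  ext y; simp [cell]

lemma isOpen_cell (d : ℕ) : IsOpen (cell d) := by
  rw [cell_eq_iInter]
  exact isOpen_iInter_of_finite fun i => isOpen_lt (by fun_prop) continuous_const

lemma measurableSet_cell (d : ℕ) : MeasurableSet (cell d) := (isOpen_cell d).measurableSet

lemma convex_cell (d : ℕ) : Convex ℝ (cell d) := by
  intro x hx y hy a b ha hb hab i
  have h1 := abs_lt.1 (hx i)
  have h2 := abs_lt.1 (hy i)
  have : (a • x + b • y) i = a * x i + b * y i := by simp
  rw [this, abs_lt]
  have hb' : b = 1 - a := by linarith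
  subst hb'
  rcases ha.eq_or_lt with rfl | ha'
  · constructor <;> simp <;> linarith
  · constructor <;> nlinarith [mul_nonneg hb (by linarith : (0 : ℝ) ≤ 1 / 2 - y i),
      mul_nonneg hb (by linarith : (0 : ℝ) ≤ 1 / 2 + y i)]

lemma isCompact_closedCell (d : ℕ) : IsCompact {y : Space d | ∀ i, |y i| ≤ 1 / 2} := by
  have hcl : IsClosed {y : Space d | ∀ i, |y i| ≤ 1 / 2} := by
    have : {y : Space d | ∀ i, |y i| ≤ 1 / 2} = ⋂ i, {y : Space d | |y i| ≤ 1 / 2} := by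
      ext; simp
    rw [this]
    exact isClosed_iInter fun i => isClosed_le (by fun_prop) continuous_const
  refine Metric.isCompact_of_isClosed_isBounded hcl ?_
  refine (Metric.isBounded_closedBall (x := (0 : Space d)) (r := √(d * 1))).subset fun y hy => ?_
  rw [mem_closedBall_zero_iff, EuclideanSpace.norm_eq]
  refine Real.sqrt_le_sqrt ?_
  calc ∑ i, ‖y i‖ ^ 2 ≤ ∑ _i : Fin d, (1 : ℝ) := Finset.sum_le_sum fun i _ => by
        have := hy i
        rw [Real.norm_eq_abs]
        nlinarith [abs_nonneg (y i)]
    _ = d * 1 := by simp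

lemma isBounded_cell (d : ℕ) : Bornology.IsBounded (cell d) :=
  (isCompact_closedCell d).isBounded.subset fun _ hy i => (hy i).le

lemma cell_eq_preimage (d : ℕ) :
    cell d = (WithLp.ofLp : Space d → Fin d → ℝ) ⁻¹'
      (Set.univ.pi fun _ => Ioo (-(1 / 2) : ℝ) (1 / 2)) := by
  ext y; simp [cell, abs_lt]

instance isProbabilityMeasure_cellMeasure (d : ℕ) : IsProbabilityMeasure (cellMeasure d) := by
  constructor
  rw [cellMeasure, Measure.restrict_apply_univ, cell_eq_preimage,
    (PiLp.volume_preserving_ofLp (Fin d)).measure_preimage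
      (MeasurableSet.univ_pi fun _ => measurableSet_Ioo).nullMeasurableSet, volume_pi_pi]
  norm_num

/-! ### Periodisation -/

/-- The translate of `y` by a lattice vector that lies in the closed unit cell. -/
def cellRep {d : ℕ} (y : Space d) : Space d := y - latticeVec fun i => round (y i)

lemma cellRep_of_mem {d : ℕ} {y : Space d} (hy : y ∈ cell d) : cellRep y = y := by
  ext i
  have h := abs_lt.1 (hy i)
  have : round (y i) = 0 := by
    rw [round_eq_zero_iff]; constructor <;> linarith
  simp [cellRep, latticeVec, this]

lemma cellRep_add {d : ℕ} (n : Fin d → ℤ) (y : Space d) :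
    cellRep (y + latticeVec n) = cellRep y := by
  ext i
  simp [cellRep, latticeVec]

lemma abs_cellRep_le {d : ℕ} (y : Space d) (i : Fin d) : |cellRep y i| ≤ 1 / 2 := by
  simpa [cellRep, latticeVec] using abs_sub_round (y i)

lemma IsPeriodic.cellRep_eq {d : ℕ} {V : Type*} {f : Space d → V} (hf : IsPeriodic f)
    (y : Space d) : f (cellRep y) = f y := by
  have := hf (fun i => round (y i)) (cellRep y)
  rw [← this, cellRep, sub_add_cancel]

/-- The periodic function that agrees with `f` on the unit cell. -/
def periodize {d : ℕ} {V : Type*} (f : Space d → V) (y : Space d) : V := f (cellRep y)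

lemma isPeriodic_periodize {d : ℕ} {V : Type*} (f : Space d → V) : IsPeriodic (periodize f) :=
  fun n y => by simp [periodize, cellRep_add]

lemma periodize_of_mem {d : ℕ} {V : Type*} (f : Space d → V) {y : Space d} (hy : y ∈ cell d) :
    periodize f y = f y := by rw [periodize, cellRep_of_mem hy]

lemma periodize_ae_eq {d : ℕ} {V : Type*} (f : Space d → V) :
    periodize f =ᵐ[cellMeasure d] f := by
  filter_upwards [ae_restrict_mem (measurableSet_cell d)] with y hy using periodize_of_mem f hy

/-- Continuous periodic functions are bounded. -/
lemma IsPeriodic.exists_norm_le {d : ℕ} {V : Type*} [NormedAddCommGroup V] {f : Space d → V}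
    (hf : IsPeriodic f) (hc : Continuous f) : ∃ C : ℝ≥0, ∀ y, ‖f y‖ ≤ C := by
  obtain ⟨C, hC⟩ := (isCompact_closedCell d).exists_bound_of_continuousOn hc.continuousOn
  refine ⟨⟨max C 0, le_max_right _ _⟩, fun y => ?_⟩
  rw [← hf.cellRep_eq y]
  exact (hC _ (abs_cellRep_le y)).trans (le_max_left _ _)

lemma IsPeriodic.fderiv {d : ℕ} {φ : Space d → ℝ} (hφ : IsPeriodic φ) :
    IsPeriodic (fderiv ℝ φ) := by
  intro n y
  have : (fun x => φ (x + latticeVec n)) = φ := funext fun x => hφ n x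
  rw [← fderiv_comp_add_right, this]

lemma IsPeriodic.pderiv {d : ℕ} {φ : Space d → ℝ} (hφ : IsPeriodic φ) (k : Fin d) :
    IsPeriodic (pderiv k φ) := fun n y => by
  simp only [HighContrast.pderiv, hφ.fderiv n y]

lemma IsPeriodic.exists_lipschitzWith {d : ℕ} {φ : Space d → ℝ} (hφ : IsPeriodic φ)
    (h1 : ContDiff ℝ 1 φ) : ∃ C : ℝ≥0, LipschitzWith C φ := by
  obtain ⟨C, hC⟩ := hφ.fderiv.exists_norm_le (h1.continuous_fderiv (by norm_num))
  exact ⟨C, lipschitzWith_of_nnnorm_fderiv_le (h1.differentiable (by norm_num))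
    fun x => by exact_mod_cast hC x⟩

lemma continuous_pderiv {d : ℕ} {φ : Space d → ℝ} (h1 : ContDiff ℝ 1 φ) (k : Fin d) :
    Continuous (pderiv k φ) :=
  (h1.continuous_fderiv (by norm_num)).clm_apply continuous_const

lemma IsPeriodic.memLp {d : ℕ} {φ : Space d → ℝ} (hφ : IsPeriodic φ) (hc : Continuous φ)
    (p : ℝ≥0∞) : MemLp φ p (cellMeasure d) := by
  obtain ⟨C, hC⟩ := hφ.exists_norm_le hc
  exact MemLp.of_bound hc.aestronglyMeasurable C (ae_of_all _ hC)

/-! ### Trigonometric functions -/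

/-- The phase `2π n·y`, as a linear form. -/
def phase {d : ℕ} (n : Fin d → ℤ) : Space d →L[ℝ] ℝ :=
  ∑ i, (2 * Real.pi * n i) • (EuclideanSpace.proj i : Space d →L[ℝ] ℝ)

lemma phase_apply {d : ℕ} (n : Fin d → ℤ) (y : Space d) :
    phase n y = ∑ i, 2 * Real.pi * n i * y i := by simp [phase]

/-- The real trigonometric functions `cos (2π n·y + θ)`. -/
def trig {d : ℕ} (n : Fin d → ℤ) (θ : ℝ) (y : Space d) : ℝ := Real.cos (phase n y + θ)

lemma contDiff_trig {d : ℕ} (n : Fin d → ℤ) (θ : ℝ) {k : WithTop ℕ∞} :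
    ContDiff ℝ k (trig n θ) := by
  unfold trig; fun_prop

lemma isPeriodic_trig {d : ℕ} (n : Fin d → ℤ) (θ : ℝ) : IsPeriodic (trig n θ) := by
  intro l y
  have : phase n (latticeVec l) = ((∑ i, n i * l i : ℤ) : ℝ) * (2 * Real.pi) := by
    rw [phase_apply]
    push_cast
    rw [Finset.sum_mul]
    exact Finset.sum_congr rfl fun i _ => by simp [latticeVec]; ring
  rw [trig, map_add, this, add_right_comm, Real.cos_add_int_mul_two_pi, trig]

/-- Differentiation only shifts the phase by π/2. With a free phase, one real family contains sines
and cosines and is closed under derivatives up to scalars. -/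
lemma pderiv_trig {d : ℕ} (n : Fin d → ℤ) (θ : ℝ) (k : Fin d) :
    pderiv k (trig n θ) = fun y => 2 * Real.pi * n k * trig n (θ + Real.pi / 2) y := by
  ext y
  have h : HasFDerivAt (trig n θ) (-Real.sin (phase n y + θ) • phase n) y :=
    ((phase n).hasFDerivAt.add_const θ).cos
  rw [pderiv, h.fderiv, trig, ← add_assoc, Real.cos_add_pi_div_two]
  have : phase n (EuclideanSpace.single k 1) = 2 * Real.pi * n k := by
    rw [phase_apply]
    simp
  simp [this]; ring

/-! ### Completeness of the trigonometric functions -/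

section Torus

-- The Haar probability measure, for which the functions `mFourier` are orthonormal.
local instance : MeasureSpace UnitAddCircle := ⟨AddCircle.haarAddCircle⟩

local instance : Measure.IsAddHaarMeasure (volume : Measure UnitAddCircle) :=
  inferInstanceAs (Measure.IsAddHaarMeasure AddCircle.haarAddCircle)

/-- The representative of a point of the torus in the half-open unit cell. -/
def torusRep {d : ℕ} (t : UnitAddTorus (Fin d)) : Space d :=
  WithLp.toLp 2 (UnitAddTorus.measurableEquivPiIoc (fun _ => (-(1 / 2) : ℝ)) t).1

lemma coe_torusRep {d : ℕ} (t : UnitAddTorus (Fin d)) :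
    (fun i => (torusRep t i : UnitAddCircle)) = t := by
  exact (UnitAddTorus.measurableEquivPiIoc (fun _ : Fin d => (-(1 / 2) : ℝ))).symm_apply_apply t

/-- The half-open and the open cube differ by a null set. Through this map the Fourier basis and the
translation invariance of the torus become available on the cell. -/
lemma measurePreserving_torusRep (d : ℕ) :
    MeasurePreserving (torusRep (d := d)) volume (cellMeasure d) := by
  have h1 := UnitAddTorus.measurePreserving_equivPiIoc (fun _ : Fin d => (-(1 / 2) : ℝ))
  have hms : MeasurableSet {x : Fin d → ℝ | ∀ i, x i ∈ Ioc (-(1 / 2) : ℝ) (-(1 / 2) + 1)} :=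
    MeasurableSet.univ_pi' fun _ => measurableSet_Ioc
  have h2 := measurePreserving_subtype_coe (μa := (volume : Measure (Fin d → ℝ))) hms
  have h3 := (PiLp.volume_preserving_toLp (Fin d)).restrict_preimage (measurableSet_cell d)
  have h4 : (volume : Measure (Fin d → ℝ)).restrict
      {x : Fin d → ℝ | ∀ i, x i ∈ Ioc (-(1 / 2) : ℝ) (-(1 / 2) + 1)} =
      volume.restrict ((WithLp.toLp 2 : (Fin d → ℝ) → Space d) ⁻¹' cell d) := by
    refine Measure.restrict_congr_set ?_
    have e1 : {x : Fin d → ℝ | ∀ i, x i ∈ Ioc (-(1 / 2) : ℝ) (-(1 / 2) + 1)} =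
        Set.univ.pi fun _ => Ioc (-(1 / 2) : ℝ) (1 / 2) := by
      ext x; norm_num
    have e2 : ((WithLp.toLp 2 : (Fin d → ℝ) → Space d) ⁻¹' cell d) =
        Set.univ.pi fun _ => Ioo (-(1 / 2) : ℝ) (1 / 2) := by
      ext x; simp [cell, abs_lt]
    rw [e1, e2]
    exact (Measure.univ_pi_Ioc_ae_eq_Icc (f := fun _ : Fin d => (-(1 / 2) : ℝ))
      (g := fun _ => 1 / 2)).trans Measure.univ_pi_Ioo_ae_eq_Icc.symm
  rw [← h4] at h3
  exact (h3.comp h2).comp h1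

lemma mFourier_coe {d : ℕ} (n : Fin d → ℤ) (y : Space d) :
    UnitAddTorus.mFourier n (fun i => (y i : UnitAddCircle)) =
      trig n 0 y + trig n (-(Real.pi / 2)) y * Complex.I := by
  have : UnitAddTorus.mFourier n (fun i => (y i : UnitAddCircle)) =
      Complex.exp (phase n y * Complex.I) := by
    change ∏ i, fourier (n i) (y i : UnitAddCircle) = _
    simp_rw [fourier_coe_apply]
    rw [← Complex.exp_sum, phase_apply]
    push_cast
    rw [Finset.sum_mul]
    congr 1
    exact Finset.sum_congr rfl fun i _ => by simp; ring
  rw [this, Complex.exp_mul_I, trig, trig, add_zero, ← sub_eq_add_neg, Real.cos_sub_pi_div_two]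
  push_cast
  rfl

/-- A square integrable function on the cell that is orthogonal to all trigonometric functions
vanishes. -/
theorem ae_eq_zero_of_integral_mul_trig {d : ℕ} {u : Space d → ℝ}
    (hu : MemLp u 2 (cellMeasure d))
    (h : ∀ n θ, ∫ y, u y * trig n θ y ∂(cellMeasure d) = 0) : u =ᵐ[cellMeasure d] 0 := by
  have hs := measurePreserving_torusRep d
  have hu' : MemLp (fun y => (u y : ℂ)) 2 (cellMeasure d) := hu.ofReal
  have hv : MemLp ((fun y => (u y : ℂ)) ∘ torusRep) 2 volume := hu'.comp_measurePreserving hs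
  have hcoef : ∀ n, UnitAddTorus.mFourierCoeff ((fun y => (u y : ℂ)) ∘ torusRep) n = 0 := by
    intro n
    have hint : ∀ θ, Integrable (fun y => u y * trig (-n) θ y) (cellMeasure d) := fun θ =>
      hu.integrable_mul ((isPeriodic_trig (-n) θ).memLp (contDiff_trig (k := 1) _ _).continuous 2)
    -- The n-th coefficient pairs with the frequency -n; the phases 0 and -π/2 are the real and
    -- imaginary parts.
    have e1 : UnitAddTorus.mFourierCoeff ((fun y => (u y : ℂ)) ∘ torusRep) n =
        ∫ t, (fun y : Space d => ((u y * trig (-n) 0 y : ℝ) : ℂ) +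
          ((u y * trig (-n) (-(Real.pi / 2)) y : ℝ) : ℂ) * Complex.I) (torusRep t) := by
      refine integral_congr_ae (ae_of_all _ fun t => ?_)
      simp only [Function.comp]
      conv_lhs => rw [← coe_torusRep t]
      rw [mFourier_coe, coe_torusRep, smul_eq_mul]
      push_cast
      ring
    have hG := (hint 0).ofReal (𝕜 := ℂ) |>.add
      (((hint (-(Real.pi / 2))).ofReal (𝕜 := ℂ)).mul_const Complex.I)
    have e2 := integral_map hs.aemeasurable (hs.map_eq ▸ hG.aestronglyMeasurable)
    rw [hs.map_eq] at e2
    refine e1.trans (e2.symm.trans ?_)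
    refine (integral_add (hint _).ofReal ((hint _).ofReal.mul_const _)).trans ?_
    rw [integral_mul_const]
    have e3 : ∀ θ, ∫ y, ((u y * trig (-n) θ y : ℝ) : ℂ) ∂(cellMeasure d) = 0 := fun θ => by
      rw [integral_complex_ofReal, h, Complex.ofReal_zero]
    erw [e3, e3]
    simp
  -- Completeness of the Fourier basis enters as injectivity of its coordinate map.
  have h0 : hv.toLp = 0 := by
    apply UnitAddTorus.mFourierBasis.repr.injective
    ext n
    rw [UnitAddTorus.mFourierBasis_repr, map_zero]
    have : UnitAddTorus.mFourierCoeff hv.toLp n =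
        UnitAddTorus.mFourierCoeff ((fun y => (u y : ℂ)) ∘ torusRep) n := by
      refine integral_congr_ae ?_
      filter_upwards [hv.coeFn_toLp] with t ht
      rw [ht]
    rw [this, hcoef]
    rfl
  have h1 : (fun y => (u y : ℂ)) ∘ torusRep =ᵐ[volume] 0 := by
    have := hv.coeFn_toLp
    rw [h0] at this
    exact this.symm.trans (Lp.coeFn_zero _ _ _)
  have h2 : eLpNorm (fun y => (u y : ℂ)) 2 (cellMeasure d) = 0 := by
    rw [← eLpNorm_comp_measurePreserving hu'.aestronglyMeasurable hs, eLpNorm_congr_ae h1]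
    simp
  rw [eLpNorm_eq_zero_iff hu'.aestronglyMeasurable (by norm_num)] at h2
  filter_upwards [h2] with y hy
  simpa using hy

/-- Integrals of periodic functions over the cell are invariant under translations. -/
lemma IsPeriodic.integral_comp_add {d : ℕ} {g : Space d → ℝ} (hg : IsPeriodic g) (hc : Continuous g)
    (v : Space d) : ∫ y, g (y + v) ∂(cellMeasure d) = ∫ y, g y ∂(cellMeasure d) := by
  have hs := measurePreserving_torusRep d
  have e : ∀ f : Space d → ℝ, Continuous f →
      ∫ y, f y ∂(cellMeasure d) = ∫ t, f (torusRep t) := fun f hf => by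
    rw [← integral_map hs.aemeasurable (by rw [hs.map_eq]; exact hf.aestronglyMeasurable),
      hs.map_eq]
  rw [e (fun y => g (y + v)) (hc.comp (continuous_add_const v)), e _ hc]
  let w : UnitAddTorus (Fin d) := fun i => (v i : UnitAddCircle)
  rw [← integral_add_right_eq_self (μ := volume) (fun t => g (torusRep t)) w]
  congr 1
  ext t
  -- Both vectors represent the same point of the torus, so they differ by a lattice vector.
  have h : ∀ i, ∃ n : ℤ, (torusRep t + v) i - torusRep (t + w) i = n := by
    intro i
    have h1 : (((torusRep t + v) i - torusRep (t + w) i : ℝ) : UnitAddCircle) = 0 := by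
      have a1 := congrFun (coe_torusRep t) i
      have a2 := congrFun (coe_torusRep (t + w)) i
      simp only at a1 a2
      rw [AddCircle.coe_sub, a2, PiLp.add_apply, AddCircle.coe_add, a1]
      simp [w]
    obtain ⟨n, hn⟩ := (AddCircle.coe_eq_zero_iff (1 : ℝ)).1 h1
    exact ⟨n, by rw [← hn]; simp⟩
  choose n hn using h
  have : torusRep t + v = torusRep (t + w) + latticeVec n := by
    ext i
    have := hn i
    simp only [latticeVec, PiLp.add_apply] at this ⊢
    linarith
  rw [this, hg]

end Torus

/-! ### Differences along Lipschitz curves -/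

section Segments

variable {E : Type*} [NormedAddCommGroup E] [NormedSpace ℝ E]

/-- The curve is only Lipschitz, so the chain rule is replaced by a comparison argument: the right
slopes of |u(γ t) - u(γ 0)| are asymptotically at most the derivative of the integral on the right.
-/
lemma abs_sub_le_integral_along_curve {u : E → ℝ} (hu : ContDiff ℝ 1 u) {γ : ℝ → E} {K : ℝ≥0}
    (hγ : LipschitzWith K γ) :
    |u (γ 1) - u (γ 0)| ≤ ∫ t in (0 : ℝ)..1, K * ‖fderiv ℝ u (γ t)‖ := by
  have hcu : Continuous fun t => K * ‖fderiv ℝ u (γ t)‖ :=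
    continuous_const.mul ((hu.continuous_fderiv (by norm_num)).comp hγ.continuous).norm
  have key := image_le_of_liminf_slope_right_le_deriv_boundary (a := 0) (b := 1)
    (f := fun t => |u (γ t) - u (γ 0)|)
    (B := fun t => ∫ s in (0 : ℝ)..t, K * ‖fderiv ℝ u (γ s)‖)
    (B' := fun t => K * ‖fderiv ℝ u (γ t)‖)
    (((hu.continuous.comp hγ.continuous).sub continuous_const).abs.continuousOn) (by simp)
    (fun t _ => (intervalIntegral.integral_hasDerivAt_right (hcu.intervalIntegrable _ _)
      hcu.stronglyMeasurable.stronglyMeasurableAtFilter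
      hcu.continuousAt).continuousAt.continuousWithinAt)
    (fun t _ => (intervalIntegral.integral_hasDerivAt_right (hcu.intervalIntegrable _ _)
      hcu.stronglyMeasurable.stronglyMeasurableAtFilter hcu.continuousAt).hasDerivWithinAt)
    ?_
  · exact key (right_mem_Icc.2 zero_le_one)
  intro t _ r hr
  -- Room for the linearization error of u at γ t.
  obtain ⟨ε, hε, hεr⟩ : ∃ ε : ℝ, 0 < ε ∧ K * (‖fderiv ℝ u (γ t)‖ + ε) < r := by
    have hc : Tendsto (fun ε : ℝ => K * (‖fderiv ℝ u (γ t)‖ + ε)) (𝓝[>] 0)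
        (𝓝 (K * (‖fderiv ℝ u (γ t)‖ + 0))) :=
      ((continuous_const.mul (continuous_const.add continuous_id)).tendsto 0).mono_left
        nhdsWithin_le_nhds
    rw [add_zero] at hc
    obtain ⟨ε, h1, h2⟩ := ((hc.eventually (gt_mem_nhds hr)).and self_mem_nhdsWithin).exists
    exact ⟨ε, h2, h1⟩
  have hd := ((hu.differentiable (by norm_num)) (γ t)).hasFDerivAt.isLittleO.bound hε
  have hd' := (hγ.continuous.tendsto t).eventually hd
  refine Eventually.frequently ?_
  filter_upwards [nhdsWithin_le_nhds hd', self_mem_nhdsWithin] with z hz hzt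
  have hzt' : 0 < z - t := sub_pos.2 hzt
  have h1 : |u (γ z) - u (γ t)| ≤ (‖fderiv ℝ u (γ t)‖ + ε) * ‖γ z - γ t‖ := by
    calc |u (γ z) - u (γ t)|
        = ‖(u (γ z) - u (γ t) - fderiv ℝ u (γ t) (γ z - γ t)) + fderiv ℝ u (γ t) (γ z - γ t)‖ := by
          rw [sub_add_cancel, Real.norm_eq_abs]
      _ ≤ ε * ‖γ z - γ t‖ + ‖fderiv ℝ u (γ t)‖ * ‖γ z - γ t‖ :=
          (norm_add_le _ _).trans (add_le_add hz (ContinuousLinearMap.le_opNorm _ _))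
      _ = _ := by ring
  have h2 : ‖γ z - γ t‖ ≤ K * (z - t) := by
    have := hγ.dist_le_mul z t
    rwa [dist_eq_norm, Real.dist_eq, abs_of_pos hzt'] at this
  have h3 : |u (γ z) - u (γ 0)| - |u (γ t) - u (γ 0)| ≤ |u (γ z) - u (γ t)| := by
    have := abs_sub_abs_le_abs_sub (u (γ z) - u (γ 0)) (u (γ t) - u (γ 0))
    simpa using this
  rw [slope_def_field, div_lt_iff₀ hzt']
  calc |u (γ z) - u (γ 0)| - |u (γ t) - u (γ 0)|
      ≤ (‖fderiv ℝ u (γ t)‖ + ε) * (K * (z - t)) :=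
        h3.trans (h1.trans (by gcongr))
    _ = K * (‖fderiv ℝ u (γ t)‖ + ε) * (z - t) := by ring
    _ < r * (z - t) := by gcongr

/-- Nonnegativity of the variance of g on the unit interval. -/
lemma sq_intervalIntegral_le {g : ℝ → ℝ} (hg : Continuous g) :
    (∫ t in (0 : ℝ)..1, g t) ^ 2 ≤ ∫ t in (0 : ℝ)..1, g t ^ 2 := by
  set a := ∫ t in (0 : ℝ)..1, g t with ha
  have h0 : 0 ≤ ∫ t in (0 : ℝ)..1, (g t - a) ^ 2 :=
    intervalIntegral.integral_nonneg zero_le_one fun t _ => sq_nonneg _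
  have h1 : ∫ t in (0 : ℝ)..1, (g t - a) ^ 2 =
      (∫ t in (0 : ℝ)..1, g t ^ 2) - 2 * a * a + a ^ 2 := by
    have : ∀ t, (g t - a) ^ 2 = g t ^ 2 - 2 * a * g t + a ^ 2 := fun t => by ring
    simp_rw [this]
    rw [intervalIntegral.integral_add, intervalIntegral.integral_sub,
      intervalIntegral.integral_const_mul, ← ha]
    · simp
    all_goals exact (by fun_prop : Continuous _).intervalIntegrable _ _
  nlinarith

lemma enorm_sub_sq_le_lintegral_segment {u : E → ℝ} (hu : ContDiff ℝ 1 u) {T : E → E} {L : ℝ≥0}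
    (hT : LipschitzWith L T) {R : ℝ≥0} {x y : E} (hxy : ‖y - x‖ ≤ R) :
    ‖u (T x) - u (T y)‖ₑ ^ 2 ≤
      ((L * R) ^ 2 : ℝ≥0) * ∫⁻ t in Ioc (0 : ℝ) 1, ‖fderiv ℝ u (T (x + t • (y - x)))‖ₑ ^ 2 := by
  have hγ : LipschitzWith (L * R) fun t : ℝ => T (x + t • (y - x)) := by
    refine hT.comp (LipschitzWith.of_dist_le_mul fun s t => ?_)
    rw [dist_add_left, dist_eq_norm, ← sub_smul, norm_smul, mul_comm, Real.dist_eq,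
      Real.norm_eq_abs]
    gcongr
  have h1 := abs_sub_le_integral_along_curve hu hγ
  have hcu : Continuous fun t : ℝ => ‖fderiv ℝ u (T (x + t • (y - x)))‖ :=
    ((hu.continuous_fderiv (by norm_num)).comp hγ.continuous).norm
  have h2 : (u (T x) - u (T y)) ^ 2 ≤
      ((L * R : ℝ≥0) : ℝ) ^ 2 * ∫ t in (0 : ℝ)..1, ‖fderiv ℝ u (T (x + t • (y - x)))‖ ^ 2 := by
    simp only [one_smul, add_sub_cancel, zero_smul, add_zero] at h1
    rw [intervalIntegral.integral_const_mul] at h1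
    calc (u (T x) - u (T y)) ^ 2 = |u (T y) - u (T x)| ^ 2 := by rw [sq_abs]; ring
      _ ≤ _ := pow_le_pow_left₀ (abs_nonneg _) h1 2
      _ = ((L * R : ℝ≥0) : ℝ) ^ 2 *
          (∫ t in (0 : ℝ)..1, ‖fderiv ℝ u (T (x + t • (y - x)))‖) ^ 2 := by ring
      _ ≤ _ := by
        gcongr
        exact sq_intervalIntegral_le hcu
  have h3 : ∫⁻ t in Ioc (0 : ℝ) 1, ‖fderiv ℝ u (T (x + t • (y - x)))‖ₑ ^ 2 =
      ENNReal.ofReal (∫ t in (0 : ℝ)..1, ‖fderiv ℝ u (T (x + t • (y - x)))‖ ^ 2) := by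
    rw [intervalIntegral.integral_of_le zero_le_one, ofReal_integral_eq_lintegral_ofReal]
    · refine lintegral_congr fun t => ?_
      rw [ENNReal.ofReal_pow (norm_nonneg _), ofReal_norm]
    · exact (hcu.pow 2).integrableOn_Ioc
    · exact ae_of_all _ fun t => by positivity
  rw [h3, ← ofReal_norm, ← ENNReal.ofReal_pow (norm_nonneg _), ← ENNReal.ofReal_coe_nnreal,
    ← ENNReal.ofReal_mul (by positivity)]
  refine ENNReal.ofReal_le_ofReal ?_
  simpa using h2

variable [MeasurableSpace E] [BorelSpace E] [FiniteDimensional ℝ E] (ν : Measure E)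
  [ν.IsAddHaarMeasure]

/-- The contraction y ↦ x + t(y - x) maps the convex set into itself, and its Jacobian is at least
2⁻ⁿ for t ≥ 1/2, with n the dimension. -/
lemma setLIntegral_segment_le {S : Set E} (hS : Convex ℝ S) (hm : MeasurableSet S)
    {G : E → ℝ≥0∞} (hG : Measurable G) {x : E} (hx : x ∈ S) {t : ℝ} (ht : 1 / 2 ≤ t) (ht1 : t ≤ 1) :
    ∫⁻ y in S, G (x + t • (y - x)) ∂ν ≤ 2 ^ Module.finrank ℝ E * ∫⁻ y in S, G y ∂ν := by
  have ht0 : 0 < t := by linarith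
  have hI : Measurable (S.indicator G) := hG.indicator hm
  calc ∫⁻ y in S, G (x + t • (y - x)) ∂ν
      ≤ ∫⁻ y in S, S.indicator G (x + t • (y - x)) ∂ν := by
        refine setLIntegral_mono' hm fun y hy => ?_
        rw [indicator_of_mem]
        exact hS.add_smul_sub_mem hx hy ⟨ht0.le, ht1⟩
    _ ≤ ∫⁻ y, S.indicator G (x + t • (y - x)) ∂ν := setLIntegral_le_lintegral _ _
    _ = ∫⁻ y, S.indicator G ((x - t • x) + t • y) ∂ν := by
        refine lintegral_congr fun y => ?_
        congr 1
        rw [smul_sub]; abel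
    _ = ∫⁻ z, S.indicator G ((x - t • x) + z) ∂(Measure.map (t • ·) ν) := by
        rw [lintegral_map (by fun_prop) (by fun_prop)]
    _ = ENNReal.ofReal |(t ^ Module.finrank ℝ E)⁻¹| * ∫⁻ y in S, G y ∂ν := by
        rw [Measure.map_addHaar_smul ν ht0.ne', lintegral_smul_measure,
          lintegral_add_left_eq_self (μ := ν) (S.indicator G), lintegral_indicator hm, smul_eq_mul]
    _ ≤ _ := by
        gcongr
        rw [← ENNReal.ofReal_ofNat, ← ENNReal.ofReal_pow (by norm_num), ← inv_pow,
          abs_of_pos (by positivity)]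
        refine ENNReal.ofReal_le_ofReal (pow_le_pow_left₀ (by positivity) ?_ _)
        rw [inv_le_comm₀ ht0 (by norm_num)]
        linarith

/-- For each t one endpoint is frozen and the other is the variable of a contraction of ratio t or 1
- t; one of the two ratios is at least 1/2. -/
lemma lintegral_lintegral_segment_le {S : Set E} (hS : Convex ℝ S) (hm : MeasurableSet S)
    {G : E → ℝ≥0∞} (hG : Measurable G) :
    ∫⁻ x in S, ∫⁻ y in S, (∫⁻ t in Ioc (0 : ℝ) 1, G (x + t • (y - x))) ∂ν ∂ν ≤
      2 ^ Module.finrank ℝ E * ν S * ∫⁻ y in S, G y ∂ν := by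
  have hF : Measurable fun p : (E × ℝ) × E => G (p.1.1 + p.1.2 • (p.2 - p.1.1)) := by
    refine hG.comp ?_
    fun_prop
  have e1 : ∀ x, ∫⁻ y in S, (∫⁻ t in Ioc (0 : ℝ) 1, G (x + t • (y - x))) ∂ν =
      ∫⁻ t in Ioc (0 : ℝ) 1, ∫⁻ y in S, G (x + t • (y - x)) ∂ν := fun x =>
    lintegral_lintegral_swap (Measurable.aemeasurable (hG.comp (by fun_prop)))
  simp_rw [e1]
  rw [lintegral_lintegral_swap (f := fun x t => ∫⁻ y in S, G (x + t • (y - x)) ∂ν)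
    hF.lintegral_prod_right'.aemeasurable]
  calc ∫⁻ t in Ioc (0 : ℝ) 1, ∫⁻ x in S, ∫⁻ y in S, G (x + t • (y - x)) ∂ν ∂ν
      ≤ ∫⁻ t in Ioc (0 : ℝ) 1, 2 ^ Module.finrank ℝ E * ν S * ∫⁻ y in S, G y ∂ν := by
        refine setLIntegral_mono' measurableSet_Ioc fun t ht => ?_
        have hconst : ∀ H : E → ℝ≥0∞, (∀ x ∈ S, H x ≤ 2 ^ Module.finrank ℝ E * ∫⁻ y in S, G y ∂ν) →
            ∫⁻ x in S, H x ∂ν ≤ 2 ^ Module.finrank ℝ E * ν S * ∫⁻ y in S, G y ∂ν := fun H hH => by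
          refine (setLIntegral_mono' hm hH).trans_eq ?_
          rw [setLIntegral_const]; ring
        rcases le_total (1 / 2) t with h | h
        · exact hconst _ fun x hx => setLIntegral_segment_le ν hS hm hG hx h ht.2
        -- The contraction in y degenerates as t → 0; here x contracts towards y with ratio 1 - t.
        · rw [lintegral_lintegral_swap (f := fun x y => G (x + t • (y - x)))
            (Measurable.aemeasurable (hG.comp (by fun_prop)))]
          refine hconst _ fun y hy => ?_
          have := setLIntegral_segment_le ν hS hm hG hy (t := 1 - t) (by linarith)
            (by linarith [ht.1])
          refine le_trans (le_of_eq (lintegral_congr fun x => ?_)) this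
          congr 1
          module
    _ = _ := by simp

/-- A Poincaré inequality in two-point form on bounded convex sets, for functions of the form
`u ∘ T` with `u` of class `C¹` and `T` Lipschitz. -/
theorem lintegral_enorm_sub_sq_le {S : Set E} (hS : Convex ℝ S) (hm : MeasurableSet S)
    (hb : Bornology.IsBounded S) {T : E → E} {L : ℝ≥0} (hT : LipschitzWith L T) :
    ∃ C : ℝ≥0, ∀ u : E → ℝ, ContDiff ℝ 1 u →
      ∫⁻ x in S, ∫⁻ y in S, ‖u (T x) - u (T y)‖ₑ ^ 2 ∂ν ∂ν ≤
        C * ∫⁻ y in S, ‖fderiv ℝ u (T y)‖ₑ ^ 2 ∂ν := by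
  obtain ⟨R, hR⟩ := hb.exists_norm_le
  have hfin : ν S ≠ ∞ := hb.measure_lt_top.ne
  -- The image under T of a segment in S has Lipschitz constant at most L times the diameter bound
  -- 2R; the second factor comes from averaging over segments.
  refine ⟨(L * (2 * R.toNNReal)) ^ 2 * (2 ^ Module.finrank ℝ E * (ν S).toNNReal), fun u hu => ?_⟩
  have hG : Measurable fun y => ‖fderiv ℝ u (T y)‖ₑ ^ 2 :=
    (((hu.continuous_fderiv (by norm_num)).comp hT.continuous).measurable.enorm.pow_const 2)
  calc ∫⁻ x in S, ∫⁻ y in S, ‖u (T x) - u (T y)‖ₑ ^ 2 ∂ν ∂ν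
      ≤ ∫⁻ x in S, ∫⁻ y in S, ((L * (2 * R.toNNReal)) ^ 2 : ℝ≥0) *
          (∫⁻ t in Ioc (0 : ℝ) 1, ‖fderiv ℝ u (T (x + t • (y - x)))‖ₑ ^ 2) ∂ν ∂ν := by
        refine setLIntegral_mono' hm fun x hx => setLIntegral_mono' hm fun y hy =>
          enorm_sub_sq_le_lintegral_segment hu hT ?_
        calc ‖y - x‖ ≤ ‖y‖ + ‖x‖ := norm_sub_le _ _
          _ ≤ R + R := add_le_add (hR y hy) (hR x hx)
          _ ≤ (2 * R.toNNReal : ℝ≥0) := by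
            push_cast
            linarith [Real.le_coe_toNNReal R]
    _ = ((L * (2 * R.toNNReal)) ^ 2 : ℝ≥0) * ∫⁻ x in S, ∫⁻ y in S,
          (∫⁻ t in Ioc (0 : ℝ) 1, ‖fderiv ℝ u (T (x + t • (y - x)))‖ₑ ^ 2) ∂ν ∂ν := by
        rw [← lintegral_const_mul' _ _ ENNReal.coe_ne_top]
        refine lintegral_congr fun x => ?_
        rw [lintegral_const_mul' _ _ ENNReal.coe_ne_top]
    _ ≤ ((L * (2 * R.toNNReal)) ^ 2 : ℝ≥0) *
          (2 ^ Module.finrank ℝ E * ν S * ∫⁻ y in S, ‖fderiv ℝ u (T y)‖ₑ ^ 2 ∂ν) := by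
        gcongr
        exact lintegral_lintegral_segment_le ν hS hm hG
    _ = _ := by
        push_cast
        rw [ENNReal.coe_toNNReal hfin]
        ring

end Segments

/-! ### Lipschitz domains -/

section LipschitzDomains

/-- A Lipschitz involution distorts Lebesgue measure by a bounded factor. -/
lemma measure_preimage_le_of_involutive {E : Type*} [NormedAddCommGroup E]
    [NormedSpace ℝ E] [FiniteDimensional ℝ E] [MeasurableSpace E] [BorelSpace E] (ν : Measure E)
    [ν.IsAddHaarMeasure] {K : ℝ≥0} {R : E → E} (hR : LipschitzWith K R)
    (hi : Function.Involutive R) (s : Set E) :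
    ν (R ⁻¹' s) ≤ (K : ℝ≥0∞) ^ Module.finrank ℝ E * ν s := by
  -- Preimages under an involution are images, and Haar measure is a multiple of the Hausdorff
  -- measure, whose growth under Lipschitz maps is controlled.
  rw [← hi.image_eq_preimage_symm,
    Measure.isAddLeftInvariant_eq_smul ν (Measure.hausdorffMeasure (X := E) (Module.finrank ℝ E))]
  simp only [Measure.smul_apply]
  have := hR.hausdorffMeasure_image_le (d := Module.finrank ℝ E) (Nat.cast_nonneg _) s
  rw [ENNReal.rpow_natCast] at this
  rw [mul_smul_comm]
  exact smul_le_smul_of_nonneg_left this zero_le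

variable {d : ℕ}

/-- The height of the graph of `h` over `x`, minus the height of `x`. -/
def graphGap (ν : Space d) (h : Space d → ℝ) (x : Space d) : ℝ :=
  h (x - inner ℝ ν x • ν) - inner ℝ ν x

/-- Moving along ν changes the height but not the projection. This makes the reflection in the graph
explicit. -/
lemma graphGap_add_smul {ν : Space d} (hν : ‖ν‖ = 1) (h : Space d → ℝ) (x : Space d) (t : ℝ) :
    graphGap ν h (x + t • ν) = graphGap ν h x - t := by
  have h1 : inner ℝ ν (x + t • ν) = inner ℝ ν x + t := by
    rw [inner_add_right, inner_smul_right, real_inner_self_eq_norm_sq, hν]; ring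
  rw [graphGap, h1, graphGap]
  have : x + t • ν - (inner ℝ ν x + t) • ν = x - inner ℝ ν x • ν := by module
  rw [this]; ring

lemma exists_lipschitzWith_graphGap (ν : Space d) {h : Space d → ℝ} {K : ℝ≥0}
    (hh : LipschitzWith K h) : ∃ K', LipschitzWith K' (graphGap ν h) := by
  have h1 : LipschitzWith _ fun x : Space d => inner ℝ ν x := (innerSL ℝ ν).lipschitz
  have h2 : LipschitzWith _ fun x : Space d => inner ℝ ν x • ν :=
    ((innerSL ℝ ν).smulRight ν).lipschitz
  exact ⟨_, (hh.comp (LipschitzWith.id.sub h2)).sub h1⟩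

/-- The translates of the graph by ν/(n+1) are pairwise disjoint and the shifts are bounded, which
is possible only for a null set. -/
lemma volume_graphGap_eq_zero {ν : Space d} (hν : ‖ν‖ = 1) {h : Space d → ℝ} {K : ℝ≥0}
    (hh : LipschitzWith K h) : volume {x | graphGap ν h x = 0} = 0 := by
  obtain ⟨K', hK'⟩ := exists_lipschitzWith_graphGap ν hh
  have hm : MeasurableSet {x | graphGap ν h x = 0} :=
    (isClosed_eq hK'.continuous continuous_const).measurableSet
  refine Measure.addHaar_eq_zero_of_disjoint_translates volume
    (fun n : ℕ => (1 / ((n : ℝ) + 1)) • ν) ?_ ?_ hm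
  · have : Tendsto (fun n : ℕ => (1 / ((n : ℝ) + 1)) • ν) atTop (𝓝 ((0 : ℝ) • ν)) :=
      tendsto_one_div_add_atTop_nhds_zero_nat.smul_const ν
    exact Metric.isBounded_range_of_tendsto _ this
  · intro m n hmn
    rw [Function.onFun, Set.disjoint_left]
    rintro x hx hx'
    rw [singleton_add, mem_image] at hx hx'
    obtain ⟨a, ha, rfl⟩ := hx
    obtain ⟨b, hb, hab⟩ := hx'
    apply hmn
    have e1 := congrArg (graphGap ν h) hab
    rw [add_comm, graphGap_add_smul hν, add_comm _ a, graphGap_add_smul hν,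
      show graphGap ν h a = 0 from ha, show graphGap ν h b = 0 from hb] at e1
    have e2 : (1 : ℝ) / (n + 1) = 1 / (m + 1) := by linarith
    rw [div_eq_div_iff (by positivity) (by positivity)] at e2
    have : (m : ℝ) = n := by linarith
    exact_mod_cast this

variable {W : Set (Space d)}

lemma graphGap_eq_zero_of_mem_frontier (hW : IsOpen W) {p ν : Space d} {r : ℝ} {K : ℝ≥0}
    {h : Space d → ℝ} (hh : LipschitzWith K h)
    (hloc : ∀ x ∈ Metric.ball p r, (x ∈ W ↔ h (x - inner ℝ ν x • ν) < inner ℝ ν x))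
    {x : Space d} (hx : x ∈ frontier W) (hxp : x ∈ Metric.ball p r) : graphGap ν h x = 0 := by
  obtain ⟨K', hK'⟩ := exists_lipschitzWith_graphGap ν hh
  rw [hW.frontier_eq] at hx
  have h1 : 0 ≤ graphGap ν h x := by
    have := mt (hloc x hxp).2 hx.2
    rw [graphGap]; linarith
  refine le_antisymm ?_ h1
  by_contra hlt
  push Not at hlt
  have hev : ∀ᶠ y in 𝓝 x, 0 < graphGap ν h y ∧ y ∈ Metric.ball p r :=
    (hK'.continuous.continuousAt.eventually (lt_mem_nhds hlt)).and
      (Metric.isOpen_ball.mem_nhds hxp)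
  obtain ⟨y, hyW, hy⟩ := (mem_closure_iff_frequently.1 hx.1).and_eventually hev |>.exists
  have := (hloc y hy.2).1 hyW
  have h3 := hy.1
  rw [graphGap] at h3
  linarith

lemma volume_frontier_eq_zero (hW : IsOpen W) (hL : HasLipschitzBoundary W) :
    volume (frontier W) = 0 := by
  refine measure_null_of_locally_null _ fun p hp => ?_
  obtain ⟨ν, r, K, h, hν, hr, hh, hloc⟩ := hL p hp
  refine ⟨frontier W ∩ Metric.ball p r,
    inter_mem_nhdsWithin _ (Metric.ball_mem_nhds p hr), ?_⟩
  exact measure_mono_null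
    (fun x hx => graphGap_eq_zero_of_mem_frontier hW hh hloc hx.1 hx.2)
    (volume_graphGap_eq_zero hν hh)

lemma IsInclusion.closure_subset_cell (hW : IsInclusion W) : closure W ⊆ cell d := by
  intro y hy
  by_contra hyc
  obtain ⟨c, hc, hd⟩ := hW.dist_pos
  have hyf : y ∈ frontier (cell d) := by
    rw [(isOpen_cell d).frontier_eq]
    exact ⟨closure_mono hW.subset_cell hy, hyc⟩
  obtain ⟨x, hx, hxy⟩ := Metric.mem_closure_iff.1 hy c hc
  have := hd x hx y hyf
  rw [dist_comm] at this
  linarith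

lemma IsInclusion.isBounded (hW : IsInclusion W) : Bornology.IsBounded W :=
  (isBounded_cell d).subset hW.subset_cell

lemma IsInclusion.isConnected (hW : IsInclusion W) : IsConnected W := by
  have := hW.simplyConnected
  exact isConnected_iff_connectedSpace.2 inferInstance

/-- Almost everywhere on S, g ∘ T is dominated by 1_W g + (1_W g) ∘ R, and the second term is
integrated with the distortion bound for R. -/
lemma setLIntegral_comp_le_of_eq_or_eq {S : Set (Space d)} (hW : MeasurableSet W)
    {R T : Space d → Space d} {c : ℝ≥0} (hRm : Measurable R)
    (hR : ∀ s, MeasurableSet s → volume (R ⁻¹' s) ≤ c * volume s)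
    (hT : ∀ᵐ x, x ∈ S → T x ∈ W ∧ (T x = x ∨ T x = R x)) {g : Space d → ℝ≥0∞}
    (hg : Measurable g) :
    ∫⁻ x in S, g (T x) ≤ (1 + c : ℝ≥0) * ∫⁻ x in W, g x := by
  have hgI : Measurable (W.indicator g) := hg.indicator hW
  calc ∫⁻ x in S, g (T x)
      ≤ ∫⁻ x in S, (W.indicator g x + W.indicator g (R x)) := by
        refine setLIntegral_mono_ae (hgI.add (hgI.comp hRm)).aemeasurable ?_
        filter_upwards [hT] with x hx hxS
        obtain ⟨h1, h2 | h2⟩ := hx hxS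
        · rw [h2] at h1 ⊢
          rw [indicator_of_mem h1]
          exact le_self_add
        · rw [h2] at h1 ⊢
          rw [indicator_of_mem h1]
          exact le_add_self
    _ ≤ ∫⁻ x, (W.indicator g x + W.indicator g (R x)) := setLIntegral_le_lintegral _ _
    _ = (∫⁻ x, W.indicator g x) + ∫⁻ x, W.indicator g x ∂(Measure.map R volume) := by
        rw [lintegral_add_left hgI, lintegral_map hgI hRm]
    _ ≤ (∫⁻ x, W.indicator g x) + ∫⁻ x, W.indicator g x ∂((c : ℝ≥0∞) • volume) := by
        gcongr
        refine Measure.le_iff.2 fun s hs => ?_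
        rw [Measure.map_apply hRm hs]
        exact hR s hs
    _ = _ := by
        rw [lintegral_smul_measure, lintegral_indicator hW, smul_eq_mul]
        push_cast
        ring

/-- Near each point of its closure, a Lipschitz domain is a Lipschitz retract, by reflection in the
boundary, and the retraction distorts Lebesgue measure by a bounded factor. -/
theorem exists_local_retraction (hW : IsOpen W) (hL : HasLipschitzBoundary W) {p : Space d}
    (hp : p ∈ closure W) :
    ∃ (r : ℝ) (T : Space d → Space d) (L C : ℝ≥0), 0 < r ∧ LipschitzWith L T ∧
      (∀ x ∈ W, x ∈ Metric.ball p r → T x = x) ∧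
      (∀ x ∈ Metric.ball p r, x ∉ frontier W → T x ∈ W) ∧
      ∀ g : Space d → ℝ≥0∞, Measurable g →
        ∫⁻ x in Metric.ball p r, g (T x) ≤ C * ∫⁻ x in W, g x := by
  by_cases hpW : p ∈ W
  · obtain ⟨r, hr, hrW⟩ := Metric.isOpen_iff.1 hW p hpW
    refine ⟨r, id, 1, 1, hr, LipschitzWith.id, fun _ _ _ => rfl, fun x hx _ => hrW hx,
      fun g _ => ?_⟩
    rw [ENNReal.coe_one, one_mul]
    exact lintegral_mono_set hrW
  have hpf : p ∈ frontier W := by rw [hW.frontier_eq]; exact ⟨hp, hpW⟩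
  obtain ⟨ν, r, K, h, hν, hr, hh, hloc⟩ := hL p hpf
  obtain ⟨K', hK'⟩ := exists_lipschitzWith_graphGap ν hh
  have hWiff : ∀ x ∈ Metric.ball p r, (x ∈ W ↔ graphGap ν h x < 0) := fun x hx => by
    rw [hloc x hx, graphGap, sub_neg]
  -- the reflection
  obtain ⟨LR, hR⟩ : ∃ LR, LipschitzWith LR fun x : Space d => x + (2 * graphGap ν h x) • ν := by
    have h1 : LipschitzWith _ fun x : Space d => (2 * graphGap ν h x) • ν :=
      ((ContinuousLinearMap.id ℝ ℝ).smulRight ν).lipschitz.comp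
        (((2 : ℝ) • ContinuousLinearMap.id ℝ ℝ).lipschitz.comp hK')
    exact ⟨_, LipschitzWith.id.add h1⟩
  set R : Space d → Space d := fun x => x + (2 * graphGap ν h x) • ν with hRdef
  -- Reflection reverses the sign of the gap, which makes it an involution.
  have hgR : ∀ x, graphGap ν h (R x) = -graphGap ν h x := fun x => by
    rw [hRdef]; simp only; rw [graphGap_add_smul hν]; ring
  have hRinv : Function.Involutive R := fun x => by
    have : R (R x) = R x + (2 * graphGap ν h (R x)) • ν := rfl
    rw [this, hgR, hRdef]; simp only; module
  -- the retraction
  obtain ⟨L, hT⟩ : ∃ L, LipschitzWith L fun x : Space d => x + (2 * max (graphGap ν h x) 0) • ν := by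
    have h1 : LipschitzWith _ fun x : Space d => (2 * max (graphGap ν h x) 0) • ν :=
      ((ContinuousLinearMap.id ℝ ℝ).smulRight ν).lipschitz.comp
        (((2 : ℝ) • ContinuousLinearMap.id ℝ ℝ).lipschitz.comp (hK'.max_const 0))
    exact ⟨_, LipschitzWith.id.add h1⟩
  set T : Space d → Space d := fun x => x + (2 * max (graphGap ν h x) 0) • ν with hTdef
  have hTid : ∀ x, graphGap ν h x ≤ 0 → T x = x := fun x hx => by
    simp [hTdef, max_eq_right hx]
  have hTR : ∀ x, 0 ≤ graphGap ν h x → T x = R x := fun x hx => by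
    simp [hTdef, hRdef, max_eq_left hx]
  have hp0 : graphGap ν h p = 0 :=
    graphGap_eq_zero_of_mem_frontier hW hh hloc hpf (Metric.mem_ball_self hr)
  have hTp : T p = p := hTid p hp0.le
  -- T fixes p, so it maps this smaller ball into the ball where the graph describes W.
  have hr' : 0 < r / (L + 1) := by positivity
  have hsub : r / (L + 1) ≤ r := div_le_self hr.le (by linarith [L.2])
  have hTball : ∀ x ∈ Metric.ball p (r / (L + 1)), T x ∈ Metric.ball p r := fun x hx => by
    rw [Metric.mem_ball] at hx ⊢
    rw [lt_div_iff₀ (by positivity)] at hx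
    calc dist (T x) p = dist (T x) (T p) := by rw [hTp]
      _ ≤ L * dist x p := hT.dist_le_mul _ _
      _ ≤ dist x p * (L + 1) := by nlinarith [dist_nonneg (x := x) (y := p)]
      _ < r := hx
  -- A point of zero gap is the limit of the points x + tν, t ↓ 0, which lie in W; hence it belongs
  -- to the closure.
  have hpos : ∀ x ∈ Metric.ball p r, x ∉ W → x ∉ frontier W → 0 < graphGap ν h x := by
    intro x hx hxW hxf
    have hxc : x ∉ closure W := fun hc => hxf (by rw [hW.frontier_eq]; exact ⟨hc, hxW⟩)
    have h0 : 0 ≤ graphGap ν h x := not_lt.1 (mt (hWiff x hx).2 hxW)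
    refine lt_of_le_of_ne h0 fun h00 => hxc ?_
    have hc : Tendsto (fun t : ℝ => x + t • ν) (𝓝[>] 0) (𝓝 (x + (0 : ℝ) • ν)) :=
      ((continuous_const.add (continuous_id.smul continuous_const)).tendsto 0).mono_left
        nhdsWithin_le_nhds
    rw [zero_smul, add_zero] at hc
    refine mem_closure_of_tendsto hc ?_
    filter_upwards [hc.eventually (Metric.isOpen_ball.mem_nhds hx), self_mem_nhdsWithin]
      with t ht ht0
    rw [hWiff _ ht, graphGap_add_smul hν, ← h00]
    simpa using ht0
  have hTW : ∀ x ∈ Metric.ball p (r / (L + 1)), x ∉ frontier W → T x ∈ W := by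
    intro x hx hxf
    have hxr := Metric.ball_subset_ball hsub hx
    by_cases hxW : x ∈ W
    · rwa [hTid x ((hWiff x hxr).1 hxW).le]
    · have h0 := hpos x hxr hxW hxf
      rw [hWiff _ (hTball x hx), hTR x h0.le, hgR]
      linarith
  -- In the distortion constant, 1 accounts for the points that T fixes and `LR ^ d` for those that
  -- it reflects.
  refine ⟨r / (L + 1), T, L, 1 + LR ^ d, hr', hT, fun x hx hxp =>
    hTid x ((hWiff x (Metric.ball_subset_ball hsub hxp)).1 hx).le, hTW, fun g hg => ?_⟩
  have hae : ∀ᵐ x ∂(volume : Measure (Space d)), x ∉ frontier W :=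
    measure_eq_zero_iff_ae_notMem.1 (volume_frontier_eq_zero hW hL)
  have key := setLIntegral_comp_le_of_eq_or_eq (c := LR ^ d) hW.measurableSet
    hR.continuous.measurable (fun s _ => ?_) (T := T) (S := Metric.ball p (r / (L + 1))) ?_ hg
  · exact key
  · have := measure_preimage_le_of_involutive volume hR hRinv s
    rwa [finrank_euclideanSpace_fin, ← ENNReal.coe_pow] at this
  · filter_upwards [hae] with x hxf hx
    exact ⟨hTW x hx hxf, (le_total (graphGap ν h x) 0).imp (hTid x) (hTR x)⟩

end LipschitzDomains

/-! ### The Poincaré inequality on a connected Lipschitz domain -/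

section DomainPoincare

lemma enorm_sub_sq_le {a b c : ℝ} :
    ‖a - c‖ₑ ^ 2 ≤ 2 * ‖a - b‖ₑ ^ 2 + 2 * ‖b - c‖ₑ ^ 2 := by
  have h : ∀ x : ℝ, ‖x‖ₑ ^ 2 = ENNReal.ofReal (x ^ 2) := fun x => by
    rw [← ofReal_norm, ← ENNReal.ofReal_pow (norm_nonneg _), Real.norm_eq_abs, sq_abs]
  rw [h, h, h, ← ENNReal.ofReal_ofNat, ← ENNReal.ofReal_mul (by norm_num),
    ← ENNReal.ofReal_mul (by norm_num), ← ENNReal.ofReal_add (by positivity) (by positivity)]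
  refine ENNReal.ofReal_le_ofReal ?_
  nlinarith [sq_nonneg (a - b - (b - c))]

/-- Insert an intermediate point y in u(x) - u(z) and integrate over y against β. -/
lemma lintegral_lintegral_sub_sq_trans {X : Type*} [MeasurableSpace X] {α β γ : Measure X}
    [SFinite α] [SFinite β] [SFinite γ] {u : X → ℝ} (hu : Measurable u) :
    β univ * ∫⁻ x, ∫⁻ z, ‖u x - u z‖ₑ ^ 2 ∂γ ∂α ≤
      2 * γ univ * ∫⁻ x, ∫⁻ y, ‖u x - u y‖ₑ ^ 2 ∂β ∂α +
      2 * α univ * ∫⁻ y, ∫⁻ z, ‖u y - u z‖ₑ ^ 2 ∂γ ∂β := by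
  have hm : Measurable fun p : X × X => ‖u p.1 - u p.2‖ₑ ^ 2 := by fun_prop
  have h1 : ∀ (ρ : Measure X) [SFinite ρ], Measurable fun x => ∫⁻ y, ‖u x - u y‖ₑ ^ 2 ∂ρ :=
    fun ρ _ => hm.lintegral_prod_right'
  calc β univ * ∫⁻ x, ∫⁻ z, ‖u x - u z‖ₑ ^ 2 ∂γ ∂α
      = ∫⁻ x, ∫⁻ z, ∫⁻ _y, ‖u x - u z‖ₑ ^ 2 ∂β ∂γ ∂α := by
        simp_rw [lintegral_const]
        rw [← lintegral_const_mul _ (h1 γ)]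
        refine lintegral_congr fun x => ?_
        rw [lintegral_mul_const _ (by fun_prop), mul_comm]
    _ ≤ ∫⁻ x, ∫⁻ z, ∫⁻ y, (2 * ‖u x - u y‖ₑ ^ 2 + 2 * ‖u y - u z‖ₑ ^ 2) ∂β ∂γ ∂α :=
        lintegral_mono fun x => lintegral_mono fun z => lintegral_mono fun y => enorm_sub_sq_le
    _ = ∫⁻ x, (2 * γ univ * ∫⁻ y, ‖u x - u y‖ₑ ^ 2 ∂β +
          2 * ∫⁻ y, ∫⁻ z, ‖u y - u z‖ₑ ^ 2 ∂γ ∂β) ∂α := by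
        refine lintegral_congr fun x => ?_
        have e1 : ∀ z, ∫⁻ y, (2 * ‖u x - u y‖ₑ ^ 2 + 2 * ‖u y - u z‖ₑ ^ 2) ∂β =
            2 * ∫⁻ y, ‖u x - u y‖ₑ ^ 2 ∂β + 2 * ∫⁻ y, ‖u y - u z‖ₑ ^ 2 ∂β := fun z => by
          rw [lintegral_add_left (by fun_prop), lintegral_const_mul _ (by fun_prop),
            lintegral_const_mul _ (by fun_prop)]
        simp_rw [e1]
        rw [lintegral_add_left measurable_const, lintegral_const,
          lintegral_const_mul _ hm.lintegral_prod_left',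
          lintegral_lintegral_swap (f := fun z y => ‖u y - u z‖ₑ ^ 2)
            (hm.comp measurable_swap).aemeasurable]
        ring
    _ = _ := by
        rw [lintegral_add_left ((h1 β).const_mul _), lintegral_const_mul _ (h1 β), lintegral_const]
        ring

variable {d : ℕ} {W : Set (Space d)}

/-- Two-point Poincaré inequality between the parts `S ∩ W` and `S' ∩ W` of `W`. -/
def TwoPointBound (W S S' : Set (Space d)) : Prop :=
  ∃ C : ℝ≥0, ∀ u : Space d → ℝ, ContDiff ℝ 1 u →
    ∫⁻ x in S ∩ W, ∫⁻ y in S' ∩ W, ‖u x - u y‖ₑ ^ 2 ≤ C * ∫⁻ x in W, ‖fderiv ℝ u x‖ₑ ^ 2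

namespace TwoPointBound

variable {S S' S'' : Set (Space d)}

lemma symm (h : TwoPointBound W S S') : TwoPointBound W S' S := by
  obtain ⟨C, hC⟩ := h
  refine ⟨C, fun u hu => ?_⟩
  have hm := hu.continuous.measurable
  rw [lintegral_lintegral_swap (f := fun x y => ‖u x - u y‖ₑ ^ 2)
    (Measurable.aemeasurable (by simp only [Function.uncurry_def]; fun_prop))]
  simpa only [enorm_sub_rev] using hC u hu

lemma mono {Z Z' : Set (Space d)} (h : TwoPointBound W S S') (hZ : Z ⊆ S) (hZ' : Z' ⊆ S') :
    TwoPointBound W Z Z' := by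
  obtain ⟨C, hC⟩ := h
  refine ⟨C, fun u hu => le_trans ?_ (hC u hu)⟩
  refine (lintegral_mono_set (inter_subset_inter_left _ hZ)).trans (lintegral_mono fun x => ?_)
  exact lintegral_mono_set (inter_subset_inter_left _ hZ')

lemma union (h : TwoPointBound W S S'') (h' : TwoPointBound W S' S'') :
    TwoPointBound W (S ∪ S') S'' := by
  obtain ⟨C, hC⟩ := h
  obtain ⟨C', hC'⟩ := h'
  refine ⟨C + C', fun u hu => ?_⟩
  rw [union_inter_distrib_right, ENNReal.coe_add, add_mul]
  exact (lintegral_union_le _ _ _).trans (add_le_add (hC u hu) (hC' u hu))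

/-- The intermediate point is averaged over S' ∩ W, so the constant contains the inverse of its
volume, which must be positive. -/
lemma trans (hW : Bornology.IsBounded W) (h : TwoPointBound W S S') (h' : TwoPointBound W S' S'')
    (h0 : volume (S' ∩ W) ≠ 0) : TwoPointBound W S S'' := by
  obtain ⟨C, hC⟩ := h
  obtain ⟨C', hC'⟩ := h'
  have hfin : ∀ Z : Set (Space d), volume (Z ∩ W) ≠ ∞ := fun Z =>
    (hW.subset inter_subset_right).measure_lt_top.ne
  refine ⟨(volume (S' ∩ W)).toNNReal⁻¹ * (2 * (volume (S'' ∩ W)).toNNReal * C +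
    2 * (volume (S ∩ W)).toNNReal * C'), fun u hu => ?_⟩
  have key := lintegral_lintegral_sub_sq_trans (α := volume.restrict (S ∩ W))
    (β := volume.restrict (S' ∩ W)) (γ := volume.restrict (S'' ∩ W)) hu.continuous.measurable
  simp only [Measure.restrict_apply_univ] at key
  push_cast
  rw [ENNReal.coe_inv (by
    rw [ne_eq, ENNReal.toNNReal_eq_zero_iff]; exact not_or.2 ⟨h0, hfin _⟩),
    ENNReal.coe_toNNReal (hfin _), ENNReal.coe_toNNReal (hfin _), ENNReal.coe_toNNReal (hfin _),
    mul_assoc, ← ENNReal.mul_le_iff_le_inv h0 (hfin _)]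
  refine key.trans ?_
  rw [add_mul, mul_assoc _ (C : ℝ≥0∞), mul_assoc _ (C' : ℝ≥0∞)]
  gcongr
  · exact hC u hu
  · exact hC' u hu

end TwoPointBound

/-- On W near p one has u = u ∘ T. The inequality on the convex ball applies to u ∘ T, and the
distortion bound for T brings the energy back to W. -/
lemma exists_nhds_twoPointBound (hW : IsOpen W) (hL : HasLipschitzBoundary W) {p : Space d}
    (hp : p ∈ closure W) : ∃ U ∈ 𝓝 p, TwoPointBound W U U := by
  obtain ⟨r, T, L, C, hr, hT, hTid, hTW, hC⟩ := exists_local_retraction hW hL hp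
  obtain ⟨C', hC'⟩ := lintegral_enorm_sub_sq_le volume (convex_ball p r) measurableSet_ball
    Metric.isBounded_ball hT
  refine ⟨Metric.ball p r, Metric.ball_mem_nhds p hr, C' * C, fun u hu => ?_⟩
  have hms : MeasurableSet (Metric.ball p r ∩ W) := measurableSet_ball.inter hW.measurableSet
  calc ∫⁻ x in Metric.ball p r ∩ W, ∫⁻ y in Metric.ball p r ∩ W, ‖u x - u y‖ₑ ^ 2
      = ∫⁻ x in Metric.ball p r ∩ W, ∫⁻ y in Metric.ball p r ∩ W, ‖u (T x) - u (T y)‖ₑ ^ 2 := by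
        refine setLIntegral_congr_fun hms fun x hx => setLIntegral_congr_fun hms fun y hy => ?_
        rw [hTid x hx.2 hx.1, hTid y hy.2 hy.1]
    _ ≤ ∫⁻ x in Metric.ball p r, ∫⁻ y in Metric.ball p r, ‖u (T x) - u (T y)‖ₑ ^ 2 :=
        (lintegral_mono_set inter_subset_left).trans
          (lintegral_mono fun x => lintegral_mono_set inter_subset_left)
    _ ≤ C' * ∫⁻ y in Metric.ball p r, ‖fderiv ℝ u (T y)‖ₑ ^ 2 := hC' u hu
    _ ≤ C' * (C * ∫⁻ y in W, ‖fderiv ℝ u y‖ₑ ^ 2) := by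
        gcongr
        exact hC _ ((hu.continuous_fderiv (by norm_num)).measurable.enorm.pow_const 2)
    _ = _ := by push_cast; ring

/-- The existence of a bound between neighbourhoods of two points holds for nearby points, and it is
transitive because neighbourhoods of points of the closure meet W in positive measure. By
connectedness it holds for all pairs, and compactness of the closure leaves finitely many constants.
-/
lemma twoPointBound_self (hW : IsOpen W) (hL : HasLipschitzBoundary W)
    (hb : Bornology.IsBounded W) (hc : IsConnected W) : TwoPointBound W W W := by
  have hpos : ∀ q ∈ closure W, ∀ V ∈ 𝓝 q, volume (V ∩ W) ≠ 0 := by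
    intro q hq V hV
    obtain ⟨O, hOV, hO, hqO⟩ := mem_nhds_iff.1 hV
    have : (O ∩ W).Nonempty := mem_closure_iff.1 hq O hO hqO
    exact (((hO.inter hW).measure_pos volume this).trans_le
      (measure_mono (inter_subset_inter_left _ hOV))).ne'
  have hpair : ∀ p ∈ closure W, ∀ q ∈ closure W,
      ∃ U ∈ 𝓝 p, ∃ V ∈ 𝓝 q, TwoPointBound W U V := by
    intro p hp q hq
    refine hc.closure.isPreconnected.induction₂'
      (fun p q => ∃ U ∈ 𝓝 p, ∃ V ∈ 𝓝 q, TwoPointBound W U V) ?_ ?_ hp hq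
    · intro x hx
      obtain ⟨U, hU, hUU⟩ := exists_nhds_twoPointBound hW hL hx
      filter_upwards [nhdsWithin_le_nhds (eventually_mem_nhds_iff.2 hU)] with y hy
      exact ⟨⟨U, hU, U, hy, hUU⟩, ⟨U, hy, U, hU, hUU⟩⟩
    · rintro x y z hx hy hz ⟨U, hU, V, hV, h1⟩ ⟨V', hV', Z, hZ, h2⟩
      refine ⟨U, hU, Z, hZ, ?_⟩
      exact (h1.mono subset_rfl inter_subset_left).trans hb (h2.mono inter_subset_right subset_rfl)
        (hpos y hy _ (inter_mem hV hV'))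
  have hcomp : IsCompact (closure W) := hb.isCompact_closure
  have hempty : ∀ S : Set (Space d), TwoPointBound W ∅ S := fun S => ⟨0, fun u _ => by simp⟩
  -- Compactness is used one variable at a time: here p is fixed and its neighbourhood shrinks
  -- finitely often.
  have hfix : ∀ p ∈ closure W, ∃ U ∈ 𝓝 p, TwoPointBound W (closure W) U := by
    intro p hp
    refine hcomp.induction_on (p := fun S => ∃ U ∈ 𝓝 p, TwoPointBound W S U)
      ⟨univ, univ_mem, hempty _⟩ ?_ ?_ ?_
    · rintro S S' hSS ⟨U, hU, h⟩
      exact ⟨U, hU, h.mono hSS subset_rfl⟩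
    · rintro S S' ⟨U, hU, h⟩ ⟨U', hU', h'⟩
      exact ⟨U ∩ U', inter_mem hU hU', (h.mono subset_rfl inter_subset_left).union
        (h'.mono subset_rfl inter_subset_right)⟩
    · intro q hq
      obtain ⟨U, hU, V, hV, h⟩ := hpair p hp q hq
      exact ⟨V, mem_nhdsWithin_of_mem_nhds hV, U, hU, h.symm⟩
  have hall : TwoPointBound W (closure W) (closure W) := by
    refine hcomp.induction_on (p := fun S => TwoPointBound W S (closure W)) (hempty _)
      (fun S S' hSS h => h.mono hSS subset_rfl) (fun S S' h h' => h.union h') fun p hp => ?_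
    obtain ⟨U, hU, h⟩ := hfix p hp
    exact ⟨U, mem_nhdsWithin_of_mem_nhds hU, h.symm⟩
  exact hall.mono subset_closure subset_closure

/-- The Poincaré inequality on a bounded connected Lipschitz domain, for `C¹` functions. -/
theorem exists_poincare (hW : IsOpen W) (hL : HasLipschitzBoundary W)
    (hb : Bornology.IsBounded W) (hc : IsConnected W) :
    ∃ C : ℝ≥0, ∀ u : Space d → ℝ, ContDiff ℝ 1 u → ∃ c : ℝ,
      ∫⁻ x in W, ‖u x - c‖ₑ ^ 2 ≤ C * ∫⁻ x in W, ‖fderiv ℝ u x‖ₑ ^ 2 := by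
  obtain ⟨C, hC⟩ := twoPointBound_self hW hL hb hc
  have h0 : volume W ≠ 0 := (hW.measure_pos volume hc.nonempty).ne'
  have hfin : volume W ≠ ∞ := hb.measure_lt_top.ne
  refine ⟨(volume W).toNNReal⁻¹ * C, fun u hu => ?_⟩
  have h1 := hC u hu
  simp only [inter_self] at h1
  -- If the double integral is infinite, so is the right side of the two-point bound, and any c will
  -- do.
  by_cases htop : ∫⁻ x in W, ∫⁻ y in W, ‖u x - u y‖ₑ ^ 2 = ∞
  · refine ⟨0, ?_⟩
    rw [htop, top_le_iff] at h1
    push_cast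
    rw [mul_assoc, h1, ENNReal.mul_top]
    · exact le_top
    · simp [ENNReal.toNNReal_eq_zero_iff, hfin, h0]
  have hm := hu.continuous.measurable
  have hm' : Measurable fun p : Space d × Space d => ‖u p.1 - u p.2‖ₑ ^ 2 := by fun_prop
  -- Some x does no worse than the average; its value u(x) serves as the constant c.
  obtain ⟨x, -, hx⟩ := exists_le_setLAverage h0 hfin
    (f := fun x => ∫⁻ y in W, ‖u x - u y‖ₑ ^ 2) hm'.lintegral_prod_right'.aemeasurable
  refine ⟨u x, ?_⟩
  rw [setLAverage_eq, ENNReal.div_eq_inv_mul] at hx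
  simp_rw [enorm_sub_rev _ (u x)]
  refine hx.trans ?_
  push_cast
  rw [ENNReal.coe_inv (by
    rw [ne_eq, ENNReal.toNNReal_eq_zero_iff]; exact not_or.2 ⟨h0, hfin⟩),
    ENNReal.coe_toNNReal hfin, mul_assoc]
  gcongr

end DomainPoincare

/-! ### Extension of functions from a Lipschitz domain -/

section Extension

lemma lipschitzWith_mul_of_bounded {X : Type*} [PseudoMetricSpace X] {f g : X → ℝ}
    {K K' M M' : ℝ≥0} (hf : LipschitzWith K f) (hg : LipschitzWith K' g) (hfM : ∀ x, |f x| ≤ M)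
    (hgM : ∀ x, |g x| ≤ M') : LipschitzWith (M * K' + M' * K) fun x => f x * g x := by
  refine LipschitzWith.of_dist_le_mul fun x y => ?_
  have h1 := hf.dist_le_mul x y
  have h2 := hg.dist_le_mul x y
  rw [Real.dist_eq] at h1 h2 ⊢
  calc |f x * g x - f y * g y| = |f x * (g x - g y) + g y * (f x - f y)| := by ring_nf
    _ ≤ |f x| * |g x - g y| + |g y| * |f x - f y| := by
        rw [← abs_mul, ← abs_mul]; exact abs_add_le _ _
    _ ≤ M * (K' * dist x y) + M' * (K * dist x y) := by
        gcongr
        · exact hfM x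
        · exact hgM y
    _ = _ := by push_cast; ring

variable {d : ℕ} {W : Set (Space d)}

/-- The density of the squared `H¹` norm. -/
def energyDensity (v : Space d → ℝ) (x : Space d) : ℝ≥0 := ‖v x‖₊ ^ 2 + ‖fderiv ℝ v x‖₊ ^ 2

lemma measurable_energyDensity {v : Space d → ℝ} (hv : Measurable v) :
    Measurable (energyDensity v) :=
  (hv.nnnorm.pow_const 2).add ((measurable_fderiv ℝ v).nnnorm.pow_const 2)

lemma energyDensity_add_le {v w : Space d → ℝ} {x : Space d} (hv : DifferentiableAt ℝ v x)
    (hw : DifferentiableAt ℝ w x) :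
    energyDensity (fun y => v y + w y) x ≤ 2 * (energyDensity v x + energyDensity w x) := by
  have h1 := norm_add_le (v x) (w x)
  have h2 := norm_add_le (fderiv ℝ v x) (fderiv ℝ w x)
  rw [energyDensity, fderiv_fun_add hv hw]
  simp only [energyDensity, ← NNReal.coe_le_coe]
  push_cast
  nlinarith [pow_le_pow_left₀ (norm_nonneg _) h1 2, pow_le_pow_left₀ (norm_nonneg _) h2 2,
    sq_nonneg (‖v x‖ - ‖w x‖), sq_nonneg (‖fderiv ℝ v x‖ - ‖fderiv ℝ w x‖)]

lemma energyDensity_mul_le {v w : Space d → ℝ} {x : Space d} (hv : DifferentiableAt ℝ v x)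
    (hw : DifferentiableAt ℝ w x) {M : ℝ≥0} (h0 : ‖v x‖ ≤ M) (h1 : ‖fderiv ℝ v x‖ ≤ M) :
    energyDensity (fun y => v y * w y) x ≤ 3 * M ^ 2 * energyDensity w x := by
  have e1 : ‖fderiv ℝ (fun y => v y * w y) x‖ ≤ M * (‖fderiv ℝ w x‖ + ‖w x‖) := by
    rw [fderiv_fun_mul hv hw]
    refine (norm_add_le _ _).trans ?_
    rw [norm_smul, norm_smul]
    nlinarith [mul_le_mul_of_nonneg_right h0 (norm_nonneg (fderiv ℝ w x)),
      mul_le_mul_of_nonneg_right h1 (norm_nonneg (w x))]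
  have e2 : ‖v x * w x‖ ≤ M * ‖w x‖ := by
    rw [norm_mul]; gcongr
  simp only [energyDensity, ← NNReal.coe_le_coe]
  push_cast
  have e1' := pow_le_pow_left₀ (norm_nonneg _) e1 2
  have e2' := pow_le_pow_left₀ (norm_nonneg _) e2 2
  nlinarith [mul_nonneg (sq_nonneg (M : ℝ)) (sq_nonneg (‖fderiv ℝ w x‖ - ‖w x‖)),
    mul_nonneg (sq_nonneg (M : ℝ)) (sq_nonneg ‖fderiv ℝ w x‖)]

lemma energyDensity_comp_le {u : Space d → ℝ} {T : Space d → Space d} {L : ℝ≥0}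
    (hT : LipschitzWith L T) {x : Space d} (hu : DifferentiableAt ℝ u (T x))
    (hTx : DifferentiableAt ℝ T x) :
    energyDensity (fun y => u (T y)) x ≤ (1 + L ^ 2) * energyDensity u (T x) := by
  have e1 : ‖fderiv ℝ (fun y => u (T y)) x‖ ≤ ‖fderiv ℝ u (T x)‖ * L := by
    rw [fderiv_fun_comp x hu hTx]
    refine (ContinuousLinearMap.opNorm_comp_le _ _).trans ?_
    gcongr
    exact norm_fderiv_le_of_lipschitz ℝ hT
  simp only [energyDensity, ← NNReal.coe_le_coe]
  push_cast
  have e1' := pow_le_pow_left₀ (norm_nonneg _) e1 2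
  nlinarith [mul_nonneg (sq_nonneg (L : ℝ)) (sq_nonneg ‖u (T x)‖), sq_nonneg ‖fderiv ℝ u (T x)‖]

lemma exists_bound_of_contDiff_of_hasCompactSupport {φ : Space d → ℝ} (h : ContDiff ℝ 1 φ)
    (hs : HasCompactSupport φ) :
    ∃ M : ℝ≥0, (∀ x, ‖φ x‖ ≤ M) ∧ (∀ x, ‖fderiv ℝ φ x‖ ≤ M) ∧ LipschitzWith M φ := by
  obtain ⟨M, hM⟩ := hs.exists_bound_of_continuous h.continuous
  obtain ⟨M', hM'⟩ := (hs.fderiv ℝ).exists_bound_of_continuous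
    (h.continuous_fderiv (by norm_num))
  have h2 : ∀ x, ‖fderiv ℝ φ x‖ ≤ (max M M').toNNReal := fun x =>
    ((hM' x).trans (le_max_right _ _)).trans (Real.le_coe_toNNReal _)
  exact ⟨(max M M').toNNReal, fun x =>
    ((hM x).trans (le_max_left _ _)).trans (Real.le_coe_toNNReal _), h2,
    lipschitzWith_of_nnnorm_fderiv_le (h.differentiable (by norm_num)) fun x => by
      exact_mod_cast h2 x⟩

/-- Functions cut off to a neighbourhood of `S` extend from `W` to compactly supported Lipschitz
functions on the unit cell, with a bound for the `H¹` norm. -/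
def HasLocalExtension (W S : Set (Space d)) : Prop :=
  ∃ φ : Space d → ℝ, ContDiff ℝ 1 φ ∧ HasCompactSupport φ ∧ (∀ x ∈ S, φ x = 1) ∧
    ∃ C : ℝ≥0, ∀ u : Space d → ℝ, ContDiff ℝ 1 u → (∃ K, LipschitzWith K u) →
      ∃ v : Space d → ℝ, (∃ K, LipschitzWith K v) ∧ HasCompactSupport v ∧ tsupport v ⊆ cell d ∧
        (∀ x ∈ W, v x = φ x * u x) ∧
        ∫⁻ x, energyDensity v x ≤ C * ∫⁻ x in W, energyDensity u x

lemma HasLocalExtension.empty : HasLocalExtension W ∅ :=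
  ⟨0, contDiff_const, HasCompactSupport.zero, by simp, 0, fun u _ _ =>
    ⟨0, ⟨0, LipschitzWith.const 0⟩, HasCompactSupport.zero, by simp [tsupport], by simp,
      by simp [energyDensity]⟩⟩

/-- The cutoff φ + (1 - φ)φ' equals 1 on both sets, and v + (1 - φ)v' is the corresponding
extension. Energies are compared almost everywhere, where the Lipschitz functions are
differentiable. -/
lemma HasLocalExtension.union {S S' : Set (Space d)} (h : HasLocalExtension W S)
    (h' : HasLocalExtension W S') : HasLocalExtension W (S ∪ S') := by
  obtain ⟨φ, hφ, hφs, hφ1, C, hC⟩ := h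
  obtain ⟨φ', hφ', hφs', hφ1', C', hC'⟩ := h'
  obtain ⟨M, hM, hM', hML⟩ := exists_bound_of_contDiff_of_hasCompactSupport hφ hφs
  have hψ : ContDiff ℝ 1 fun x => 1 - φ x := contDiff_const.sub hφ
  have hψM : ∀ x, ‖1 - φ x‖ ≤ (1 + M : ℝ≥0) := fun x => by
    push_cast
    exact (norm_sub_le _ _).trans (add_le_add (by simp) (hM x))
  have hψM' : ∀ x, ‖fderiv ℝ (fun y => 1 - φ y) x‖ ≤ (1 + M : ℝ≥0) := fun x => by
    rw [fderiv_const_sub, norm_neg]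
    push_cast
    linarith [hM' x]
  have hψL : LipschitzWith (0 + M) fun x => 1 - φ x := (LipschitzWith.const 1).sub hML
  refine ⟨fun x => φ x + (1 - φ x) * φ' x, hφ.add (hψ.mul hφ'), hφs.add hφs'.mul_left, ?_,
    2 * (1 + 3 * (1 + M) ^ 2) * (C + C'), fun u hu hK => ?_⟩
  · rintro x (hx | hx)
    · simp [hφ1 x hx]
    · simp [hφ1' x hx]
  obtain ⟨v, ⟨K, hv⟩, hvs, hvc, hvW, hvC⟩ := hC u hu hK
  obtain ⟨v', ⟨K', hv'⟩, hvs', hvc', hvW', hvC'⟩ := hC' u hu hK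
  obtain ⟨B, hB⟩ := hvs'.exists_bound_of_continuous hv'.continuous
  have hprod := lipschitzWith_mul_of_bounded hψL hv' hψM (M' := B.toNNReal)
    fun x => (hB x).trans (Real.le_coe_toNNReal _)
  refine ⟨fun x => v x + (1 - φ x) * v' x, ⟨_, hv.add hprod⟩, hvs.add hvs'.mul_left, ?_, ?_, ?_⟩
  · refine (tsupport_add v _).trans (union_subset hvc ?_)
    exact (tsupport_mul_subset_right (f := fun x => 1 - φ x) (g := v')).trans hvc'
  · intro x hx
    simp only [hvW x hx, hvW' x hx]; ring
  · have hae : ∀ᵐ x, energyDensity (fun x => v x + (1 - φ x) * v' x) x ≤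
        2 * (1 + 3 * (1 + M) ^ 2) * (energyDensity v x + energyDensity v' x) := by
      filter_upwards [hv.ae_differentiableAt, hv'.ae_differentiableAt] with x hx hx'
      have hψx : DifferentiableAt ℝ (fun y => 1 - φ y) x := (hψ.differentiable (by norm_num)) x
      have e1 := energyDensity_add_le hx (hψx.mul hx')
      have e2 := energyDensity_mul_le hψx hx' (hψM x) (hψM' x)
      calc _ ≤ _ := e1
        _ ≤ 2 * (energyDensity v x + 3 * (1 + M) ^ 2 * energyDensity v' x) := by gcongr; exact e2
        _ ≤ 2 * (energyDensity v x + 3 * (1 + M) ^ 2 * energyDensity v' x) +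
            2 * (3 * (1 + M) ^ 2 * energyDensity v x + energyDensity v' x) := le_self_add
        _ = _ := by ring
    calc ∫⁻ x, energyDensity (fun x => v x + (1 - φ x) * v' x) x
        ≤ ∫⁻ x, ((2 * (1 + 3 * (1 + M) ^ 2) : ℝ≥0) : ℝ≥0∞) *
            ((energyDensity v x : ℝ≥0∞) + energyDensity v' x) := by
          refine lintegral_mono_ae ?_
          filter_upwards [hae] with x hx
          exact_mod_cast hx
      _ = ((2 * (1 + 3 * (1 + M) ^ 2) : ℝ≥0) : ℝ≥0∞) *
            ((∫⁻ x, energyDensity v x) + ∫⁻ x, energyDensity v' x) := by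
          rw [lintegral_const_mul' _ _ ENNReal.coe_ne_top, lintegral_add_left
            (measurable_energyDensity hv.continuous.measurable).coe_nnreal_ennreal]
      _ ≤ ((2 * (1 + 3 * (1 + M) ^ 2) : ℝ≥0) : ℝ≥0∞) *
            (C * (∫⁻ x in W, energyDensity u x) + C' * ∫⁻ x in W, energyDensity u x) := by gcongr
      _ = _ := by push_cast; ring

/-- The extension is φ · (u ∘ T), with T the local retraction and φ a bump function. In the
constant, 3M² comes from the product rule, 1 + L² from the chain rule and C from the distortion of
volume. -/
lemma exists_nhds_hasLocalExtension (hW : IsOpen W) (hL : HasLipschitzBoundary W)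
    (hcl : closure W ⊆ cell d) {p : Space d} (hp : p ∈ closure W) :
    ∃ S ∈ 𝓝 p, HasLocalExtension W S := by
  obtain ⟨r, T, L, C, hr, hT, hTid, hTW, hC⟩ := exists_local_retraction hW hL hp
  obtain ⟨r', hr', hrc⟩ := Metric.isOpen_iff.1 (isOpen_cell d) p (hcl hp)
  have hρ : 0 < min r r' / 2 := by positivity
  -- The support lies both where T retracts onto W and inside the unit cell.
  let φ : ContDiffBump p := ⟨min r r' / 2 / 2, min r r' / 2, half_pos hρ, half_lt_self hρ⟩
  have hφ : ContDiff ℝ 1 φ := φ.contDiff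
  obtain ⟨M, hM, hM', hML⟩ := exists_bound_of_contDiff_of_hasCompactSupport hφ φ.hasCompactSupport
  have hsupp : tsupport φ ⊆ Metric.ball p (min r r') := by
    rw [φ.tsupport_eq]
    exact Metric.closedBall_subset_ball (half_lt_self (by positivity))
  have hsr : tsupport φ ⊆ Metric.ball p r :=
    hsupp.trans (Metric.ball_subset_ball (min_le_left _ _))
  have hzero : ∀ x, x ∉ Metric.ball p r → φ x = 0 := fun x hx =>
    image_eq_zero_of_notMem_tsupport fun h => hx (hsr h)
  refine ⟨Metric.closedBall p φ.rIn, Metric.closedBall_mem_nhds _ φ.rIn_pos, φ, hφ,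
    φ.hasCompactSupport, fun x hx => φ.one_of_mem_closedBall hx, 3 * M ^ 2 * (1 + L ^ 2) * C,
    fun u hu hK => ?_⟩
  obtain ⟨K, hK⟩ := hK
  have huT : LipschitzWith (K * L) fun x => u (T x) := hK.comp hT
  obtain ⟨B, hB⟩ := (isCompact_closedBall p r).exists_bound_of_continuousOn
    huT.continuous.continuousOn
  have hB0 : 0 ≤ B := (norm_nonneg _).trans (hB p (Metric.mem_closedBall_self hr.le))
  refine ⟨fun x => φ x * u (T x), ?_, φ.hasCompactSupport.mul_right, ?_, ?_, ?_⟩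
  -- The function u ∘ T may be unbounded, and products of Lipschitz functions need bounds.
  -- Truncating it at ±B changes nothing on the support of φ.
  · have hclip : LipschitzWith (K * L) fun x => max (min (u (T x)) B) (-B) :=
      (huT.min_const B).max_const (-B)
    have := lipschitzWith_mul_of_bounded hML hclip (fun x => hM x) (M' := B.toNNReal) fun x => by
      rw [Real.coe_toNNReal _ hB0, abs_le]
      exact ⟨le_max_right _ _, max_le (min_le_right _ _) (by linarith)⟩
    have heq : (fun x => φ x * max (min (u (T x)) B) (-B)) = fun x => φ x * u (T x) := by
      ext x
      by_cases hx : x ∈ Metric.ball p r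
      · have := abs_le.1 (hB x (Metric.ball_subset_closedBall hx))
        rw [min_eq_left this.2, max_eq_left this.1]
      · rw [hzero x hx, zero_mul, zero_mul]
    exact ⟨M * (K * L) + B.toNNReal * M, heq ▸ this⟩
  · exact ((tsupport_mul_subset_left (f := φ) (g := fun x => u (T x))).trans hsupp).trans
      ((Metric.ball_subset_ball (min_le_right _ _)).trans hrc)
  · intro x hx
    by_cases hxr : x ∈ Metric.ball p r
    · simp only [hTid x hx hxr]
    · simp only [hzero x hxr, zero_mul]
  · have hmE : Measurable fun x => (energyDensity u x : ℝ≥0∞) :=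
      (measurable_energyDensity hu.continuous.measurable).coe_nnreal_ennreal
    have hae : ∀ᵐ x, (energyDensity (fun x => φ x * u (T x)) x : ℝ≥0∞) ≤
        (Metric.ball p r).indicator
          (fun x => ((3 * M ^ 2 * (1 + L ^ 2) : ℝ≥0) : ℝ≥0∞) * energyDensity u (T x)) x := by
      filter_upwards [hT.ae_differentiableAt] with x hx
      by_cases hxr : x ∈ Metric.ball p r
      · rw [indicator_of_mem hxr]
        have hux : DifferentiableAt ℝ u (T x) := (hu.differentiable (by norm_num)) _
        have e1 := energyDensity_mul_le ((hφ.differentiable (by norm_num)) x)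
          (hux.fun_comp' x hx) (hM x) (hM' x)
        have e2 := energyDensity_comp_le hT hux hx
        have : energyDensity (fun x => φ x * u (T x)) x ≤
            3 * M ^ 2 * (1 + L ^ 2) * energyDensity u (T x) := by
          refine e1.trans ?_
          rw [mul_assoc (3 * M ^ 2)]
          gcongr
        exact_mod_cast this
      · have hx0 : (fun x => φ x * u (T x)) =ᶠ[𝓝 x] fun _ => 0 := by
          have : x ∉ tsupport φ := fun h => hxr (hsr h)
          filter_upwards [notMem_tsupport_iff_eventuallyEq.1 this] with y hy
          rw [hy]; simp
        have e0 : energyDensity (fun x => φ x * u (T x)) x = 0 := by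
          rw [energyDensity, hx0.fderiv_eq, hx0.eq_of_nhds]
          simp
        rw [e0]
        simp
    calc ∫⁻ x, energyDensity (fun x => φ x * u (T x)) x
        ≤ ∫⁻ x in Metric.ball p r,
            ((3 * M ^ 2 * (1 + L ^ 2) : ℝ≥0) : ℝ≥0∞) * energyDensity u (T x) := by
          rw [← lintegral_indicator measurableSet_ball]
          exact lintegral_mono_ae hae
      _ = ((3 * M ^ 2 * (1 + L ^ 2) : ℝ≥0) : ℝ≥0∞) *
            ∫⁻ x in Metric.ball p r, energyDensity u (T x) :=
          lintegral_const_mul' _ _ ENNReal.coe_ne_top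
      _ ≤ ((3 * M ^ 2 * (1 + L ^ 2) : ℝ≥0) : ℝ≥0∞) * (C * ∫⁻ x in W, energyDensity u x) := by
          gcongr
          exact hC _ hmE
      _ = _ := by push_cast; ring

lemma hasLocalExtension_closure (hW : IsOpen W) (hL : HasLipschitzBoundary W)
    (hcl : closure W ⊆ cell d) : HasLocalExtension W (closure W) := by
  have hcomp : IsCompact (closure W) :=
    ((isBounded_cell d).subset (subset_closure.trans hcl)).isCompact_closure
  refine hcomp.induction_on HasLocalExtension.empty ?_ (fun _ _ => HasLocalExtension.union) ?_
  · rintro S S' hS ⟨φ, h1, h2, h3, h4⟩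
    exact ⟨φ, h1, h2, fun x hx => h3 x (hS hx), h4⟩
  · intro p hp
    obtain ⟨S, hS, h⟩ := exists_nhds_hasLocalExtension hW hL hcl hp
    exact ⟨S, mem_nhdsWithin_of_mem_nhds hS, h⟩

/-- Up to a constant, `C¹` functions extend from `W` to compactly supported Lipschitz functions on
the unit cell, with a bound for the Dirichlet energy. -/
theorem exists_extension (hW : IsInclusion W) :
    ∃ C : ℝ≥0, ∀ u : Space d → ℝ, ContDiff ℝ 1 u → (∃ K, LipschitzWith K u) →
      ∃ v : Space d → ℝ, (∃ K, LipschitzWith K v) ∧ HasCompactSupport v ∧ tsupport v ⊆ cell d ∧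
        (∀ x ∈ W, fderiv ℝ v x = fderiv ℝ u x) ∧
        ∫⁻ x, ‖fderiv ℝ v x‖ₑ ^ 2 ≤ C * ∫⁻ x in W, ‖fderiv ℝ u x‖ₑ ^ 2 := by
  obtain ⟨φ, -, -, hφ, C, hC⟩ := hasLocalExtension_closure hW.isOpen hW.lipschitz
    hW.closure_subset_cell
  obtain ⟨C', hC'⟩ := exists_poincare hW.isOpen hW.lipschitz hW.isBounded hW.isConnected
  refine ⟨C * (C' + 1), fun u hu ⟨K, hK⟩ => ?_⟩
  -- Extending u - c instead of u, the zero-order part of the H¹ norm is absorbed by the Poincaré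
  -- inequality, and gradients on W are unaffected.
  obtain ⟨c, hc⟩ := hC' u hu
  obtain ⟨v, hvL, hvs, hvc, hvW, hvC⟩ := hC (fun x => u x - c) (hu.sub contDiff_const)
    ⟨_, hK.sub (LipschitzWith.const c)⟩
  refine ⟨v, hvL, hvs, hvc, fun x hx => ?_, ?_⟩
  · have : v =ᶠ[𝓝 x] fun y => u y - c := by
      filter_upwards [hW.isOpen.mem_nhds hx] with y hy
      rw [hvW y hy, hφ y (subset_closure hy), one_mul]
    rw [this.fderiv_eq, fderiv_sub_const]
  · have e : ∀ (w : Space d → ℝ) x, (energyDensity w x : ℝ≥0∞) =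
        ‖w x‖ₑ ^ 2 + ‖fderiv ℝ w x‖ₑ ^ 2 := fun w x => by
      rw [energyDensity]; push_cast; rfl
    have hm : Measurable fun x => ‖u x - c‖ₑ ^ 2 :=
      ((hu.continuous.sub continuous_const).measurable.enorm.pow_const 2)
    calc ∫⁻ x, ‖fderiv ℝ v x‖ₑ ^ 2 ≤ ∫⁻ x, energyDensity v x :=
          lintegral_mono fun x => by rw [e]; exact le_add_self
      _ ≤ _ := hvC
      _ = C * ((∫⁻ x in W, ‖u x - c‖ₑ ^ 2) + ∫⁻ x in W, ‖fderiv ℝ u x‖ₑ ^ 2) := by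
          rw [← lintegral_add_left hm]
          simp_rw [e, fderiv_sub_const]
      _ ≤ C * (C' * (∫⁻ x in W, ‖fderiv ℝ u x‖ₑ ^ 2) + ∫⁻ x in W, ‖fderiv ℝ u x‖ₑ ^ 2) := by
          gcongr
      _ = _ := by push_cast; ring

end Extension

/-! ### Periodic Sobolev functions -/

section PeriodicSobolev

variable {d : ℕ}

lemma cellMeasure_ae_mem (d : ℕ) : ∀ᵐ y ∂(cellMeasure d), y ∈ cell d :=
  ae_restrict_mem (measurableSet_cell d)

lemma integrable_mul_of_memLp_two {X : Type*} [MeasurableSpace X] {ν : Measure X} {f g : X → ℝ}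
    (hf : MemLp f 2 ν) (hg : MemLp g 2 ν) : Integrable (fun y => f y * g y) ν :=
  hf.integrable_mul hg

lemma integral_mul_congr_left {X : Type*} [MeasurableSpace X] {ν : Measure X} {f g : X → ℝ}
    (h : f =ᵐ[ν] g) (φ : X → ℝ) : ∫ y, f y * φ y ∂ν = ∫ y, g y * φ y ∂ν :=
  integral_congr_ae (h.mono fun y hy => by simp only [hy])

lemma isPeriodic_const {V : Type*} (c : V) : IsPeriodic (fun _ : Space d => c) := fun _ _ => rfl

lemma IsPeriodic.add {f g : Space d → ℝ} (hf : IsPeriodic f) (hg : IsPeriodic g) :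
    IsPeriodic fun y => f y + g y := fun n y => by simp only [hf n y, hg n y]

lemma IsPeriodic.sub {f g : Space d → ℝ} (hf : IsPeriodic f) (hg : IsPeriodic g) :
    IsPeriodic fun y => f y - g y := fun n y => by simp only [hf n y, hg n y]

lemma IsPeriodic.mul {f g : Space d → ℝ} (hf : IsPeriodic f) (hg : IsPeriodic g) :
    IsPeriodic fun y => f y * g y := fun n y => by simp only [hf n y, hg n y]

lemma IsPeriodic.memLp_two_of_contDiff {φ : Space d → ℝ} (hφ : IsPeriodic φ)
    (h : ContDiff ℝ (⊤ : ℕ∞) φ) : MemLp φ 2 (cellMeasure d) := hφ.memLp h.continuous 2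

lemma contDiff_one_of_top {φ : Space d → ℝ} (h : ContDiff ℝ (⊤ : ℕ∞) φ) : ContDiff ℝ 1 φ :=
  h.of_le (by exact_mod_cast le_top)

lemma contDiff_pderiv {φ : Space d → ℝ} (h : ContDiff ℝ (⊤ : ℕ∞) φ) (k : Fin d) :
    ContDiff ℝ (⊤ : ℕ∞) (pderiv k φ) :=
  (h.fderiv_right (m := (⊤ : ℕ∞)) (by simp)).clm_apply contDiff_const

lemma IsPeriodic.memLp_two_pderiv {φ : Space d → ℝ} (hφ : IsPeriodic φ)
    (h : ContDiff ℝ (⊤ : ℕ∞) φ) (k : Fin d) : MemLp (HighContrast.pderiv k φ) 2 (cellMeasure d) :=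
  (hφ.pderiv k).memLp (contDiff_pderiv h k).continuous 2

namespace IsPerH1

variable {u v : Space d → ℝ} {Du Dv : Fin d → Space d → ℝ}

lemma add (hu : IsPerH1 u Du) (hv : IsPerH1 v Dv) :
    IsPerH1 (fun y => u y + v y) (fun k y => Du k y + Dv k y) where
  periodic := hu.periodic.add hv.periodic
  periodic_grad k := (hu.periodic_grad k).add (hv.periodic_grad k)
  memLp := hu.memLp.add hv.memLp
  memLp_grad k := (hu.memLp_grad k).add (hv.memLp_grad k)
  weak_grad k φ hφ hp := by
    have m1 := hp.memLp_two_of_contDiff hφ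
    have m2 := hp.memLp_two_pderiv hφ k
    simp_rw [add_mul]
    rw [integral_add (integrable_mul_of_memLp_two hu.memLp m2)
        (integrable_mul_of_memLp_two hv.memLp m2),
      integral_add (integrable_mul_of_memLp_two (hu.memLp_grad k) m1)
        (integrable_mul_of_memLp_two (hv.memLp_grad k) m1),
      hu.weak_grad k φ hφ hp, hv.weak_grad k φ hφ hp, neg_add]

lemma const_mul (c : ℝ) (hu : IsPerH1 u Du) :
    IsPerH1 (fun y => c * u y) (fun k y => c * Du k y) where
  periodic := (isPeriodic_const c).mul hu.periodic
  periodic_grad k := (isPeriodic_const c).mul (hu.periodic_grad k)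
  memLp := hu.memLp.const_mul c
  memLp_grad k := (hu.memLp_grad k).const_mul c
  weak_grad k φ hφ hp := by
    simp_rw [mul_assoc]
    rw [integral_const_mul, integral_const_mul, hu.weak_grad k φ hφ hp, mul_neg]

end IsPerH1

/-- Average over the translations by t e_k, 0 ≤ t ≤ 1, which do not change the integral. By Fubini
the inner integral is g(y + e_k) - g(y) = 0. -/
lemma IsPeriodic.integral_pderiv {g : Space d → ℝ} (hg : IsPeriodic g) (hc : ContDiff ℝ 1 g)
    (k : Fin d) : ∫ y, HighContrast.pderiv k g y ∂(cellMeasure d) = 0 := by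
  set e : Space d := EuclideanSpace.single k 1 with he
  have hcp := continuous_pderiv hc k
  obtain ⟨C, hC⟩ := (hg.pderiv k).exists_norm_le hcp
  have h1 : ∀ y, ∫ t in (0 : ℝ)..1, HighContrast.pderiv k g (y + t • e) = 0 := by
    intro y
    have hd : ∀ t ∈ uIcc (0 : ℝ) 1, HasDerivAt (fun t : ℝ => g (y + t • e))
        (HighContrast.pderiv k g (y + t • e)) t := by
      intro t _
      have h2 : HasDerivAt (fun t : ℝ => y + t • e) e t := by
        simpa using ((hasDerivAt_id t).smul_const e).const_add y
      exact ((hc.differentiable (by norm_num)) _).hasFDerivAt.comp_hasDerivAt t h2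
    rw [intervalIntegral.integral_eq_sub_of_hasDerivAt hd
      ((hcp.comp (by fun_prop)).intervalIntegrable _ _)]
    have : (1 : ℝ) • e = latticeVec (Pi.single k 1) := by
      ext i
      by_cases h : i = k
      · subst h; simp [he, latticeVec]
      · simp [he, latticeVec, h]
    rw [this, hg, zero_smul, add_zero, sub_self]
  have h2 : ∫ t in (0 : ℝ)..1, ∫ y, HighContrast.pderiv k g (y + t • e) ∂(cellMeasure d) =
      ∫ y, HighContrast.pderiv k g y ∂(cellMeasure d) := by
    simp_rw [(hg.pderiv k).integral_comp_add hcp]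
    simp
  have h3 : ∫ t in (0 : ℝ)..1, ∫ y, HighContrast.pderiv k g (y + t • e) ∂(cellMeasure d) =
      ∫ y, (∫ t in (0 : ℝ)..1, HighContrast.pderiv k g (y + t • e)) ∂(cellMeasure d) := by
    simp_rw [intervalIntegral.integral_of_le zero_le_one]
    refine integral_integral_swap ?_
    have hcont : Continuous fun p : ℝ × Space d => HighContrast.pderiv k g (p.2 + p.1 • e) :=
      hcp.comp (by fun_prop)
    exact Integrable.of_bound hcont.aestronglyMeasurable C (ae_of_all _ fun p => hC _)
  rw [← h2, h3]
  simp [h1]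

/-- Smooth periodic functions belong to the periodic Sobolev space. -/
lemma isPerH1_of_contDiff {φ : Space d → ℝ} (hp : IsPeriodic φ) (h : ContDiff ℝ (⊤ : ℕ∞) φ) :
    IsPerH1 φ fun k => pderiv k φ where
  periodic := hp
  periodic_grad := hp.pderiv
  memLp := hp.memLp_two_of_contDiff h
  memLp_grad := hp.memLp_two_pderiv h
  weak_grad k ψ hψ hψp := by
    have h0 := (hp.mul hψp).integral_pderiv (contDiff_one_of_top (h.mul hψ)) k
    have h1 : ∀ y, pderiv k (fun y => φ y * ψ y) y =
        φ y * pderiv k ψ y + pderiv k φ y * ψ y := fun y => by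
      have := fderiv_fun_mul ((contDiff_one_of_top h).differentiable (by norm_num) y)
        ((contDiff_one_of_top hψ).differentiable (by norm_num) y)
      rw [pderiv, this]
      simp [pderiv]; ring
    simp_rw [h1] at h0
    rw [integral_add (integrable_mul_of_memLp_two (hp.memLp_two_of_contDiff h)
      (hψp.memLp_two_pderiv hψ k))
      (integrable_mul_of_memLp_two (hp.memLp_two_pderiv h k) (hψp.memLp_two_of_contDiff hψ))] at h0
    linarith

lemma pderiv_const (k : Fin d) (c : ℝ) : pderiv k (fun _ : Space d => c) = fun _ => 0 := by
  ext y; simp [pderiv]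

lemma isPerH1_const (c : ℝ) : IsPerH1 (fun _ : Space d => c) fun _ _ => 0 := by
  have := isPerH1_of_contDiff (isPeriodic_const (d := d) c) contDiff_const
  simpa only [pderiv_const] using this

lemma IsPerH1.congr {u v : Space d → ℝ} {Du Dv : Fin d → Space d → ℝ} (hu : IsPerH1 u Du)
    (hv : IsPeriodic v) (hDv : ∀ k, IsPeriodic (Dv k)) (h : u =ᵐ[cellMeasure d] v)
    (hD : ∀ k, Du k =ᵐ[cellMeasure d] Dv k) : IsPerH1 v Dv where
  periodic := hv
  periodic_grad := hDv
  memLp := (memLp_congr_ae h).1 hu.memLp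
  memLp_grad k := (memLp_congr_ae (hD k)).1 (hu.memLp_grad k)
  weak_grad k φ hφ hp := by
    have := hu.weak_grad k φ hφ hp
    rwa [integral_mul_congr_left h, integral_mul_congr_left (hD k)] at this

/-- Compactly supported Lipschitz functions on the cell define periodic Sobolev functions. -/
lemma isPerH1_periodize_of_lipschitzWith {v : Space d → ℝ} {K : ℝ≥0} (hv : LipschitzWith K v)
    (hs : HasCompactSupport v) (hc : tsupport v ⊆ cell d) :
    IsPerH1 (periodize v) fun k => periodize (pderiv k v) := by
  have hz : ∀ x, x ∉ cell d → v x = 0 := fun x hx =>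
    image_eq_zero_of_notMem_tsupport fun h => hx (hc h)
  have hzD : ∀ x, x ∉ cell d → fderiv ℝ v x = 0 := fun x hx => by
    have : x ∉ tsupport v := fun h => hx (hc h)
    rw [(notMem_tsupport_iff_eventuallyEq.1 this).fderiv_eq]
    exact fderiv_const_apply _
  obtain ⟨B, hB⟩ := hs.exists_bound_of_continuous hv.continuous
  have hDm : ∀ k, Measurable (pderiv k v) := fun k =>
    (measurable_fderiv_apply_const ℝ v (EuclideanSpace.single k 1))
  have hDb : ∀ k x, ‖pderiv k v x‖ ≤ K := fun k x => by
    have h1 := (fderiv ℝ v x).le_opNorm (EuclideanSpace.single k 1)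
    have h2 : ‖(EuclideanSpace.single k 1 : Space d)‖ = 1 := by simp
    rw [h2, mul_one] at h1
    exact h1.trans (norm_fderiv_le_of_lipschitz ℝ hv)
  have hmv : MemLp v 2 (cellMeasure d) :=
    MemLp.of_bound hv.continuous.aestronglyMeasurable B (ae_of_all _ hB)
  have hmD : ∀ k, MemLp (pderiv k v) 2 (cellMeasure d) := fun k =>
    MemLp.of_bound (hDm k).aestronglyMeasurable K (ae_of_all _ (hDb k))
  refine ⟨isPeriodic_periodize _, fun k => isPeriodic_periodize _,
    (memLp_congr_ae (periodize_ae_eq _)).2 hmv,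
    fun k => (memLp_congr_ae (periodize_ae_eq _)).2 (hmD k), fun k φ hφ hp => ?_⟩
  rw [integral_mul_congr_left (periodize_ae_eq v),
    integral_mul_congr_left (periodize_ae_eq (pderiv k v))]
  obtain ⟨Kφ, hKφ⟩ := hp.exists_lipschitzWith (contDiff_one_of_top hφ)
  -- Integration by parts on the whole space; v is supported in the cell, so the integrals over the
  -- cell are integrals over the whole space.
  have key := LipschitzWith.integral_lineDeriv_mul_eq (μ := volume) hKφ hv hs
    (EuclideanSpace.single k 1)
  rw [cellMeasure, setIntegral_eq_integral_of_forall_compl_eq_zero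
    (fun x hx => by rw [hz x hx, zero_mul]), setIntegral_eq_integral_of_forall_compl_eq_zero
    (fun x hx => by rw [pderiv, hzD x hx]; simp)]
  have e1 : ∀ x, lineDeriv ℝ φ x (EuclideanSpace.single k 1) * v x = v x * pderiv k φ x :=
    fun x => by
      rw [((contDiff_one_of_top hφ).differentiable (by norm_num) x).lineDeriv_eq_fderiv,
        mul_comm, pderiv]
  have e2 : ∀ᵐ x, lineDeriv ℝ v x (-EuclideanSpace.single k 1) * φ x = -(pderiv k v x * φ x) := by
    filter_upwards [hv.ae_differentiableAt] with x hx
    rw [hx.lineDeriv_eq_fderiv, map_neg, pderiv, neg_mul]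
  rw [integral_congr_ae (ae_of_all _ e1), integral_congr_ae e2, integral_neg] at key
  exact key

end PeriodicSobolev

/-! ### The Hilbert space of periodic Sobolev functions -/

section HilbertSpace

variable {d : ℕ}

/-- Square integrable functions on the cell. -/
abbrev CellL2 (d : ℕ) : Type := Lp ℝ 2 (cellMeasure d)

/-- Tuples `(u, ∂₁u, …, ∂_d u)` of square integrable functions on the cell. -/
abbrev JetSpace (d : ℕ) : Type := PiLp 2 (fun _ : Option (Fin d) => CellL2 d)

lemma CellL2.inner_eq (f g : CellL2 d) :
    inner ℝ f g = ∫ y, f y * g y ∂(cellMeasure d) := by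
  rw [L2.inner_def]
  exact integral_congr_ae (ae_of_all _ fun y => by simp [mul_comm])

lemma CellL2.inner_toLp (f : CellL2 d) {φ : Space d → ℝ} (hφ : MemLp φ 2 (cellMeasure d)) :
    inner ℝ f (hφ.toLp φ) = ∫ y, f y * φ y ∂(cellMeasure d) := by
  rw [CellL2.inner_eq]
  refine integral_congr_ae ?_
  filter_upwards [hφ.coeFn_toLp] with y hy
  rw [hy]

lemma CellL2.norm_sq_eq (f : CellL2 d) : ‖f‖ ^ 2 = ∫ y, f y ^ 2 ∂(cellMeasure d) := by
  rw [← real_inner_self_eq_norm_sq, CellL2.inner_eq]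
  simp_rw [sq]

lemma norm_toLp_sq {φ : Space d → ℝ} (hφ : MemLp φ 2 (cellMeasure d)) :
    ‖hφ.toLp φ‖ ^ 2 = ∫ y, φ y ^ 2 ∂(cellMeasure d) := by
  rw [CellL2.norm_sq_eq]
  refine integral_congr_ae ?_
  filter_upwards [hφ.coeFn_toLp] with y hy
  rw [hy]

/-- The periodic Sobolev functions, as a subspace of the space of jets. -/
def perSobolev (d : ℕ) : Submodule ℝ (JetSpace d) where
  carrier := {U | ∀ (k : Fin d) (φ : Space d → ℝ) (hφ : ContDiff ℝ (⊤ : ℕ∞) φ)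
    (hp : IsPeriodic φ), inner ℝ (U none) ((hp.memLp_two_pderiv hφ k).toLp (pderiv k φ)) +
      inner ℝ (U (some k)) ((hp.memLp_two_of_contDiff hφ).toLp φ) = 0}
  add_mem' {U V} hU hV k φ hφ hp := by
    have h1 := hU k φ hφ hp
    have h2 := hV k φ hφ hp
    simp only [PiLp.add_apply, inner_add_left]
    linarith
  zero_mem' k φ hφ hp := by simp
  smul_mem' c U hU k φ hφ hp := by
    have h1 := hU k φ hφ hp
    simp only [PiLp.smul_apply, real_inner_smul_left]
    rw [← mul_add, h1, mul_zero]

lemma isClosed_perSobolev (d : ℕ) : IsClosed (perSobolev d : Set (JetSpace d)) := by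
  have : (perSobolev d : Set (JetSpace d)) = ⋂ (k : Fin d) (φ : Space d → ℝ)
      (hφ : ContDiff ℝ (⊤ : ℕ∞) φ) (hp : IsPeriodic φ),
      {U | inner ℝ (U none) ((hp.memLp_two_pderiv hφ k).toLp (pderiv k φ)) +
        inner ℝ (U (some k)) ((hp.memLp_two_of_contDiff hφ).toLp φ) = 0} := by
    ext U; simp [perSobolev]
  rw [this]
  refine isClosed_iInter fun k => isClosed_iInter fun φ => isClosed_iInter fun hφ =>
    isClosed_iInter fun hp => isClosed_eq ?_ continuous_const
  exact ((PiLp.continuous_apply 2 _ none).inner continuous_const).add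
    ((PiLp.continuous_apply 2 _ (some k)).inner continuous_const)

/-- Jets are only classes of functions on the cell; periodization supplies representatives on the
whole space. -/
lemma isPerH1_of_mem_perSobolev {U : JetSpace d} (hU : U ∈ perSobolev d) :
    IsPerH1 (periodize (U none)) fun k => periodize (U (some k)) where
  periodic := isPeriodic_periodize _
  periodic_grad _ := isPeriodic_periodize _
  memLp := (memLp_congr_ae (periodize_ae_eq _)).2 (Lp.memLp _)
  memLp_grad _ := (memLp_congr_ae (periodize_ae_eq _)).2 (Lp.memLp _)
  weak_grad k φ hφ hp := by
    have := hU k φ hφ hp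
    rw [CellL2.inner_toLp, CellL2.inner_toLp] at this
    rw [integral_mul_congr_left (periodize_ae_eq _), integral_mul_congr_left (periodize_ae_eq _)]
    linarith

namespace IsPerH1

variable {u : Space d → ℝ} {Du : Fin d → Space d → ℝ}

/-- The element of the jet space given by a Sobolev function. -/
def jet (h : IsPerH1 u Du) : JetSpace d :=
  WithLp.toLp 2 fun o => o.elim (h.memLp.toLp u) fun k => (h.memLp_grad k).toLp (Du k)

lemma jet_none (h : IsPerH1 u Du) : h.jet none = h.memLp.toLp u := rfl

lemma jet_some (h : IsPerH1 u Du) (k : Fin d) :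
    h.jet (some k) = (h.memLp_grad k).toLp (Du k) := rfl

lemma jet_mem (h : IsPerH1 u Du) : h.jet ∈ perSobolev d := by
  intro k φ hφ hp
  rw [CellL2.inner_toLp, CellL2.inner_toLp, jet_none, jet_some,
    integral_mul_congr_left h.memLp.coeFn_toLp, integral_mul_congr_left (h.memLp_grad k).coeFn_toLp,
    h.weak_grad k φ hφ hp]
  ring

lemma integral_grad_mul_trig (h : IsPerH1 u Du) (k : Fin d) (n : Fin d → ℤ) (θ : ℝ) :
    ∫ y, Du k y * trig n θ y ∂(cellMeasure d) =
      -(2 * Real.pi * n k) * ∫ y, u y * trig n (θ + Real.pi / 2) y ∂(cellMeasure d) := by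
  have := h.weak_grad k _ (contDiff_trig n θ) (isPeriodic_trig n θ)
  rw [pderiv_trig] at this
  rw [eq_neg_iff_add_eq_zero.2 (neg_eq_iff_add_eq_zero.1 this.symm), ← integral_const_mul,
    ← integral_neg]
  exact integral_congr_ae (ae_of_all _ fun y => by simp only; ring) |>.symm

end IsPerH1

lemma trig_add_pi (n : Fin d → ℤ) (θ : ℝ) (y : Space d) :
    trig n (θ + Real.pi / 2 + Real.pi / 2) y = -trig n θ y := by
  rw [add_assoc, add_halves, trig, ← add_assoc, Real.cos_add_pi, trig]

lemma isPerH1_trig (n : Fin d → ℤ) (θ : ℝ) : IsPerH1 (trig n θ) fun k => pderiv k (trig n θ) :=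
  isPerH1_of_contDiff (isPeriodic_trig n θ) (contDiff_trig n θ)

/-- The span of the trigonometric functions. -/
def trigSpan (d : ℕ) : Submodule ℝ (JetSpace d) :=
  Submodule.span ℝ (Set.range fun p : (Fin d → ℤ) × ℝ => (isPerH1_trig p.1 p.2).jet)

lemma trigSpan_le : trigSpan d ≤ perSobolev d := by
  rw [trigSpan, Submodule.span_le]
  rintro _ ⟨p, rfl⟩
  exact (isPerH1_trig p.1 p.2).jet_mem

/-- The H¹ pairing with a trigonometric function is (1 + Σ_k (2πn_k)²) times the L² pairing, so all
Fourier coefficients of u vanish, and with them those of its gradient. -/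
lemma IsPerH1.eq_zero_of_inner_trig {u : Space d → ℝ} {Du : Fin d → Space d → ℝ}
    (h : IsPerH1 u Du) (h0 : ∀ n θ, inner ℝ h.jet (isPerH1_trig n θ).jet = 0) : h.jet = 0 := by
  have key : ∀ n θ, ∫ y, u y * trig n θ y ∂(cellMeasure d) = 0 := by
    intro n θ
    have h1 := h0 n θ
    rw [PiLp.inner_apply, Fintype.sum_option] at h1
    simp only [jet_none, jet_some, CellL2.inner_toLp] at h1
    rw [integral_mul_congr_left h.memLp.coeFn_toLp] at h1
    -- One phase shift by π/2 comes from ∂_k of the test function and one from the integration by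
    -- parts; together they change the sign and cancel the minus of the latter.
    have h2 : ∀ k, ∫ y, ((h.memLp_grad k).toLp (Du k)) y * pderiv k (trig n θ) y ∂(cellMeasure d) =
        (2 * Real.pi * n k) ^ 2 * ∫ y, u y * trig n θ y ∂(cellMeasure d) := by
      intro k
      rw [integral_mul_congr_left (h.memLp_grad k).coeFn_toLp, pderiv_trig]
      have e1 : ∀ y, Du k y * (2 * Real.pi * n k * trig n (θ + Real.pi / 2) y) =
          (2 * Real.pi * n k) * (Du k y * trig n (θ + Real.pi / 2) y) := fun y => by ring
      simp_rw [e1]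
      rw [integral_const_mul, h.integral_grad_mul_trig]
      simp_rw [trig_add_pi, mul_neg]
      rw [integral_neg]
      ring
    simp_rw [h2] at h1
    rw [← Finset.sum_mul, ← one_add_mul] at h1
    refine (mul_eq_zero.1 h1).resolve_left ?_
    positivity
  have hu : u =ᵐ[cellMeasure d] 0 := ae_eq_zero_of_integral_mul_trig h.memLp key
  have hDu : ∀ k, Du k =ᵐ[cellMeasure d] 0 := fun k =>
    ae_eq_zero_of_integral_mul_trig (h.memLp_grad k) fun n θ => by
      rw [h.integral_grad_mul_trig, key, mul_zero]
  ext1 o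
  cases o with
  | none =>
    rw [jet_none, PiLp.zero_apply]
    exact Lp.ext (h.memLp.coeFn_toLp.trans (hu.trans (Lp.coeFn_zero _ _ _).symm))
  | some k =>
    rw [jet_some, PiLp.zero_apply]
    exact Lp.ext ((h.memLp_grad k).coeFn_toLp.trans ((hDu k).trans (Lp.coeFn_zero _ _ _).symm))

lemma jet_isPerH1_of_mem {U : JetSpace d} (hU : U ∈ perSobolev d) :
    (isPerH1_of_mem_perSobolev hU).jet = U := by
  ext1 o
  cases o with
  | none =>
    exact Lp.ext ((MemLp.coeFn_toLp (isPerH1_of_mem_perSobolev hU).memLp).trans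
      (periodize_ae_eq _))
  | some k =>
    exact Lp.ext ((MemLp.coeFn_toLp ((isPerH1_of_mem_perSobolev hU).memLp_grad k)).trans
      (periodize_ae_eq _))

/-- The trigonometric functions span a dense subspace of the periodic Sobolev space. -/
theorem trigSpan_topologicalClosure : (trigSpan d).topologicalClosure = perSobolev d := by
  refine le_antisymm (Submodule.topologicalClosure_minimal _ trigSpan_le (isClosed_perSobolev d))
    fun U hU => ?_
  set K := (trigSpan d).topologicalClosure with hK
  have hcK : CompleteSpace K := (Submodule.isClosed_topologicalClosure _).completeSpace_coe
  have hKle : K ≤ perSobolev d :=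
    Submodule.topologicalClosure_minimal _ trigSpan_le (isClosed_perSobolev d)
  -- The orthogonal remainder Z is itself Sobolev and has zero pairing with every trigonometric
  -- function.
  obtain ⟨P, hP, Z, hZ, rfl⟩ := Submodule.exists_add_mem_mem_orthogonal (K := K) U
  have hZm : Z ∈ perSobolev d := by
    have := (perSobolev d).sub_mem hU (hKle hP)
    simpa using this
  have hZ0 : Z = 0 := by
    rw [← jet_isPerH1_of_mem hZm]
    refine IsPerH1.eq_zero_of_inner_trig _ fun n θ => ?_
    rw [jet_isPerH1_of_mem hZm]
    have hmem : (isPerH1_trig n θ).jet ∈ K :=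
      Submodule.le_topologicalClosure _ (Submodule.subset_span ⟨(n, θ), rfl⟩)
    exact Submodule.inner_left_of_mem_orthogonal hmem hZ
  rw [hZ0, add_zero]
  exact hP

lemma exists_contDiff_of_mem_trigSpan {U : JetSpace d} (hU : U ∈ trigSpan d) :
    ∃ (φ : Space d → ℝ) (hφ : ContDiff ℝ (⊤ : ℕ∞) φ) (hp : IsPeriodic φ),
      U = (isPerH1_of_contDiff hp hφ).jet := by
  refine Submodule.span_induction ?_ ?_ ?_ ?_ hU
  · rintro _ ⟨p, rfl⟩
    exact ⟨_, contDiff_trig p.1 p.2, isPeriodic_trig p.1 p.2, rfl⟩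
  · refine ⟨fun _ => 0, contDiff_const, isPeriodic_const 0, ?_⟩
    ext1 o
    cases o with
    | none =>
      rw [PiLp.zero_apply, IsPerH1.jet_none]
      exact (MemLp.toLp_zero _).symm
    | some k =>
      have h0 := (isPerH1_of_contDiff (isPeriodic_const (d := d) (0 : ℝ)) contDiff_const).memLp_grad k
      rw [PiLp.zero_apply, IsPerH1.jet_some, eq_comm, Lp.eq_zero_iff_ae_eq_zero]
      filter_upwards [h0.coeFn_toLp] with y hy
      rw [hy, pderiv_const]
      rfl
  · rintro U V - - ⟨φ, hφ, hp, rfl⟩ ⟨ψ, hψ, hq, rfl⟩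
    refine ⟨fun y => φ y + ψ y, hφ.add hψ, hp.add hq, ?_⟩
    ext1 o
    cases o with
    | none =>
      rw [PiLp.add_apply, IsPerH1.jet_none, IsPerH1.jet_none, ← MemLp.toLp_add]; rfl
    | some k =>
      rw [PiLp.add_apply, IsPerH1.jet_some, IsPerH1.jet_some, IsPerH1.jet_some, ← MemLp.toLp_add]
      refine MemLp.toLp_congr _ _ (ae_of_all _ fun y => ?_)
      rw [pderiv, fderiv_fun_add ((contDiff_one_of_top hφ).differentiable (by norm_num) y)
        ((contDiff_one_of_top hψ).differentiable (by norm_num) y)]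
      rfl
  · rintro c U - ⟨φ, hφ, hp, rfl⟩
    refine ⟨fun y => c * φ y, contDiff_const.mul hφ, (isPeriodic_const c).mul hp, ?_⟩
    ext1 o
    cases o with
    | none =>
      rw [PiLp.smul_apply, IsPerH1.jet_none, IsPerH1.jet_none, ← MemLp.toLp_const_smul]; rfl
    | some k =>
      rw [PiLp.smul_apply, IsPerH1.jet_some, IsPerH1.jet_some, ← MemLp.toLp_const_smul]
      refine MemLp.toLp_congr _ _ (ae_of_all _ fun y => ?_)
      rw [pderiv, fderiv_const_mul ((contDiff_one_of_top hφ).differentiable (by norm_num) y)]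
      rfl

/-- Smooth periodic functions are dense in the periodic Sobolev space. -/
theorem IsPerH1.exists_contDiff_approx {u : Space d → ℝ} {Du : Fin d → Space d → ℝ}
    (h : IsPerH1 u Du) {ε : ℝ} (hε : 0 < ε) :
    ∃ φ : Space d → ℝ, ContDiff ℝ (⊤ : ℕ∞) φ ∧ IsPeriodic φ ∧
      ∑ k, ∫ y, (Du k y - pderiv k φ y) ^ 2 ∂(cellMeasure d) ≤ ε := by
  have hmem : h.jet ∈ closure (trigSpan d : Set (JetSpace d)) := by
    rw [← Submodule.topologicalClosure_coe, trigSpan_topologicalClosure]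
    exact h.jet_mem
  obtain ⟨U, hU, hdist⟩ := Metric.mem_closure_iff.1 hmem (√ε) (Real.sqrt_pos.2 hε)
  obtain ⟨φ, hφ, hp, rfl⟩ := exists_contDiff_of_mem_trigSpan hU
  refine ⟨φ, hφ, hp, ?_⟩
  have h1 : ‖h.jet - (isPerH1_of_contDiff hp hφ).jet‖ ^ 2 ≤ ε := by
    rw [dist_eq_norm] at hdist
    calc _ ≤ √ε ^ 2 := pow_le_pow_left₀ (norm_nonneg _) hdist.le 2
      _ = ε := Real.sq_sqrt hε.le
  rw [PiLp.norm_sq_eq_of_L2, Fintype.sum_option] at h1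
  refine le_trans (le_of_eq (Finset.sum_congr rfl fun k _ => ?_))
    ((le_add_of_nonneg_left (sq_nonneg _)).trans h1)
  rw [PiLp.sub_apply, jet_some, jet_some, ← MemLp.toLp_sub, norm_toLp_sq]
  rfl

end HilbertSpace

/-! ### Poincaré inequality and weak solutions on the torus -/

section WeakSolutions

variable {d : ℕ}

lemma norm_sq_eq_sum_apply_single (L : Space d →L[ℝ] ℝ) :
    ‖L‖ ^ 2 = ∑ k, L (EuclideanSpace.single k 1) ^ 2 := by
  set v := (InnerProductSpace.toDual ℝ (Space d)).symm L with hv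
  have h1 : ‖L‖ = ‖v‖ := ((InnerProductSpace.toDual ℝ (Space d)).symm.norm_map L).symm
  rw [h1, EuclideanSpace.norm_sq_eq]
  refine Finset.sum_congr rfl fun k _ => ?_
  rw [← InnerProductSpace.toDual_symm_apply (𝕜 := ℝ) (y := L), ← hv,
    EuclideanSpace.inner_single_right]
  simp

lemma lintegral_enorm_sq_eq {X : Type*} [MeasurableSpace X] {ν : Measure X} {f : X → ℝ}
    (hf : MemLp f 2 ν) : ∫⁻ x, ‖f x‖ₑ ^ 2 ∂ν = ENNReal.ofReal (∫ x, f x ^ 2 ∂ν) := by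
  rw [ofReal_integral_eq_lintegral_ofReal hf.integrable_sq (ae_of_all _ fun x => sq_nonneg _)]
  refine lintegral_congr fun x => ?_
  rw [← ofReal_norm, ← ENNReal.ofReal_pow (norm_nonneg _), Real.norm_eq_abs, sq_abs]

lemma integral_pderiv_sq_eq {ν : Measure (Space d)} {v : Space d → ℝ}
    (h : ∀ k, MemLp (pderiv k v) 2 ν) :
    ENNReal.ofReal (∑ k, ∫ y, pderiv k v y ^ 2 ∂ν) = ∫⁻ y, ‖fderiv ℝ v y‖ₑ ^ 2 ∂ν := by
  rw [← integral_finsetSum _ fun k _ => (h k).integrable_sq, ofReal_integral_eq_lintegral_ofReal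
    (integrable_finsetSum _ fun k _ => (h k).integrable_sq)
    (ae_of_all _ fun y => Finset.sum_nonneg fun k _ => sq_nonneg _)]
  refine lintegral_congr fun y => ?_
  rw [← ofReal_norm, ← ENNReal.ofReal_pow (norm_nonneg _), norm_sq_eq_sum_apply_single]
  rfl

lemma integral_quadratic {X : Type*} [MeasurableSpace X] {ν : Measure X} [IsProbabilityMeasure ν]
    {f : X → ℝ} (hf : MemLp f 2 ν) (a b c : ℝ) :
    ∫ x, (a * f x ^ 2 + b * f x + c) ∂ν = a * ∫ x, f x ^ 2 ∂ν + b * ∫ x, f x ∂ν + c := by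
  have h1 : Integrable (fun x => a * f x ^ 2) ν := hf.integrable_sq.const_mul a
  have h2 : Integrable (fun x => b * f x) ν := (hf.integrable (by norm_num)).const_mul b
  have h3 : Integrable (fun x => a * f x ^ 2 + b * f x) ν := h1.add h2
  rw [integral_add h3 (integrable_const c), integral_add h1 h2, integral_const_mul,
    integral_const_mul]
  simp

/-- The cell has unit volume, so the left side of the two-point inequality is twice the variance of
φ. -/
lemma exists_poincare_contDiff (d : ℕ) :
    ∃ C : ℝ, 0 ≤ C ∧ ∀ φ : Space d → ℝ, ContDiff ℝ (⊤ : ℕ∞) φ → IsPeriodic φ →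
      ∫ y, φ y ^ 2 ∂(cellMeasure d) ≤ (∫ y, φ y ∂(cellMeasure d)) ^ 2 +
        C * ∑ k, ∫ y, pderiv k φ y ^ 2 ∂(cellMeasure d) := by
  obtain ⟨C, hC⟩ := lintegral_enorm_sub_sq_le (volume : Measure (Space d)) (convex_cell d)
    (measurableSet_cell d) (isBounded_cell d) LipschitzWith.id
  refine ⟨C, C.coe_nonneg, fun φ hφ hp => ?_⟩
  have h := hC φ (contDiff_one_of_top hφ)
  simp only [id] at h
  change ∫⁻ x, ∫⁻ y, ‖φ x - φ y‖ₑ ^ 2 ∂(cellMeasure d) ∂(cellMeasure d) ≤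
    C * ∫⁻ y, ‖fderiv ℝ φ y‖ₑ ^ 2 ∂(cellMeasure d) at h
  have hφ2 := hp.memLp_two_of_contDiff hφ
  have hφ1 : Integrable φ (cellMeasure d) := hφ2.integrable (by norm_num)
  set m := ∫ y, φ y ∂(cellMeasure d) with hm
  set s := ∫ y, φ y ^ 2 ∂(cellMeasure d) with hs
  have e0 : ∀ x, ∫ y, (φ x - φ y) ^ 2 ∂(cellMeasure d) = φ x ^ 2 - 2 * m * φ x + s := fun x => by
    have : ∀ y, (φ x - φ y) ^ 2 = 1 * φ y ^ 2 + (-2 * φ x) * φ y + φ x ^ 2 := fun y => by ring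
    simp_rw [this]
    rw [integral_quadratic hφ2]
    ring
  have e1 : ∀ x, ∫⁻ y, ‖φ x - φ y‖ₑ ^ 2 ∂(cellMeasure d) =
      ENNReal.ofReal (1 * φ x ^ 2 + (-2 * m) * φ x + s) := fun x => by
    rw [lintegral_enorm_sq_eq (f := fun y => φ x - φ y) ((memLp_const (φ x)).sub hφ2), e0]
    congr 1; ring
  have i1 : Integrable (fun x => 1 * φ x ^ 2 + (-2 * m) * φ x + s) (cellMeasure d) :=
    ((hφ2.integrable_sq.const_mul _).add (hφ1.const_mul _)).add (integrable_const _)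
  have e2 : ∫⁻ x, ∫⁻ y, ‖φ x - φ y‖ₑ ^ 2 ∂(cellMeasure d) ∂(cellMeasure d) =
      ENNReal.ofReal (2 * (s - m ^ 2)) := by
    simp_rw [e1]
    rw [← ofReal_integral_eq_lintegral_ofReal i1]
    · rw [integral_quadratic hφ2, ← hm, ← hs]
      congr 1; ring
    · refine ae_of_all _ fun x => ?_
      have h0 : 0 ≤ ∫ y, (φ x - φ y) ^ 2 ∂(cellMeasure d) := integral_nonneg fun y => sq_nonneg _
      rw [e0] at h0
      simp only [Pi.zero_apply]
      linarith
  have e3 := integral_pderiv_sq_eq (ν := cellMeasure d) fun k => hp.memLp_two_pderiv hφ k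
  have hnn : 0 ≤ ∑ k, ∫ y, pderiv k φ y ^ 2 ∂(cellMeasure d) :=
    Finset.sum_nonneg fun k _ => integral_nonneg fun y => sq_nonneg _
  rw [e2, ← e3, ← ENNReal.ofReal_coe_nnreal, ← ENNReal.ofReal_mul C.coe_nonneg,
    ENNReal.ofReal_le_ofReal_iff (mul_nonneg C.coe_nonneg hnn)] at h
  have h2 : 0 ≤ (C : ℝ) * ∑ k, ∫ y, pderiv k φ y ^ 2 ∂(cellMeasure d) := mul_nonneg C.coe_nonneg hnn
  linarith

/-- The constant function `1`. -/
def oneL2 (d : ℕ) : CellL2 d := (memLp_const (1 : ℝ)).toLp fun _ => 1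

lemma inner_oneL2 (f : CellL2 d) : inner ℝ f (oneL2 d) = ∫ y, f y ∂(cellMeasure d) := by
  rw [oneL2, CellL2.inner_toLp]; simp

/-- Both sides are continuous on the jet space, so the inequality passes from trigonometric
polynomials to their closure. -/
lemma exists_poincare_perSobolev (d : ℕ) :
    ∃ C : ℝ, 0 ≤ C ∧ ∀ U ∈ perSobolev d,
      ‖U none‖ ^ 2 ≤ (inner ℝ (U none) (oneL2 d)) ^ 2 + C * ∑ k, ‖U (some k)‖ ^ 2 := by
  obtain ⟨C, hC0, hC⟩ := exists_poincare_contDiff d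
  refine ⟨C, hC0, fun U hU => ?_⟩
  rw [← trigSpan_topologicalClosure] at hU
  have hcl : IsClosed {U : JetSpace d |
      ‖U none‖ ^ 2 ≤ (inner ℝ (U none) (oneL2 d)) ^ 2 + C * ∑ k, ‖U (some k)‖ ^ 2} := by
    have hc : ∀ o, Continuous fun U : JetSpace d => U o := fun o => PiLp.continuous_apply 2 _ o
    refine isClosed_le ((hc none).norm.pow 2) ((((hc none).inner continuous_const).pow 2).add
      (continuous_const.mul (continuous_finsetSum _ fun k _ => (hc (some k)).norm.pow 2)))
  refine closure_minimal ?_ hcl hU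
  intro V hV
  obtain ⟨φ, hφ, hp, rfl⟩ := exists_contDiff_of_mem_trigSpan hV
  have := hC φ hφ hp
  rw [mem_ofPred_eq, IsPerH1.jet_none, norm_toLp_sq, inner_oneL2,
    integral_congr_ae (MemLp.coeFn_toLp _)]
  simp_rw [IsPerH1.jet_some, norm_toLp_sq]
  exact this

/-- The Poincaré inequality on the torus. -/
theorem exists_poincare_torus (d : ℕ) :
    ∃ C : ℝ, 0 ≤ C ∧ ∀ (u : Space d → ℝ) (Du : Fin d → Space d → ℝ), IsPerH1 u Du →
      ∫ y, u y ∂(cellMeasure d) = 0 →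
      ∫ y, u y ^ 2 ∂(cellMeasure d) ≤ C * ∑ k, ∫ y, Du k y ^ 2 ∂(cellMeasure d) := by
  obtain ⟨C, hC0, hC⟩ := exists_poincare_perSobolev d
  refine ⟨C, hC0, fun u Du h h0 => ?_⟩
  have := hC _ h.jet_mem
  rw [IsPerH1.jet_none, norm_toLp_sq, inner_oneL2, integral_congr_ae (MemLp.coeFn_toLp _), h0] at this
  simp_rw [IsPerH1.jet_some, norm_toLp_sq] at this
  simpa using this

lemma IsPerH1.sub_const {u : Space d → ℝ} {Du : Fin d → Space d → ℝ} (h : IsPerH1 u Du) (c : ℝ) :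
    IsPerH1 (fun y => u y - c) Du := by
  refine (h.add (isPerH1_const (-c))).congr (h.periodic.sub (isPeriodic_const c)) h.periodic_grad
    (ae_of_all _ fun y => ?_) fun k => ae_of_all _ fun y => ?_
  · simp only; ring
  · simp

/-- The periodic Sobolev functions with mean zero. -/
def perSobolevZero (d : ℕ) : Submodule ℝ (JetSpace d) :=
  perSobolev d ⊓ (innerSL ℝ (oneL2 d) ∘L PiLp.proj 2 (𝕜 := ℝ) (fun _ => CellL2 d) none).ker

lemma mem_perSobolevZero {U : JetSpace d} :
    U ∈ perSobolevZero d ↔ U ∈ perSobolev d ∧ ∫ y, U none y ∂(cellMeasure d) = 0 := by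
  rw [perSobolevZero, Submodule.mem_inf, LinearMap.mem_ker, ← inner_oneL2, real_inner_comm]
  rfl

instance completeSpace_perSobolevZero (d : ℕ) : CompleteSpace (perSobolevZero d) :=
  ((isClosed_perSobolev d).inter (ContinuousLinearMap.isClosed_ker _)).completeSpace_coe

/-- The space of vector valued periodic Sobolev functions with mean zero. -/
abbrev VectorSobolev (d m : ℕ) : Type := PiLp 2 (fun _ : Fin m => perSobolevZero d)

/-- The components of a vector valued Sobolev function and of its gradient. -/
def coord {m : ℕ} (α : Fin m) (o : Option (Fin d)) : VectorSobolev d m →L[ℝ] CellL2 d :=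
  PiLp.proj 2 (𝕜 := ℝ) (fun _ => CellL2 d) o ∘L (perSobolevZero d).subtypeL ∘L
    PiLp.proj 2 (𝕜 := ℝ) (fun _ : Fin m => perSobolevZero d) α

lemma coord_apply {m : ℕ} (α : Fin m) (o : Option (Fin d)) (U : VectorSobolev d m) :
    coord α o U = (U α : JetSpace d) o := rfl

/-- Multiplication by a bounded function. -/
def mulBounded (b : Lp ℝ ∞ (cellMeasure d)) : CellL2 d →L[ℝ] CellL2 d :=
  (ContinuousLinearMap.mul ℝ ℝ).holderL (cellMeasure d) ∞ 2 2 b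

lemma coeFn_mulBounded (b : Lp ℝ ∞ (cellMeasure d)) (f : CellL2 d) :
    mulBounded b f =ᵐ[cellMeasure d] fun y => b y * f y :=
  (ContinuousLinearMap.mul ℝ ℝ).coeFn_holder b f

/-- The pairing `∫ f g`. -/
def pairing (d : ℕ) : CellL2 d →L[ℝ] CellL2 d →L[ℝ] ℝ :=
  (ContinuousLinearMap.mul ℝ ℝ).lpPairing (cellMeasure d) 2 2

lemma pairing_apply (f g : CellL2 d) : pairing d f g = ∫ y, f y * g y ∂(cellMeasure d) :=
  ContinuousLinearMap.lpPairing_eq_integral _ f g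

/-- The bilinear form of a second order system. -/
def systemForm {m : ℕ} (b : Fin d → Fin d → Fin m → Fin m → Lp ℝ ∞ (cellMeasure d)) :
    VectorSobolev d m →L[ℝ] VectorSobolev d m →L[ℝ] ℝ :=
  ∑ i, ∑ j, ∑ α, ∑ β, (pairing d).bilinearComp (mulBounded (b i j α β) ∘L coord β (some j))
    (coord α (some i))

lemma systemForm_apply {m : ℕ} (b : Fin d → Fin d → Fin m → Fin m → Lp ℝ ∞ (cellMeasure d))
    (U V : VectorSobolev d m) :
    systemForm b U V = ∑ i, ∑ j, ∑ α, ∑ β, ∫ y, b i j α β y * coord β (some j) U y *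
      coord α (some i) V y ∂(cellMeasure d) := by
  simp only [systemForm, sum_apply, ContinuousLinearMap.bilinearComp_apply,
    ContinuousLinearMap.comp_apply, pairing_apply]
  refine Finset.sum_congr rfl fun i _ => Finset.sum_congr rfl fun j _ =>
    Finset.sum_congr rfl fun α _ => Finset.sum_congr rfl fun β _ => ?_
  exact integral_mul_congr_left (coeFn_mulBounded _ _) _

lemma memLp_top_mul {X : Type*} [MeasurableSpace X] {ν : Measure X} {b f : X → ℝ}
    (hb : MemLp b ∞ ν) (hf : MemLp f 2 ν) : MemLp (fun y => b y * f y) 2 ν :=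
  hf.mul hb

lemma norm_sq_vectorSobolev {m : ℕ} (U : VectorSobolev d m) :
    ‖U‖ ^ 2 = ∑ α, (‖coord α none U‖ ^ 2 + ∑ i, ‖coord α (some i) U‖ ^ 2) := by
  rw [PiLp.norm_sq_eq_of_L2]
  refine Finset.sum_congr rfl fun α _ => ?_
  rw [Submodule.coe_norm, PiLp.norm_sq_eq_of_L2, Fintype.sum_option]
  rfl

/-- Ellipticity controls the gradients, and the mean-zero Poincaré inequality recovers the full norm
at the cost of the factor 1 + C. -/
lemma isCoercive_systemForm {m : ℕ}
    {b : Fin d → Fin d → Fin m → Fin m → Lp ℝ ∞ (cellMeasure d)} {c : ℝ} (hc : 0 < c)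
    (hell : ∀ᵐ y ∂(cellMeasure d), ∀ ξ : Fin d → Fin m → ℝ,
      c * ∑ i, ∑ α, ξ i α ^ 2 ≤ ∑ i, ∑ j, ∑ α, ∑ β, b i j α β y * ξ i α * ξ j β) :
    IsCoercive (systemForm b) := by
  obtain ⟨C, hC0, hC⟩ := exists_poincare_perSobolev d
  refine ⟨c / (1 + C), by positivity, fun U => ?_⟩
  set S := ∑ α, ∑ i, ‖coord α (some i) U‖ ^ 2 with hS
  have h1 : ‖U‖ ^ 2 ≤ (1 + C) * S := by
    rw [norm_sq_vectorSobolev, hS, Finset.mul_sum]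
    refine Finset.sum_le_sum fun α _ => ?_
    have hm := mem_perSobolevZero.1 (U α).2
    have := hC _ hm.1
    rw [inner_oneL2, hm.2] at this
    simp only [coord_apply]
    nlinarith
  have hint : ∀ i j α β, Integrable (fun y => b i j α β y * coord α (some i) U y *
      coord β (some j) U y) (cellMeasure d) := fun i j α β =>
    integrable_mul_of_memLp_two (memLp_top_mul (Lp.memLp (b i j α β))
      (Lp.memLp (coord α (some i) U))) (Lp.memLp (coord β (some j) U))
  have hsq : ∀ i α, Integrable (fun y => coord α (some i) U y ^ 2) (cellMeasure d) := fun i α =>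
    (Lp.memLp (coord α (some i) U)).integrable_sq
  have h2 : c * S ≤ systemForm b U U := by
    have e1 : c * S = ∫ y, c * ∑ i, ∑ α, coord α (some i) U y ^ 2 ∂(cellMeasure d) := by
      rw [integral_const_mul, integral_finsetSum _ fun i _ =>
        integrable_finsetSum _ fun α _ => hsq i α, hS, Finset.sum_comm]
      simp_rw [integral_finsetSum _ fun α _ => hsq _ α, CellL2.norm_sq_eq]
    have e2 : systemForm b U U = ∫ y, ∑ i, ∑ j, ∑ α, ∑ β, b i j α β y * coord α (some i) U y *
        coord β (some j) U y ∂(cellMeasure d) := by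
      rw [systemForm_apply, integral_finsetSum _ fun i _ => integrable_finsetSum _ fun j _ =>
        integrable_finsetSum _ fun α _ => integrable_finsetSum _ fun β _ => hint i j α β]
      refine Finset.sum_congr rfl fun i _ => ?_
      rw [integral_finsetSum _ fun j _ =>
        integrable_finsetSum _ fun α _ => integrable_finsetSum _ fun β _ => hint i j α β]
      refine Finset.sum_congr rfl fun j _ => ?_
      rw [integral_finsetSum _ fun α _ => integrable_finsetSum _ fun β _ => hint i j α β]
      refine Finset.sum_congr rfl fun α _ => ?_
      rw [integral_finsetSum _ fun β _ => hint i j α β]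
      refine Finset.sum_congr rfl fun β _ => integral_congr_ae (ae_of_all _ fun y => ?_)
      simp only; ring
    rw [e1, e2]
    refine integral_mono_ae ((integrable_finsetSum _ fun i _ =>
        integrable_finsetSum _ fun α _ => hsq i α).const_mul c)
      (integrable_finsetSum _ fun i _ => integrable_finsetSum _ fun j _ =>
        integrable_finsetSum _ fun α _ => integrable_finsetSum _ fun β _ => hint i j α β) ?_
    filter_upwards [hell] with y hy
    exact hy fun i α => coord α (some i) U y
  calc c / (1 + C) * ‖U‖ * ‖U‖ = c / (1 + C) * ‖U‖ ^ 2 := by ring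
    _ ≤ c / (1 + C) * ((1 + C) * S) := by gcongr
    _ = c * S := by field_simp
    _ ≤ _ := h2

end WeakSolutions

/-! ### Lax–Milgram for elliptic systems on the torus -/

section Existence

variable {d m : ℕ}

instance : NormedAddCommGroup (VectorSobolev d m) := PiLp.normedAddCommGroup 2 _

instance : InnerProductSpace ℝ (VectorSobolev d m) := PiLp.innerProductSpace _

instance : CompleteSpace (VectorSobolev d m) := inferInstance

/-- Existence of weak solutions of elliptic systems on the torus. -/
theorem exists_weak_solution (b : Fin d → Fin d → Fin m → Fin m → Space d → ℝ)
    (hb : ∀ i j α β, MemLp (b i j α β) ∞ (cellMeasure d)) {c : ℝ} (hc : 0 < c)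
    (hell : ∀ᵐ y ∂(cellMeasure d), ∀ ξ : Fin d → Fin m → ℝ,
      c * ∑ i, ∑ α, ξ i α ^ 2 ≤ ∑ i, ∑ j, ∑ α, ∑ β, b i j α β y * ξ i α * ξ j β)
    (f : Fin d → Fin m → Space d → ℝ) (hf : ∀ i α, MemLp (f i α) 2 (cellMeasure d))
    (g : Fin m → Space d → ℝ) (hg : ∀ α, MemLp (g α) 2 (cellMeasure d))
    (hg0 : ∀ α, ∫ y, g α y ∂(cellMeasure d) = 0) :
    ∃ (w : Fin m → Space d → ℝ) (Dw : Fin m → Fin d → Space d → ℝ),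
      (∀ α, IsPerH1 (w α) (Dw α)) ∧ (∀ α, ∫ y, w α y ∂(cellMeasure d) = 0) ∧
      ∀ (v : Fin m → Space d → ℝ) (Dv : Fin m → Fin d → Space d → ℝ),
        (∀ α, IsPerH1 (v α) (Dv α)) →
        ∑ i, ∑ j, ∑ α, ∑ β, ∫ y, b i j α β y * Dw β j y * Dv α i y ∂(cellMeasure d) =
          ∑ i, ∑ α, ∫ y, f i α y * Dv α i y ∂(cellMeasure d) +
          ∑ α, ∫ y, g α y * v α y ∂(cellMeasure d) := by
  let b' : Fin d → Fin d → Fin m → Fin m → Lp ℝ ∞ (cellMeasure d) :=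
    fun i j α β => (hb i j α β).toLp
  have hb' : ∀ᵐ y ∂(cellMeasure d), ∀ i j α β, b' i j α β y = b i j α β y := by
    simp only [eventually_all]
    exact fun i j α β => (hb i j α β).coeFn_toLp
  have hco : IsCoercive (systemForm b') := by
    refine isCoercive_systemForm hc ?_
    filter_upwards [hell, hb'] with y h1 h2 ξ
    simp only [h2]
    exact h1 ξ
  let ℓ : VectorSobolev d m →L[ℝ] ℝ :=
    ∑ i, ∑ α, pairing d (hf i α).toLp ∘L coord α (some i) +
      ∑ α, pairing d (hg α).toLp ∘L coord α none
  -- Lax–Milgram: the coercive form represents ℓ by S.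
  let S : VectorSobolev d m := hco.continuousLinearEquivOfBilin.symm
    ((InnerProductSpace.toDual ℝ (VectorSobolev d m)).symm ℓ)
  have hS : ∀ T, systemForm b' S T = ℓ T := fun T => by
    rw [← hco.continuousLinearEquivOfBilin_apply, ContinuousLinearEquiv.apply_symm_apply,
      InnerProductSpace.toDual_symm_apply]
  have hSm : ∀ α, (S α : JetSpace d) ∈ perSobolev d ∧
      ∫ y, (S α : JetSpace d) none y ∂(cellMeasure d) = 0 := fun α =>
    mem_perSobolevZero.1 (S α).2
  refine ⟨fun α => periodize ((S α : JetSpace d) none),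
    fun α k => periodize ((S α : JetSpace d) (some k)),
    fun α => isPerH1_of_mem_perSobolev (hSm α).1, fun α => ?_, fun v Dv hv => ?_⟩
  · rw [integral_congr_ae (periodize_ae_eq _)]
    exact (hSm α).2
  -- Test functions need not have mean zero. Subtracting the mean changes neither their gradients
  -- nor the pairing with g, whose mean vanishes.
  have hmean : ∀ α, ∫ y, v α y - ∫ z, v α z ∂(cellMeasure d) ∂(cellMeasure d) = 0 := fun α => by
    rw [integral_sub ((hv α).memLp.integrable (by norm_num)) (integrable_const _)]
    simp
  let hv' := fun α => (hv α).sub_const (∫ z, v α z ∂(cellMeasure d))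
  let T : VectorSobolev d m := WithLp.toLp 2 fun α => ⟨(hv' α).jet, mem_perSobolevZero.2
    ⟨(hv' α).jet_mem, by
      rw [IsPerH1.jet_none, integral_congr_ae (MemLp.coeFn_toLp _)]; exact hmean α⟩⟩
  have hT1 : ∀ α i, coord α (some i) T =ᵐ[cellMeasure d] Dv α i := fun α i =>
    ((hv' α).memLp_grad i).coeFn_toLp
  have hT0 : ∀ α, coord α none T =ᵐ[cellMeasure d] fun y => v α y - ∫ z, v α z ∂(cellMeasure d) :=
    fun α => (hv' α).memLp.coeFn_toLp
  have key := hS T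
  rw [systemForm_apply] at key
  have e1 : ∀ i j α β, ∫ y, b' i j α β y * coord β (some j) S y * coord α (some i) T y
      ∂(cellMeasure d) = ∫ y, b i j α β y * periodize ((S β : JetSpace d) (some j)) y * Dv α i y
      ∂(cellMeasure d) := fun i j α β => by
    refine integral_congr_ae ?_
    filter_upwards [(hb i j α β).coeFn_toLp, hT1 α i,
      periodize_ae_eq ((S β : JetSpace d) (some j))] with y h1 h2 h3
    rw [h2, h3, h1]
    rfl
  have e2 : ∀ i α, pairing d (hf i α).toLp (coord α (some i) T) =
      ∫ y, f i α y * Dv α i y ∂(cellMeasure d) := fun i α => by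
    rw [pairing_apply]
    refine integral_congr_ae ?_
    filter_upwards [(hf i α).coeFn_toLp, hT1 α i] with y h1 h2
    rw [h1, h2]
  have e3 : ∀ α, pairing d (hg α).toLp (coord α none T) =
      ∫ y, g α y * v α y ∂(cellMeasure d) := fun α => by
    have : ∫ y, g α y * v α y ∂(cellMeasure d) =
        ∫ y, (g α y * v α y - g α y * ∫ z, v α z ∂(cellMeasure d)) ∂(cellMeasure d) := by
      rw [integral_sub (integrable_mul_of_memLp_two (hg α) (hv α).memLp)
        (((hg α).integrable (by norm_num)).mul_const _), integral_mul_const, hg0]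
      simp
    rw [pairing_apply, this]
    refine integral_congr_ae ?_
    filter_upwards [(hg α).coeFn_toLp, hT0 α] with y h1 h2
    rw [h1, h2]; ring
  simp only [e1] at key
  rw [key]
  simp only [ℓ, add_apply, sum_apply, ContinuousLinearMap.comp_apply, e2, e3]

end Existence

/-! ### Energy estimates with a contrast -/

section Contrast

variable {ι X : Type*} [Fintype ι]

/-- Young's inequality entry by entry; the free parameter t decides which factor is absorbed. -/
lemma abs_bilin_le {a : ι → ι → ℝ} {M : ℝ} (hM : 0 ≤ M) (ha : ∀ p q, |a p q| ≤ M)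
    (x z : ι → ℝ) {t : ℝ} (ht : 0 < t) :
    |∑ p, ∑ q, a p q * x q * z p| ≤
      M * Fintype.card ι * (t / 2 * ∑ p, x p ^ 2 + 1 / (2 * t) * ∑ p, z p ^ 2) := by
  have h1 : ∀ p q, |a p q * x q * z p| ≤ M * (t / 2 * x q ^ 2 + 1 / (2 * t) * z p ^ 2) := by
    intro p q
    have h2 : |x q| * |z p| ≤ t / 2 * x q ^ 2 + 1 / (2 * t) * z p ^ 2 := by
      have h3 : t / 2 * x q ^ 2 + 1 / (2 * t) * z p ^ 2 - |x q| * |z p| =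
          (t * |x q| - |z p|) ^ 2 / (2 * t) := by
        rw [← sq_abs (x q), ← sq_abs (z p)]; field_simp; ring
      have h4 : 0 ≤ (t * |x q| - |z p|) ^ 2 / (2 * t) := by positivity
      linarith
    rw [abs_mul, abs_mul, mul_assoc]
    exact mul_le_mul (ha p q) h2 (by positivity) hM
  calc |∑ p, ∑ q, a p q * x q * z p| ≤ ∑ p, ∑ q, |a p q * x q * z p| :=
        (Finset.abs_sum_le_sum_abs _ _).trans
          (Finset.sum_le_sum fun p _ => Finset.abs_sum_le_sum_abs _ _)
    _ ≤ ∑ p, ∑ q, M * (t / 2 * x q ^ 2 + 1 / (2 * t) * z p ^ 2) :=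
        Finset.sum_le_sum fun p _ => Finset.sum_le_sum fun q _ => h1 p q
    _ = _ := by
        simp only [← Finset.mul_sum, Finset.sum_add_distrib, Finset.sum_const, Finset.card_univ,
          nsmul_eq_mul]
        ring

lemma sum_sq_mulVec_le {a : ι → ι → ℝ} {M : ℝ} (ha : ∀ p q, |a p q| ≤ M) (x : ι → ℝ) :
    ∑ p, (∑ q, a p q * x q) ^ 2 ≤ (M * Fintype.card ι) ^ 2 * ∑ q, x q ^ 2 := by
  have h1 : ∀ p, (∑ q, a p q * x q) ^ 2 ≤ M ^ 2 * Fintype.card ι * ∑ q, x q ^ 2 := by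
    intro p
    calc (∑ q, a p q * x q) ^ 2 ≤ (∑ q, a p q ^ 2) * ∑ q, x q ^ 2 :=
          Finset.sum_mul_sq_le_sq_mul_sq _ _ _
      _ ≤ (∑ _q : ι, M ^ 2) * ∑ q, x q ^ 2 := by
          refine mul_le_mul_of_nonneg_right (Finset.sum_le_sum fun q _ => ?_)
            (Finset.sum_nonneg fun q _ => sq_nonneg _)
          rw [← sq_abs]
          exact pow_le_pow_left₀ (abs_nonneg _) (ha p q) 2
      _ = _ := by
          rw [Finset.sum_const, Finset.card_univ, nsmul_eq_mul]; ring
  calc _ ≤ ∑ _p : ι, M ^ 2 * Fintype.card ι * ∑ q, x q ^ 2 := Finset.sum_le_sum fun p _ => h1 p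
    _ = _ := by
        rw [Finset.sum_const, Finset.card_univ, nsmul_eq_mul]; ring

variable [MeasurableSpace X] {ν : Measure X} {W : Set X} {a : X → ι → ι → ℝ} {Λ : X → ℝ}
  {μ M δ : ℝ} {G : ι → X → ℝ}

lemma integrable_sum_sq (hG : ∀ p, MemLp (G p) 2 ν) : Integrable (fun y => ∑ p, G p y ^ 2) ν :=
  integrable_finsetSum _ fun p _ => (hG p).integrable_sq

/-- If the flux of `G` is orthogonal to `G - Z`, and `Z` vanishes on the inclusion, then `Z`
controls `G` outside of the inclusion. -/
lemma setIntegral_compl_le_of_orthogonal (hW : MeasurableSet W) (hμ : 0 < μ) (hδ : 0 < δ)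
    (hM : 0 < M) (ha : ∀ y p q, |a y p q| ≤ M)
    (hell : ∀ y (x : ι → ℝ), μ * ∑ p, x p ^ 2 ≤ ∑ p, ∑ q, a y p q * x q * x p)
    (hΛ : ∀ᵐ y ∂ν, (y ∈ W ∧ Λ y = δ) ∨ (y ∉ W ∧ Λ y = 1))
    (hG : ∀ p, MemLp (G p) 2 ν) {Z : ι → X → ℝ} (hZ : ∀ p, MemLp (Z p) 2 ν)
    (hZW : ∀ᵐ y ∂ν, y ∈ W → ∀ p, Z p y = 0)
    (hint : Integrable (fun y => ∑ p, ∑ q, Λ y * a y p q * G q y * (G p y - Z p y)) ν)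
    (h0 : ∫ y, ∑ p, ∑ q, Λ y * a y p q * G q y * (G p y - Z p y) ∂ν = 0) :
    ∫ y in Wᶜ, ∑ p, G p y ^ 2 ∂ν ≤
      (M * (Fintype.card ι + 1)) ^ 2 / μ ^ 2 * ∫ y, ∑ p, Z p y ^ 2 ∂ν := by
  -- The summand 1 keeps L positive even when the index set is empty.
  set L := M * (Fintype.card ι + 1) with hL
  have hL0 : 0 < L := by positivity
  have hIG := integrable_sum_sq hG
  have hIZ := integrable_sum_sq hZ
  have key : ∫ y, (Wᶜ.indicator (fun y => μ / 2 * ∑ p, G p y ^ 2) y -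
      L ^ 2 / (2 * μ) * ∑ p, Z p y ^ 2) ∂ν ≤ 0 := by
    rw [← h0]
    refine integral_mono_ae (((hIG.const_mul _).indicator hW.compl).sub (hIZ.const_mul _)) hint ?_
    filter_upwards [hΛ, hZW] with y hy hyZ
    have hsq : 0 ≤ ∑ p, G p y ^ 2 := Finset.sum_nonneg fun p _ => sq_nonneg _
    have hsqZ : 0 ≤ ∑ p, Z p y ^ 2 := Finset.sum_nonneg fun p _ => sq_nonneg _
    have e1 : ∑ p, ∑ q, Λ y * a y p q * G q y * (G p y - Z p y) =
        Λ y * (∑ p, ∑ q, a y p q * G q y * G p y - ∑ p, ∑ q, a y p q * G q y * Z p y) := by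
      rw [← Finset.sum_sub_distrib, Finset.mul_sum]
      refine Finset.sum_congr rfl fun p _ => ?_
      rw [← Finset.sum_sub_distrib, Finset.mul_sum]
      exact Finset.sum_congr rfl fun q _ => by ring
    have e2 := hell y fun p => G p y
    rw [e1]
    rcases hy with ⟨hyW, hyΛ⟩ | ⟨hyW, hyΛ⟩
    -- On the inclusion Z vanishes and the integrand is δ times a nonnegative quadratic form, so it
    -- can be dropped whatever the size of δ.
    · rw [indicator_of_notMem (by simpa using hyW), hyΛ]
      have : ∑ p, ∑ q, a y p q * G q y * Z p y = 0 :=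
        Finset.sum_eq_zero fun p _ => Finset.sum_eq_zero fun q _ => by rw [hyZ hyW p, mul_zero]
      rw [this, sub_zero]
      have h1 : 0 ≤ δ * ∑ p, ∑ q, a y p q * G q y * G p y :=
        mul_nonneg hδ.le ((mul_nonneg hμ.le hsq).trans e2)
      have h2 : 0 ≤ L ^ 2 / (2 * μ) * ∑ p, Z p y ^ 2 := by positivity
      linarith
    · rw [indicator_of_mem (by simpa using hyW), hyΛ, one_mul]
      -- With t = μ/L the cross term takes exactly half of the coercive term.
      have h1 := (abs_le.1 (abs_bilin_le hM.le (ha y) (fun q => G q y) (fun p => Z p y)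
        (t := μ / L) (by positivity))).2
      have h2 : M * Fintype.card ι * (μ / L / 2 * ∑ p, G p y ^ 2 +
          1 / (2 * (μ / L)) * ∑ p, Z p y ^ 2) ≤
          L * (μ / L / 2 * ∑ p, G p y ^ 2 + 1 / (2 * (μ / L)) * ∑ p, Z p y ^ 2) := by
        refine mul_le_mul_of_nonneg_right ?_ (by positivity)
        rw [hL]; nlinarith
      have h3 : L * (μ / L / 2 * ∑ p, G p y ^ 2 + 1 / (2 * (μ / L)) * ∑ p, Z p y ^ 2) =
          μ / 2 * ∑ p, G p y ^ 2 + L ^ 2 / (2 * μ) * ∑ p, Z p y ^ 2 := by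
        field_simp
      linarith
  rw [integral_sub ((hIG.const_mul _).indicator hW.compl) (hIZ.const_mul _),
    integral_indicator hW.compl, integral_const_mul, integral_const_mul] at key
  have : L ^ 2 / μ ^ 2 * ∫ y, ∑ p, Z p y ^ 2 ∂ν =
      2 / μ * (L ^ 2 / (2 * μ) * ∫ y, ∑ p, Z p y ^ 2 ∂ν) := by field_simp
  rw [this, ← div_le_iff₀' (by positivity)]
  refine le_trans (le_of_eq ?_) (sub_nonpos.1 key)
  field_simp

/-- If the flux of `G` is orthogonal to `P`, where `P` is close to `G` on the inclusion and is
controlled by its restriction to the inclusion, then the values of `G` outside of the inclusion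
control its values inside. -/
lemma setIntegral_le_of_orthogonal (hW : MeasurableSet W) (hμ : 0 < μ) (hδ : 0 < δ)
    (hM : 0 < M) (ha : ∀ y p q, |a y p q| ≤ M)
    (hell : ∀ y (x : ι → ℝ), μ * ∑ p, x p ^ 2 ≤ ∑ p, ∑ q, a y p q * x q * x p)
    (hΛ : ∀ᵐ y ∂ν, (y ∈ W ∧ Λ y = δ) ∨ (y ∉ W ∧ Λ y = 1))
    (hG : ∀ p, MemLp (G p) 2 ν) {K ε : ℝ} (hK : 0 < K) {P : ι → X → ℝ}
    (hP : ∀ p, MemLp (P p) 2 ν)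
    (hPK : ∫ y, ∑ p, P p y ^ 2 ∂ν ≤ K * ∫ y in W, ∑ p, P p y ^ 2 ∂ν)
    (hPε : ∫ y in W, ∑ p, (P p y - G p y) ^ 2 ∂ν ≤ ε)
    (hint : Integrable (fun y => ∑ p, ∑ q, Λ y * a y p q * G q y * P p y) ν)
    (h0 : ∫ y, ∑ p, ∑ q, Λ y * a y p q * G q y * P p y ∂ν = 0) :
    δ ^ 2 * ∫ y in W, ∑ p, G p y ^ 2 ∂ν ≤
      4 * (M * (Fintype.card ι + 1)) ^ 2 * K / μ ^ 2 * ∫ y in Wᶜ, ∑ p, G p y ^ 2 ∂ν +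
      ε * (2 * δ / μ * (δ * (M * (Fintype.card ι + 1)) ^ 2 / μ + δ * μ / 4)) := by
  set L := M * (Fintype.card ι + 1) with hL
  have hL0 : 0 < L := by positivity
  have hIG := integrable_sum_sq hG
  have hIP := integrable_sum_sq hP
  have hID := integrable_sum_sq (G := fun p y => P p y - G p y) fun p => (hP p).sub (hG p)
  -- The Young parameter outside the inclusion: once P is estimated through K and G, the P-term
  -- costs δμ/4 times the energy of G on the inclusion, plus an error in ε.
  set s := 4 * L * K / (δ * μ) with hs
  have hs0 : 0 < s := by positivity
  have hML : M * Fintype.card ι ≤ L := by rw [hL]; nlinarith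
  have key : ∫ y, (W.indicator (fun y => 3 / 4 * δ * μ * ∑ p, G p y ^ 2) y -
      W.indicator (fun y => δ * L ^ 2 / μ * ∑ p, (P p y - G p y) ^ 2) y -
      Wᶜ.indicator (fun y => L * s / 2 * ∑ p, G p y ^ 2) y -
      L / (2 * s) * ∑ p, P p y ^ 2) ∂ν ≤ 0 := by
    rw [← h0]
    refine integral_mono_ae (((((hIG.const_mul _).indicator hW).sub
      ((hID.const_mul _).indicator hW)).sub ((hIG.const_mul _).indicator hW.compl)).sub
      (hIP.const_mul _)) hint ?_
    filter_upwards [hΛ] with y hy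
    have hsqP : 0 ≤ ∑ p, P p y ^ 2 := Finset.sum_nonneg fun p _ => sq_nonneg _
    have hsqG : 0 ≤ ∑ p, G p y ^ 2 := Finset.sum_nonneg fun p _ => sq_nonneg _
    have hsqD : 0 ≤ ∑ p, (P p y - G p y) ^ 2 := Finset.sum_nonneg fun p _ => sq_nonneg _
    have e1 : ∑ p, ∑ q, Λ y * a y p q * G q y * P p y =
        Λ y * ∑ p, ∑ q, a y p q * G q y * P p y := by
      rw [Finset.mul_sum]
      refine Finset.sum_congr rfl fun p _ => ?_
      rw [Finset.mul_sum]
      exact Finset.sum_congr rfl fun q _ => by ring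
    have e2 := hell y fun p => G p y
    rw [e1]
    rcases hy with ⟨hyW, hyΛ⟩ | ⟨hyW, hyΛ⟩
    · rw [indicator_of_mem hyW, indicator_of_mem hyW, indicator_of_notMem (by simpa using hyW), hyΛ]
      have e3 : ∑ p, ∑ q, a y p q * G q y * P p y = ∑ p, ∑ q, a y p q * G q y * G p y +
          ∑ p, ∑ q, a y p q * G q y * (P p y - G p y) := by
        simp_rw [← Finset.sum_add_distrib]
        exact Finset.sum_congr rfl fun p _ => Finset.sum_congr rfl fun q _ => by ring
      -- With t = μ/(2L) replacing P by G costs a quarter of the coercive term and leaves 3/4.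
      have h1 := (abs_le.1 (abs_bilin_le hM.le (ha y) (fun q => G q y)
        (fun p => P p y - G p y) (t := μ / (2 * L)) (by positivity))).1
      have h2 : M * Fintype.card ι * (μ / (2 * L) / 2 * ∑ p, G p y ^ 2 +
          1 / (2 * (μ / (2 * L))) * ∑ p, (P p y - G p y) ^ 2) ≤
          L * (μ / (2 * L) / 2 * ∑ p, G p y ^ 2 +
          1 / (2 * (μ / (2 * L))) * ∑ p, (P p y - G p y) ^ 2) :=
        mul_le_mul_of_nonneg_right hML (by positivity)
      have h3 : L * (μ / (2 * L) / 2 * ∑ p, G p y ^ 2 +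
          1 / (2 * (μ / (2 * L))) * ∑ p, (P p y - G p y) ^ 2) =
          μ / 4 * ∑ p, G p y ^ 2 + L ^ 2 / μ * ∑ p, (P p y - G p y) ^ 2 := by
        field_simp; ring
      have h4 : 3 / 4 * μ * ∑ p, G p y ^ 2 - L ^ 2 / μ * ∑ p, (P p y - G p y) ^ 2 ≤
          ∑ p, ∑ q, a y p q * G q y * P p y := by rw [e3]; linarith
      have h5 := mul_le_mul_of_nonneg_left h4 hδ.le
      have h6 : 0 ≤ L / (2 * s) * ∑ p, P p y ^ 2 := by positivity
      have h7 : δ * (3 / 4 * μ * ∑ p, G p y ^ 2 - L ^ 2 / μ * ∑ p, (P p y - G p y) ^ 2) =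
          3 / 4 * δ * μ * ∑ p, G p y ^ 2 - δ * L ^ 2 / μ * ∑ p, (P p y - G p y) ^ 2 := by ring
      linarith
    · rw [indicator_of_notMem hyW, indicator_of_notMem hyW,
        indicator_of_mem (by simpa using hyW), hyΛ, one_mul]
      have h1 := (abs_le.1 (abs_bilin_le hM.le (ha y) (fun q => G q y) (fun p => P p y) hs0)).1
      have h2 : M * Fintype.card ι * (s / 2 * ∑ p, G p y ^ 2 + 1 / (2 * s) * ∑ p, P p y ^ 2) ≤
          L * (s / 2 * ∑ p, G p y ^ 2 + 1 / (2 * s) * ∑ p, P p y ^ 2) :=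
        mul_le_mul_of_nonneg_right hML (by positivity)
      have h3 : L * (s / 2 * ∑ p, G p y ^ 2 + 1 / (2 * s) * ∑ p, P p y ^ 2) =
          L * s / 2 * ∑ p, G p y ^ 2 + L / (2 * s) * ∑ p, P p y ^ 2 := by ring
      linarith
  have i1 := (hIG.const_mul (3 / 4 * δ * μ)).indicator hW
  have i2 := (hID.const_mul (δ * L ^ 2 / μ)).indicator hW
  have i3 := (hIG.const_mul (L * s / 2)).indicator hW.compl
  have i4 := hIP.const_mul (L / (2 * s))
  rw [integral_sub (by exact (i1.sub i2).sub i3) i4, integral_sub (by exact i1.sub i2) i3,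
    integral_sub i1 i2,
    integral_indicator hW, integral_indicator hW, integral_indicator hW.compl, integral_const_mul,
    integral_const_mul, integral_const_mul, integral_const_mul] at key
  have hPX : ∫ y in W, ∑ p, P p y ^ 2 ∂ν ≤ 2 * ∫ y in W, ∑ p, G p y ^ 2 ∂ν + 2 * ε := by
    calc ∫ y in W, ∑ p, P p y ^ 2 ∂ν
        ≤ ∫ y in W, (2 * ∑ p, G p y ^ 2 + 2 * ∑ p, (P p y - G p y) ^ 2) ∂ν := by
          refine integral_mono hIP.integrableOn
            ((hIG.const_mul 2).add (hID.const_mul 2)).integrableOn fun y => ?_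
          simp only [Finset.mul_sum, ← Finset.sum_add_distrib]
          exact Finset.sum_le_sum fun p _ => by nlinarith [sq_nonneg (P p y - 2 * G p y)]
      _ = 2 * ∫ y in W, ∑ p, G p y ^ 2 ∂ν + 2 * ∫ y in W, ∑ p, (P p y - G p y) ^ 2 ∂ν := by
          rw [integral_add (hIG.const_mul 2).integrableOn (hID.const_mul 2).integrableOn,
            integral_const_mul, integral_const_mul]
      _ ≤ _ := by linarith
  set x := ∫ y in W, ∑ p, G p y ^ 2 ∂ν
  set E := ∫ y in Wᶜ, ∑ p, G p y ^ 2 ∂ν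
  set D := ∫ y in W, ∑ p, (P p y - G p y) ^ 2 ∂ν
  have hP2 : L / (2 * s) * ∫ y, ∑ p, P p y ^ 2 ∂ν ≤ δ * μ / 4 * (x + ε) := by
    calc L / (2 * s) * ∫ y, ∑ p, P p y ^ 2 ∂ν ≤ L / (2 * s) * (K * (2 * x + 2 * ε)) := by
          gcongr
          exact hPK.trans (by gcongr)
      _ = δ * μ / 4 * (x + ε) := by rw [hs]; field_simp
  have hD2 : δ * L ^ 2 / μ * D ≤ δ * L ^ 2 / μ * ε := by gcongr
  have hfin : δ * μ / 2 * x ≤ L * s / 2 * E + ε * (δ * L ^ 2 / μ + δ * μ / 4) := by linarith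
  -- Since s is proportional to 1/δ, multiplication by 2δ/μ turns the left side into δ² times the
  -- energy and removes δ from the coefficient of E.
  have := mul_le_mul_of_nonneg_left hfin (by positivity : 0 ≤ 2 * δ / μ)
  calc δ ^ 2 * x = 2 * δ / μ * (δ * μ / 2 * x) := by field_simp
    _ ≤ _ := this
    _ = _ := by rw [hs]; field_simp

end Contrast

/-! ### Estimates for the total flux -/

section CellProblem

variable {d m : ℕ}

/-- The coefficients as a matrix whose rows and columns are indexed by pairs. -/
def coeffMatrix (A : Coeff d m) (y : Space d) : Matrix (Fin d × Fin m) (Fin d × Fin m) ℝ :=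
  fun p q => A y p.1 q.1 p.2 q.2

lemma sum_pair_pair (f : Fin d → Fin d → Fin m → Fin m → ℝ) :
    ∑ p : Fin d × Fin m, ∑ q : Fin d × Fin m, f p.1 q.1 p.2 q.2 =
      ∑ i, ∑ j, ∑ α, ∑ β, f i j α β := by
  simp only [Fintype.sum_prod_type]
  exact Finset.sum_congr rfl fun i _ => Finset.sum_comm

lemma IsElliptic.coeffMatrix_le {μ : ℝ} {A : Coeff d m} (hA : IsElliptic μ A) (y : Space d)
    (x : Fin d × Fin m → ℝ) :
    μ * ∑ p, x p ^ 2 ≤ ∑ p, ∑ q, coeffMatrix A y p q * x q * x p ∧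
      ∑ p, ∑ q, coeffMatrix A y p q * x q * x p ≤ μ⁻¹ * ∑ p, x p ^ 2 := by
  have h := hA y fun i α => x (i, α)
  have e1 : ∑ p, x p ^ 2 = ∑ i, ∑ α, x (i, α) ^ 2 := Fintype.sum_prod_type _
  have e2 : ∑ p, ∑ q, coeffMatrix A y p q * x q * x p =
      ∑ i, ∑ j, ∑ α, ∑ β, A y i j α β * x (i, α) * x (j, β) := by
    rw [← sum_pair_pair fun i j α β => A y i j α β * x (i, α) * x (j, β)]
    refine Finset.sum_congr rfl fun p _ => Finset.sum_congr rfl fun q _ => ?_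
    simp only [coeffMatrix, Prod.mk.eta]
    ring
  rw [e1, e2]
  exact h

/-- The entries of a symmetric matrix are bounded by its quadratic form. -/
lemma abs_entry_le_of_symm {ι : Type*} [Fintype ι] [DecidableEq ι] {a : Matrix ι ι ℝ} {c : ℝ}
    (hs : ∀ p q, a p q = a q p) (h0 : ∀ x : ι → ℝ, 0 ≤ ∑ p, ∑ q, a p q * x q * x p)
    (h1 : ∀ x : ι → ℝ, ∑ p, ∑ q, a p q * x q * x p ≤ c * ∑ p, x p ^ 2) (p q : ι) :
    |a p q| ≤ c := by
  have e : ∀ x : ι → ℝ, ∑ p, ∑ q, a p q * x q * x p = x ⬝ᵥ a.mulVec x := fun x => by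
    simp only [dotProduct, Matrix.mulVec, Finset.mul_sum]
    exact Finset.sum_congr rfl fun p _ => Finset.sum_congr rfl fun q _ => by ring
  have e' : ∀ x : ι → ℝ, ∑ p, x p ^ 2 = x ⬝ᵥ x := fun x => by
    simp only [dotProduct, sq]
  simp only [e, e'] at h0 h1
  set u : ι → ℝ := Pi.single p 1 with hu
  set w : ι → ℝ := Pi.single q 1 with hw
  have hpq : u ⬝ᵥ a.mulVec w = a p q := by simp [hu, hw]
  have hqp : w ⬝ᵥ a.mulVec u = a p q := by simp [hu, hw, hs p q]
  have huu : u ⬝ᵥ u = 1 := by simp [hu]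
  have hww : w ⬝ᵥ w = 1 := by simp [hw]
  -- Polarization: the upper bound at u + w minus the lower bound at u - w gives 4a_pq ≤ 2c(1 +
  -- u·w), where u·w is 0 or 1; exchanging the signs bounds a_pq from below.
  have a1 := h1 (u + w)
  have a2 := h1 (u - w)
  have a3 := h0 (u + w)
  have a4 := h0 (u - w)
  have hc := (h0 u).trans (h1 u)
  simp only [add_dotProduct, dotProduct_add, Matrix.mulVec_add, sub_dotProduct, dotProduct_sub,
    Matrix.mulVec_sub, hpq, hqp, huu, hww, dotProduct_comm w u] at a1 a2 a3 a4 hc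
  have hn : 0 ≤ u ⬝ᵥ w ∧ u ⬝ᵥ w ≤ 1 := by
    by_cases h : p = q
    · subst h; simp [hu, hw]
    · simp [hu, hw, h]
  rw [abs_le]
  constructor <;> nlinarith [mul_nonneg (by linarith : 0 ≤ c) hn.1]

/-- The two alternatives merge here: for symmetric coefficients the ellipticity bound already
controls the entries. -/
lemma abs_coeffMatrix_le {μ M : ℝ} {A : Coeff d m} (hμ : 0 < μ) (hA : IsElliptic μ A)
    (h : IsSymm A ∨ ∀ y i j α β, |A y i j α β| ≤ M) (y : Space d) (p q : Fin d × Fin m) :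
    |coeffMatrix A y p q| ≤ max M μ⁻¹ := by
  rcases h with h | h
  · refine le_trans ?_ (le_max_right _ _)
    refine abs_entry_le_of_symm (fun p q => h y _ _ _ _) (fun x => ?_)
      (fun x => (hA.coeffMatrix_le y x).2) p q
    exact (mul_nonneg hμ.le (Finset.sum_nonneg fun p _ => sq_nonneg _)).trans
      (hA.coeffMatrix_le y x).1
  · exact (h y _ _ _ _).trans (le_max_left _ _)

/-- The contrast function vanishes on the boundary of the inclusion, which is a null set. -/
lemma IsInclusion.contrast_ae {W : Set (Space d)} (hW : IsInclusion W) (δ : ℝ) :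
    ∀ᵐ y ∂(cellMeasure d), (y ∈ W ∧ contrast W δ y = δ) ∨ (y ∉ W ∧ contrast W δ y = 1) := by
  have h0 : ∀ᵐ y ∂(cellMeasure d), y ∉ frontier W := by
    refine ae_restrict_of_ae ?_
    rw [ae_iff]
    simpa using volume_frontier_eq_zero hW.isOpen hW.lipschitz
  filter_upwards [h0, cellMeasure_ae_mem d] with y h1 h2
  by_cases hy : y ∈ W
  · exact .inl ⟨hy, by simp [contrast, hy, subset_closure hy]⟩
  · have : y ∉ closure W := fun h => h1 (by rw [hW.isOpen.frontier_eq]; exact ⟨h, hy⟩)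
    exact .inr ⟨hy, by simp [contrast, hy, h2, this]⟩

lemma measurable_contrast {W : Set (Space d)} (hW : IsOpen W) (δ : ℝ) :
    Measurable (contrast W δ) := by
  refine (measurable_const.mul (measurable_one.indicator hW.measurableSet)).add
    (measurable_one.indicator ((measurableSet_cell d).diff isClosed_closure.measurableSet))

lemma abs_contrast_le {W : Set (Space d)} {δ : ℝ} (hδ : 0 < δ) (y : Space d) :
    |contrast W δ y| ≤ δ + 1 := by
  unfold contrast
  by_cases h1 : y ∈ W <;> by_cases h2 : y ∈ cell d \ closure W <;>
    simp only [h1, h2, indicator_of_mem, indicator_of_notMem, not_false_eq_true, Pi.one_apply,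
      mul_one, mul_zero, add_zero, zero_add] <;>
    rw [abs_of_nonneg (by positivity)] <;> linarith

/-- The bounded coefficients of the cell problem. -/
lemma memLp_contrast_mul {W : Set (Space d)} (hW : IsOpen W) {δ : ℝ} (hδ : 0 < δ)
    {A : Coeff d m} (hAm : ∀ i j α β, Measurable fun y => A y i j α β) {M : ℝ}
    (hM : ∀ y p q, |coeffMatrix A y p q| ≤ M) (p q : Fin d × Fin m) :
    MemLp (fun y => contrast W δ y * coeffMatrix A y p q) ∞ (cellMeasure d) := by
  refine MemLp.of_bound ((measurable_contrast hW δ).mul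
    (hAm _ _ _ _)).aestronglyMeasurable ((δ + 1) * M) (ae_of_all _ fun y => ?_)
  rw [Real.norm_eq_abs, abs_mul]
  exact mul_le_mul (abs_contrast_le hδ y) (hM y p q) (abs_nonneg _) (by positivity)

/-- The gradient of `y_j e^β + χ_j^β`. -/
def cellGradient (Dχ : Fin d → Fin m → Fin m → Fin d → Space d → ℝ) (j : Fin d) (β : Fin m)
    (q : Fin d × Fin m) (y : Space d) : ℝ :=
  (if q = (j, β) then 1 else 0) + Dχ j q.2 β q.1 y

lemma totalFlux_eq (W : Set (Space d)) (δ : ℝ) (A : Coeff d m)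
    (Dχ : Fin d → Fin m → Fin m → Fin d → Space d → ℝ) (i j : Fin d) (α β : Fin m) (y : Space d) :
    totalFlux W δ A Dχ i j α β y =
      contrast W δ y * ∑ q, coeffMatrix A y (i, α) q * cellGradient Dχ j β q y := by
  simp only [totalFlux, cellGradient, mul_add, Finset.sum_add_distrib]
  simp [coeffMatrix, Fintype.sum_prod_type]

end CellProblem

/-! ### Extension of periodic Sobolev functions from the inclusion -/

section PeriodicExtension

variable {d : ℕ} {W : Set (Space d)}

/-- Some periodic Sobolev function agrees with a given coordinate on the inclusion. -/
lemma IsInclusion.exists_coordinate (hW : IsInclusion W) (j : Fin d) :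
    ∃ (v : Space d → ℝ) (Dv : Fin d → Space d → ℝ), IsPerH1 v Dv ∧
      ∀ᵐ y ∂(cellMeasure d), y ∈ W → ∀ k, Dv k y = if k = j then 1 else 0 := by
  obtain ⟨C, hC⟩ := exists_extension hW
  obtain ⟨v, ⟨K, hv⟩, hs, hc, hvW, -⟩ := hC (EuclideanSpace.proj j : Space d →L[ℝ] ℝ)
    (ContinuousLinearMap.contDiff _) ⟨_, ContinuousLinearMap.lipschitz _⟩
  refine ⟨_, _, isPerH1_periodize_of_lipschitzWith hv hs hc, ?_⟩
  filter_upwards [cellMeasure_ae_mem d] with y hy hyW k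
  rw [periodize_of_mem _ hy, pderiv, hvW y hyW, ContinuousLinearMap.fderiv]
  simp [eq_comm]

/-- Periodic Sobolev functions are approximated on the inclusion by functions whose energy is
controlled by the energy on the inclusion. -/
theorem IsInclusion.exists_approx (hW : IsInclusion W) :
    ∃ K : ℝ, 0 < K ∧ ∀ (u : Space d → ℝ) (Du : Fin d → Space d → ℝ), IsPerH1 u Du →
      ∀ ε : ℝ, 0 < ε → ∃ (w : Space d → ℝ) (Dw : Fin d → Space d → ℝ), IsPerH1 w Dw ∧
        ∑ k, ∫ y, Dw k y ^ 2 ∂(cellMeasure d) ≤ K * ∑ k, ∫ y in W, Dw k y ^ 2 ∂(cellMeasure d) ∧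
        ∑ k, ∫ y in W, (Dw k y - Du k y) ^ 2 ∂(cellMeasure d) ≤ ε := by
  obtain ⟨C, hC⟩ := exists_extension hW
  refine ⟨C + 1, by positivity, fun u Du hu ε hε => ?_⟩
  -- The extension is available for C¹ functions, so u is first replaced by a smooth periodic
  -- function with nearly the same gradient.
  obtain ⟨φ, hφ, hφp, hφε⟩ := hu.exists_contDiff_approx hε
  obtain ⟨v, ⟨K, hv⟩, hs, hc, hvW, hvC⟩ := hC φ (contDiff_one_of_top hφ)
    (hφp.exists_lipschitzWith (contDiff_one_of_top hφ))
  have hw := isPerH1_periodize_of_lipschitzWith hv hs hc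
  have hae : ∀ k, periodize (pderiv k v) =ᵐ[cellMeasure d] pderiv k v := fun k =>
    periodize_ae_eq _
  have hm : ∀ k, MemLp (pderiv k v) 2 (cellMeasure d) := fun k =>
    (memLp_congr_ae (hae k)).1 (hw.memLp_grad k)
  refine ⟨_, _, hw, ?_, ?_⟩
  · have e1 : ∑ k, ∫ y, periodize (pderiv k v) y ^ 2 ∂(cellMeasure d) =
        ∑ k, ∫ y, pderiv k v y ^ 2 ∂(cellMeasure d) := Finset.sum_congr rfl fun k _ =>
      integral_congr_ae ((hae k).mono fun y hy => by simp only [hy])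
    have e2 : ∑ k, ∫ y in W, periodize (pderiv k v) y ^ 2 ∂(cellMeasure d) =
        ∑ k, ∫ y in W, pderiv k v y ^ 2 ∂(cellMeasure d) := Finset.sum_congr rfl fun k _ =>
      integral_congr_ae (ae_restrict_of_ae ((hae k).mono fun y hy => by simp only [hy]))
    have hnn : 0 ≤ ∑ k, ∫ y in W, pderiv k v y ^ 2 ∂(cellMeasure d) :=
      Finset.sum_nonneg fun k _ => integral_nonneg fun y => sq_nonneg _
    have hr : (cellMeasure d).restrict W = volume.restrict W := by
      rw [cellMeasure, Measure.restrict_restrict hW.isOpen.measurableSet,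
        inter_eq_left.2 hW.subset_cell]
    rw [e1, e2, ← ENNReal.ofReal_le_ofReal_iff (by positivity), integral_pderiv_sq_eq hm,
      ENNReal.ofReal_mul (by positivity),
      integral_pderiv_sq_eq fun k => (hm k).restrict W, hr]
    calc ∫⁻ y, ‖fderiv ℝ v y‖ₑ ^ 2 ∂(cellMeasure d) ≤ ∫⁻ y, ‖fderiv ℝ v y‖ₑ ^ 2 :=
          lintegral_mono' Measure.restrict_le_self le_rfl
      _ ≤ C * ∫⁻ y in W, ‖fderiv ℝ φ y‖ₑ ^ 2 := hvC
      _ = C * ∫⁻ y in W, ‖fderiv ℝ v y‖ₑ ^ 2 := by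
          congr 1
          exact setLIntegral_congr_fun hW.isOpen.measurableSet fun y hy => by simp only [hvW y hy]
      _ ≤ _ := by
          gcongr
          rw [← ENNReal.ofReal_coe_nnreal]
          exact ENNReal.ofReal_le_ofReal (by linarith)
  · refine le_trans (Finset.sum_le_sum fun k _ => ?_) hφε
    have i1 : Integrable (fun y => (Du k y - pderiv k φ y) ^ 2) (cellMeasure d) :=
      ((hu.memLp_grad k).sub (hφp.memLp_two_pderiv hφ k)).integrable_sq
    refine le_trans (le_of_eq (integral_congr_ae ?_))
      (setIntegral_le_integral (s := W) i1 (ae_of_all _ fun y => sq_nonneg _))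
    filter_upwards [ae_restrict_of_ae (hae k), ae_restrict_mem hW.isOpen.measurableSet]
      with y h1 h2
    rw [h1, pderiv, pderiv, hvW y h2]
    ring

end PeriodicExtension

/-! ### Solvability of the cell problems -/

section CellProblem

variable {d m : ℕ} {W : Set (Space d)} {μ M δ : ℝ} {A : Coeff d m}

/-- Existence of solutions of the cell problems. -/
theorem exists_isCellSolution (hW : IsInclusion W) (hμ : 0 < μ) (hδ : 0 < δ)
    (hAm : ∀ i j α β, Measurable fun y => A y i j α β) (hA : IsElliptic μ A)
    (hM : ∀ y p q, |coeffMatrix A y p q| ≤ M) :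
    ∃ χ Dχ, IsCellSolution W δ A χ Dχ := by
  have hb : ∀ i j α β, MemLp (fun y => contrast W δ y * A y i j α β) ∞ (cellMeasure d) :=
    fun i j α β => memLp_contrast_mul hW.isOpen hδ hAm hM (i, α) (j, β)
  have hb2 : ∀ i j α β, MemLp (fun y => contrast W δ y * A y i j α β) 2 (cellMeasure d) :=
    fun i j α β => (hb i j α β).mono_exponent le_top
  -- This ellipticity constant degenerates as δ → 0; it serves existence and enters no estimate.
  have hell : ∀ᵐ y ∂(cellMeasure d), ∀ ξ : Fin d → Fin m → ℝ,
      min δ 1 * μ * ∑ i, ∑ α, ξ i α ^ 2 ≤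
        ∑ i, ∑ j, ∑ α, ∑ β, contrast W δ y * A y i j α β * ξ i α * ξ j β := by
    filter_upwards [hW.contrast_ae δ] with y hy ξ
    have h1 := (hA y ξ).1
    have h2 : min δ 1 ≤ contrast W δ y := by
      rcases hy with ⟨-, h⟩ | ⟨-, h⟩ <;> rw [h]
      exacts [min_le_left _ _, min_le_right _ _]
    have h3 : 0 ≤ ∑ i, ∑ α, ξ i α ^ 2 :=
      Finset.sum_nonneg fun i _ => Finset.sum_nonneg fun α _ => sq_nonneg _
    have h4 : ∑ i, ∑ j, ∑ α, ∑ β, contrast W δ y * A y i j α β * ξ i α * ξ j β =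
        contrast W δ y * ∑ i, ∑ j, ∑ α, ∑ β, A y i j α β * ξ i α * ξ j β := by
      simp only [Finset.mul_sum, mul_assoc]
    have h5 : 0 < min δ 1 := lt_min hδ one_pos
    rw [h4, mul_assoc]
    exact mul_le_mul h2 h1 (mul_nonneg hμ.le h3) (h5.le.trans h2)
  -- The linear part of y_j e^β moves to the right side as the flux -Λ a_{ij}^{αβ}.
  have key := fun (j : Fin d) (β : Fin m) => exists_weak_solution
    (fun i k α γ y => contrast W δ y * A y i k α γ) hb
    (mul_pos (lt_min hδ one_pos) hμ) hell (fun i α y => -(contrast W δ y * A y i j α β))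
    (fun i α => (hb2 i j α β).neg) (fun _ _ => 0) (fun _ => memLp_const 0) (fun _ => by simp)
  choose w Dw hw hw0 hweq using key
  refine ⟨fun j γ β => w j β γ, fun j γ β => Dw j β γ, fun j γ β => hw j β γ,
    fun j γ β => hw0 j β γ, fun j β v Dv hv => ?_⟩
  have h := hweq j β v Dv hv
  have i1 : ∀ i α, Integrable (fun y => contrast W δ y * A y i j α β * Dv α i y)
      (cellMeasure d) := fun i α =>
    integrable_mul_of_memLp_two (hb2 i j α β) ((hv α).memLp_grad i)
  have i2 : ∀ i k α γ, Integrable (fun y => contrast W δ y * A y i k α γ * Dw j β γ k y *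
      Dv α i y) (cellMeasure d) := fun i k α γ =>
    integrable_mul_of_memLp_two (memLp_top_mul (hb i k α γ) ((hw j β γ).memLp_grad k))
      ((hv α).memLp_grad i)
  have e : ∀ y, ∑ i, ∑ α, totalFlux W δ A (fun j γ β => Dw j β γ) i j α β y * Dv α i y =
      ∑ i, ∑ α, (contrast W δ y * A y i j α β * Dv α i y + ∑ k, ∑ γ,
        contrast W δ y * A y i k α γ * Dw j β γ k y * Dv α i y) := fun y => by
    refine Finset.sum_congr rfl fun i _ => Finset.sum_congr rfl fun α _ => ?_
    simp only [totalFlux, mul_add, add_mul, Finset.mul_sum, Finset.sum_mul, mul_assoc]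
  simp_rw [e]
  have i3 : ∀ i α, Integrable (fun y => ∑ k, ∑ γ,
      contrast W δ y * A y i k α γ * Dw j β γ k y * Dv α i y) (cellMeasure d) := fun i α =>
    integrable_finsetSum _ fun k _ => integrable_finsetSum _ fun γ _ => i2 i k α γ
  have i4 : ∀ i α, Integrable (fun y => contrast W δ y * A y i j α β * Dv α i y + ∑ k, ∑ γ,
      contrast W δ y * A y i k α γ * Dw j β γ k y * Dv α i y) (cellMeasure d) := fun i α =>
    (i1 i α).add (i3 i α)
  rw [integral_finsetSum _ fun i _ => integrable_finsetSum _ fun α _ => i4 i α]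
  have e2 : ∀ i, ∫ y, ∑ α, (contrast W δ y * A y i j α β * Dv α i y + ∑ k, ∑ γ,
      contrast W δ y * A y i k α γ * Dw j β γ k y * Dv α i y) ∂(cellMeasure d) =
      ∑ α, ∫ y, contrast W δ y * A y i j α β * Dv α i y ∂(cellMeasure d) +
      ∑ k, ∑ α, ∑ γ, ∫ y, contrast W δ y * A y i k α γ * Dw j β γ k y * Dv α i y
        ∂(cellMeasure d) := fun i => by
    rw [integral_finsetSum _ fun α _ => i4 i α, Finset.sum_comm (γ := Fin d),
      ← Finset.sum_add_distrib]
    refine Finset.sum_congr rfl fun α _ => ?_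
    rw [integral_add (i1 i α) (i3 i α), integral_finsetSum _ fun k _ =>
      integrable_finsetSum _ fun γ _ => i2 i k α γ]
    congr 1
    exact Finset.sum_congr rfl fun k _ => integral_finsetSum _ fun γ _ => i2 i k α γ
  simp_rw [e2]
  rw [Finset.sum_add_distrib, h]
  simp only [neg_mul, integral_neg, Finset.sum_neg_distrib, zero_mul, integral_zero,
    Finset.sum_const_zero, add_zero, add_neg_cancel]

end CellProblem

/-! ### Bounds for the total flux that are independent of the contrast -/

section TotalFlux

variable {d m : ℕ} {W : Set (Space d)} {μ M δ : ℝ} {A : Coeff d m}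
  {χ : Fin d → Fin m → Fin m → Space d → ℝ} {Dχ : Fin d → Fin m → Fin m → Fin d → Space d → ℝ}

lemma IsCellSolution.memLp_cellGradient (h : IsCellSolution W δ A χ Dχ) (j : Fin d) (β : Fin m)
    (q : Fin d × Fin m) : MemLp (cellGradient Dχ j β q) 2 (cellMeasure d) := by
  have h1 : MemLp (fun _ : Space d => if q = (j, β) then (1 : ℝ) else 0) 2 (cellMeasure d) :=
    memLp_const _
  exact h1.add ((h.perH1 j q.2 β).memLp_grad q.1)

lemma IsCellSolution.integral_flux_mul_eq_zero (h : IsCellSolution W δ A χ Dχ) (j : Fin d)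
    (β : Fin m) {v : Fin m → Space d → ℝ} {Dv : Fin m → Fin d → Space d → ℝ}
    (hv : ∀ α, IsPerH1 (v α) (Dv α)) :
    ∫ y, ∑ p : Fin d × Fin m, ∑ q, contrast W δ y * coeffMatrix A y p q *
      cellGradient Dχ j β q y * Dv p.2 p.1 y ∂(cellMeasure d) = 0 := by
  rw [← h.weak_eq j β v Dv hv]
  refine integral_congr_ae (ae_of_all _ fun y => ?_)
  simp only [totalFlux_eq, Finset.mul_sum, Finset.sum_mul]
  rw [Fintype.sum_prod_type]
  simp only [mul_assoc]

lemma IsCellSolution.integrable_flux_mul (h : IsCellSolution W δ A χ Dχ) (hW : IsOpen W)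
    (hδ : 0 < δ) (hAm : ∀ i j α β, Measurable fun y => A y i j α β)
    (hM : ∀ y p q, |coeffMatrix A y p q| ≤ M) (j : Fin d) (β : Fin m)
    {Z : Fin d × Fin m → Space d → ℝ} (hZ : ∀ p, MemLp (Z p) 2 (cellMeasure d)) :
    Integrable (fun y => ∑ p : Fin d × Fin m, ∑ q, contrast W δ y * coeffMatrix A y p q *
      cellGradient Dχ j β q y * Z p y) (cellMeasure d) :=
  integrable_finsetSum _ fun p _ => integrable_finsetSum _ fun q _ =>
    integrable_mul_of_memLp_two (memLp_top_mul (memLp_contrast_mul hW hδ hAm hM p q)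
      (h.memLp_cellGradient j β q)) (hZ p)

lemma IsCellSolution.memLp_totalFlux (h : IsCellSolution W δ A χ Dχ) (hW : IsOpen W)
    (hδ : 0 < δ) (hAm : ∀ i j α β, Measurable fun y => A y i j α β)
    (hM : ∀ y p q, |coeffMatrix A y p q| ≤ M) (i j : Fin d) (α β : Fin m) :
    MemLp (totalFlux W δ A Dχ i j α β) 2 (cellMeasure d) := by
  have e : totalFlux W δ A Dχ i j α β = fun y => ∑ q, contrast W δ y * coeffMatrix A y (i, α) q *
      cellGradient Dχ j β q y := by
    ext y; simp only [totalFlux_eq, Finset.mul_sum, mul_assoc]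
  rw [e]
  exact memLp_finsetSum _ fun q _ => memLp_top_mul (memLp_contrast_mul hW hδ hAm hM (i, α) q)
    (h.memLp_cellGradient j β q)

/-- The gradient outside of the inclusion is bounded independently of the contrast. -/
lemma IsCellSolution.setIntegral_compl_le (h : IsCellSolution W δ A χ Dχ) (hW : IsInclusion W)
    (hμ : 0 < μ) (hδ : 0 < δ) (hM0 : 0 < M)
    (hAm : ∀ i j α β, Measurable fun y => A y i j α β) (hA : IsElliptic μ A)
    (hM : ∀ y p q, |coeffMatrix A y p q| ≤ M) {j : Fin d} (β : Fin m) {v : Space d → ℝ}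
    {Dv : Fin d → Space d → ℝ} (hv : IsPerH1 v Dv)
    (hvW : ∀ᵐ y ∂(cellMeasure d), y ∈ W → ∀ k, Dv k y = if k = j then 1 else 0) :
    ∫ y in Wᶜ, ∑ q, cellGradient Dχ j β q y ^ 2 ∂(cellMeasure d) ≤
      (M * (Fintype.card (Fin d × Fin m) + 1)) ^ 2 / μ ^ 2 *
        ∑ k, ∫ y, ((if k = j then 1 else 0) - Dv k y) ^ 2 ∂(cellMeasure d) := by
  let c : Fin m → ℝ := fun γ => if γ = β then 1 else 0
  -- The gradient of (y_j - v) e^β: it is periodic and vanishes on the inclusion.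
  let Z : Fin d × Fin m → Space d → ℝ := fun p y => c p.2 * ((if p.1 = j then 1 else 0) - Dv p.1 y)
  have hZ1 : ∀ k, MemLp (fun y => (if k = j then (1 : ℝ) else 0) - Dv k y) 2 (cellMeasure d) :=
    fun k => (memLp_const _).sub (hv.memLp_grad k)
  have hZ : ∀ p, MemLp (Z p) 2 (cellMeasure d) := fun p => (hZ1 p.1).const_mul _
  -- The test function χ_j^β + v e^β replaces y_j e^β + χ_j^β, which is not periodic; its gradient
  -- is G - Z.
  have hV : ∀ γ, IsPerH1 _ _ := fun γ => (h.perH1 j γ β).add (hv.const_mul (c γ))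
  have e : ∀ (p : Fin d × Fin m) y, Dχ j p.2 β p.1 y + c p.2 * Dv p.1 y =
      cellGradient Dχ j β p y - Z p y := fun p y => by
    obtain ⟨k, γ⟩ := p
    simp only [cellGradient, Z, c, Prod.mk.injEq]
    by_cases h1 : γ = β <;> by_cases h2 : k = j <;> simp [h1, h2]
  have h0 := h.integral_flux_mul_eq_zero j β hV
  simp only [e] at h0
  have key := setIntegral_compl_le_of_orthogonal hW.isOpen.measurableSet hμ hδ hM0 hM
    (fun y x => (hA.coeffMatrix_le y x).1) (hW.contrast_ae δ) (h.memLp_cellGradient j β) hZ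
    (hvW.mono fun y hy hyW p => by simp only [Z, hy hyW, sub_self, mul_zero])
    (h.integrable_flux_mul hW.isOpen hδ hAm hM j β fun p => (h.memLp_cellGradient j β p).sub (hZ p))
    h0
  refine key.trans (le_of_eq ?_)
  congr 1
  rw [integral_finsetSum _ fun p _ => (hZ p).integrable_sq, Fintype.sum_prod_type]
  refine Finset.sum_congr rfl fun k _ => ?_
  rw [Finset.sum_eq_single β (fun γ _ hγ => by simp [Z, c, hγ]) (by simp)]
  simp [Z, c]

/-- The weighted gradient inside of the inclusion is controlled by the gradient outside. -/
lemma IsCellSolution.sq_mul_setIntegral_le (h : IsCellSolution W δ A χ Dχ) (hW : IsInclusion W)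
    (hμ : 0 < μ) (hδ : 0 < δ) (hM0 : 0 < M)
    (hAm : ∀ i j α β, Measurable fun y => A y i j α β) (hA : IsElliptic μ A)
    (hM : ∀ y p q, |coeffMatrix A y p q| ≤ M) {j : Fin d} (β : Fin m) {v : Space d → ℝ}
    {Dv : Fin d → Space d → ℝ} (hv : IsPerH1 v Dv)
    (hvW : ∀ᵐ y ∂(cellMeasure d), y ∈ W → ∀ k, Dv k y = if k = j then 1 else 0) {K : ℝ}
    (hK0 : 0 < K) (hK : ∀ (u : Space d → ℝ) (Du : Fin d → Space d → ℝ), IsPerH1 u Du →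
      ∀ ε : ℝ, 0 < ε → ∃ (w : Space d → ℝ) (Dw : Fin d → Space d → ℝ), IsPerH1 w Dw ∧
        ∑ k, ∫ y, Dw k y ^ 2 ∂(cellMeasure d) ≤ K * ∑ k, ∫ y in W, Dw k y ^ 2 ∂(cellMeasure d) ∧
        ∑ k, ∫ y in W, (Dw k y - Du k y) ^ 2 ∂(cellMeasure d) ≤ ε) :
    δ ^ 2 * ∫ y in W, ∑ q, cellGradient Dχ j β q y ^ 2 ∂(cellMeasure d) ≤
      4 * (M * (Fintype.card (Fin d × Fin m) + 1)) ^ 2 * K / μ ^ 2 *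
        ∫ y in Wᶜ, ∑ q, cellGradient Dχ j β q y ^ 2 ∂(cellMeasure d) := by
  let c : Fin m → ℝ := fun γ => if γ = β then 1 else 0
  -- On the inclusion this periodic function has the gradient of y_j e^β + χ_j^β, so it is what gets
  -- approximated and extended.
  have hV : ∀ γ, IsPerH1 _ _ := fun γ => (h.perH1 j γ β).add (hv.const_mul (c γ))
  have hG := h.memLp_cellGradient j β
  set L := M * (Fintype.card (Fin d × Fin m) + 1) with hL
  have hL0 : 0 < L := by positivity
  refine le_of_forall_pos_le_add fun η hη => ?_
  -- The factor of ε in the abstract estimate. It depends on δ, but an approximation error η/t makes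
  -- the remainder equal to the arbitrary η.
  set t := 2 * δ / μ * (δ * L ^ 2 / μ + δ * μ / 4) with ht
  have ht0 : 0 < t := by positivity
  -- The error is split among the m components; m + 1 avoids a division by zero.
  have hε : 0 < η / t / (m + 1) := by positivity
  choose w Dw hw hwK hwε using fun γ => hK _ _ (hV γ) (η / t / (m + 1)) hε
  have hP : ∀ p : Fin d × Fin m, MemLp (Dw p.2 p.1) 2 (cellMeasure d) := fun p =>
    (hw p.2).memLp_grad p.1
  have hG1 : ∀ᵐ y ∂((cellMeasure d).restrict W), ∀ p : Fin d × Fin m,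
      Dχ j p.2 β p.1 y + c p.2 * Dv p.1 y = cellGradient Dχ j β p y := by
    filter_upwards [ae_restrict_of_ae hvW, ae_restrict_mem hW.isOpen.measurableSet] with y h1 h2 p
    obtain ⟨k, γ⟩ := p
    simp only [cellGradient, c, Prod.mk.injEq, h1 h2]
    by_cases h1 : γ = β <;> by_cases h2 : k = j <;> simp [h1, h2, add_comm]
  have hPK : ∫ y, ∑ p : Fin d × Fin m, Dw p.2 p.1 y ^ 2 ∂(cellMeasure d) ≤
      K * ∫ y in W, ∑ p : Fin d × Fin m, Dw p.2 p.1 y ^ 2 ∂(cellMeasure d) := by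
    rw [integral_finsetSum _ fun p _ => (hP p).integrable_sq,
      integral_finsetSum _ fun p _ => ((hP p).restrict W).integrable_sq,
      Fintype.sum_prod_type_right, Fintype.sum_prod_type_right, Finset.mul_sum]
    exact Finset.sum_le_sum fun γ _ => hwK γ
  have hPε : ∫ y in W, ∑ p : Fin d × Fin m, (Dw p.2 p.1 y - cellGradient Dχ j β p y) ^ 2
      ∂(cellMeasure d) ≤ η / t := by
    have i1 : ∀ p : Fin d × Fin m, Integrable (fun y => (Dw p.2 p.1 y -
        cellGradient Dχ j β p y) ^ 2) ((cellMeasure d).restrict W) := fun p =>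
      (((hP p).restrict W).sub ((hG p).restrict W)).integrable_sq
    rw [integral_finsetSum _ fun p _ => i1 p, Fintype.sum_prod_type_right]
    calc _ ≤ ∑ _γ : Fin m, η / t / (m + 1) := Finset.sum_le_sum fun γ _ => by
          refine le_trans (le_of_eq (Finset.sum_congr rfl fun k _ => integral_congr_ae ?_)) (hwε γ)
          filter_upwards [hG1] with y hy
          rw [← hy (k, γ)]
      _ = m / (m + 1) * (η / t) := by
          rw [Finset.sum_const, Finset.card_univ, Fintype.card_fin, nsmul_eq_mul]; ring
      _ ≤ 1 * (η / t) := by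
          refine mul_le_mul_of_nonneg_right ?_ (by positivity)
          rw [div_le_one (by positivity)]
          linarith
      _ = η / t := one_mul _
  have key := setIntegral_le_of_orthogonal hW.isOpen.measurableSet hμ hδ hM0 hM
    (fun y x => (hA.coeffMatrix_le y x).1) (hW.contrast_ae δ) hG hK0 hP hPK hPε
    (h.integrable_flux_mul hW.isOpen hδ hAm hM j β hP) (h.integral_flux_mul_eq_zero j β hw)
  rwa [div_mul_cancel₀ _ ht0.ne'] at key

/-- The total flux is bounded independently of the contrast. -/
theorem exists_totalFlux_bound (hW : IsInclusion W) (hμ : 0 < μ) (m : ℕ) (M : ℝ) :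
    ∃ C : ℝ, ∀ A : Coeff d m, (∀ i j α β, Measurable fun y => A y i j α β) → IsElliptic μ A →
      (∀ y p q, |coeffMatrix A y p q| ≤ M) → ∀ δ : ℝ, 0 < δ → ∀ χ Dχ,
      IsCellSolution W δ A χ Dχ → ∀ j β,
        ∑ i, ∑ α, ∫ y, totalFlux W δ A Dχ i j α β y ^ 2 ∂(cellMeasure d) ≤ C := by
  obtain ⟨K, hK0, hK⟩ := hW.exists_approx
  choose v Dv hv hvW using hW.exists_coordinate
  -- A positive bound for the entries, whatever the sign of M.
  set N := max M 1 with hN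
  have hN0 : 0 < N := one_pos.trans_le (le_max_right _ _)
  set n : ℝ := ((Fintype.card (Fin d × Fin m) : ℕ) : ℝ) with hn
  set R := ∑ j, ∑ k, ∫ y, ((if k = j then 1 else 0) - Dv j k y) ^ 2 ∂(cellMeasure d) with hR
  have hRj : ∀ j, ∑ k, ∫ y, ((if k = j then 1 else 0) - Dv j k y) ^ 2 ∂(cellMeasure d) ≤ R :=
    fun j => Finset.single_le_sum (f := fun j => ∑ k, ∫ y, ((if k = j then 1 else 0) -
      Dv j k y) ^ 2 ∂(cellMeasure d)) (fun j _ => Finset.sum_nonneg fun k _ =>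
        integral_nonneg fun y => sq_nonneg _) (Finset.mem_univ j)
  refine ⟨(N * n) ^ 2 * ((4 * (N * (n + 1)) ^ 2 * K / μ ^ 2 + 1) *
    ((N * (n + 1)) ^ 2 / μ ^ 2 * R)), fun A hAm hA hM δ hδ χ Dχ h j β => ?_⟩
  replace hM : ∀ y p q, |coeffMatrix A y p q| ≤ N := fun y p q =>
    (hM y p q).trans (le_max_left _ _)
  have h1 := (h.setIntegral_compl_le hW hμ hδ hN0 hAm hA hM β (hv j) (hvW j)).trans
    (mul_le_mul_of_nonneg_left (hRj j) (by positivity))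
  have h2 := h.sq_mul_setIntegral_le hW hμ hδ hN0 hAm hA hM β (hv j) (hvW j) hK0 hK
  rw [← hn] at h1 h2
  set x := ∫ y in W, ∑ q, cellGradient Dχ j β q y ^ 2 ∂(cellMeasure d)
  set E := ∫ y in Wᶜ, ∑ q, cellGradient Dχ j β q y ^ 2 ∂(cellMeasure d)
  have hI := integrable_sum_sq (h.memLp_cellGradient j β)
  have hWm := hW.isOpen.measurableSet
  have i1 := (hI.const_mul (δ ^ 2)).indicator hWm
  have i2 := hI.indicator hWm.compl
  have hflux := h.memLp_totalFlux hW.isOpen hδ hAm hM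
  calc ∑ i, ∑ α, ∫ y, totalFlux W δ A Dχ i j α β y ^ 2 ∂(cellMeasure d)
      = ∫ y, ∑ p : Fin d × Fin m, totalFlux W δ A Dχ p.1 j p.2 β y ^ 2 ∂(cellMeasure d) := by
        rw [integral_finsetSum _ fun p _ => (hflux p.1 j p.2 β).integrable_sq,
          Fintype.sum_prod_type]
    -- Squaring the flux produces δ² on the inclusion, precisely the weight in the interior
    -- estimate.
    _ ≤ ∫ y, (N * n) ^ 2 * (W.indicator (fun y => δ ^ 2 * ∑ q, cellGradient Dχ j β q y ^ 2) y +
          Wᶜ.indicator (fun y => ∑ q, cellGradient Dχ j β q y ^ 2) y) ∂(cellMeasure d) := by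
        refine integral_mono_ae (integrable_finsetSum _ fun p _ =>
          (hflux p.1 j p.2 β).integrable_sq) ((i1.add i2).const_mul _) ?_
        filter_upwards [hW.contrast_ae δ] with y hy
        have h3 := sum_sq_mulVec_le (hM y) fun q => cellGradient Dχ j β q y
        simp only [totalFlux_eq, mul_pow, ← Finset.mul_sum]
        rw [mul_pow, ← hn] at h3
        rcases hy with ⟨hyW, hy⟩ | ⟨hyW, hy⟩
        · rw [indicator_of_mem hyW, indicator_of_notMem (by simpa using hyW), hy, add_zero,
            mul_left_comm]
          exact mul_le_mul_of_nonneg_left h3 (sq_nonneg _)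
        · rw [indicator_of_notMem hyW, indicator_of_mem (by simpa using hyW), hy, zero_add,
            one_pow, one_mul]
          exact h3
    _ = (N * n) ^ 2 * (δ ^ 2 * x + E) := by
        rw [integral_const_mul, integral_add i1 i2, integral_indicator hWm,
          integral_indicator hWm.compl, integral_const_mul]
    _ ≤ (N * n) ^ 2 * ((4 * (N * (n + 1)) ^ 2 * K / μ ^ 2 + 1) * E) := by
        gcongr; linarith
    _ ≤ _ := by gcongr

end TotalFlux

/-! ### Flux correctors -/

section FluxCorrector

variable {d m : ℕ}

/-- `f` is the mean-zero weak solution of `Δ f = F` on the torus. -/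
structure IsPoissonSolution (F f : Space d → ℝ) (Df : Fin d → Space d → ℝ) : Prop where
  perH1 : IsPerH1 f Df
  mean_zero : ∫ y, f y ∂(cellMeasure d) = 0
  weak_eq : ∀ (v : Space d → ℝ) (Dv : Fin d → Space d → ℝ), IsPerH1 v Dv →
    ∫ y, ∑ l, Df l y * Dv l y ∂(cellMeasure d) = -∫ y, F y * v y ∂(cellMeasure d)

/-- The scalar system with identity coefficients and right side -F; its solvability needs F to have
mean zero. -/
lemma exists_isPoissonSolution {F : Space d → ℝ} (hF : MemLp F 2 (cellMeasure d))
    (h0 : ∫ y, F y ∂(cellMeasure d) = 0) : ∃ f Df, IsPoissonSolution F f Df := by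
  obtain ⟨w, Dw, hw, hw0, h⟩ := exists_weak_solution (m := 1)
    (fun i j _ _ (_ : Space d) => if i = j then 1 else 0) (fun _ _ _ _ => memLp_const _)
    one_pos (ae_of_all _ fun y ξ => by simp [sq]) (fun _ _ _ => 0) (fun _ _ => memLp_const 0)
    (fun _ y => -F y) (fun _ => hF.neg) (fun _ => by rw [integral_neg, h0, neg_zero])
  refine ⟨w 0, Dw 0, hw 0, hw0 0, fun v Dv hv => ?_⟩
  have := h (fun _ => v) (fun _ => Dv) fun _ => hv
  simp only [Finset.univ_unique, Finset.sum_singleton, ite_mul, one_mul, zero_mul,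
    integral_zero, Finset.sum_const_zero, zero_add, neg_mul, integral_neg] at this
  rw [integral_finsetSum _ fun l _ => integrable_mul_of_memLp_two ((hw 0).memLp_grad l)
    (hv.memLp_grad l)]
  refine Eq.trans (Finset.sum_congr rfl fun l _ => ?_) this
  rw [Finset.sum_eq_single l (fun k _ hk => by simp [hk.symm]) (by simp)]
  simp

/-- Test with f itself. Young's inequality with weight C + 1 lets the Poincaré inequality absorb
half of the energy. -/
lemma exists_poisson_bound (d : ℕ) :
    ∃ C : ℝ, 0 ≤ C ∧ ∀ (F f : Space d → ℝ) (Df : Fin d → Space d → ℝ),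
      MemLp F 2 (cellMeasure d) → IsPoissonSolution F f Df →
      ∑ k, ∫ y, Df k y ^ 2 ∂(cellMeasure d) ≤ C * ∫ y, F y ^ 2 ∂(cellMeasure d) := by
  obtain ⟨C, hC0, hC⟩ := exists_poincare_torus d
  refine ⟨C + 1, by positivity, fun F f Df hF h => ?_⟩
  have h1 := hC f Df h.perH1 h.mean_zero
  have h2 := h.weak_eq f Df h.perH1
  rw [integral_finsetSum _ fun l _ => integrable_mul_of_memLp_two (h.perH1.memLp_grad l)
    (h.perH1.memLp_grad l), ← integral_neg] at h2
  simp only [← sq] at h2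
  set S := ∑ k, ∫ y, Df k y ^ 2 ∂(cellMeasure d)
  have hS : 0 ≤ S := Finset.sum_nonneg fun k _ => integral_nonneg fun y => sq_nonneg _
  have i1 := hF.integrable_sq.const_mul ((C + 1) / 2)
  have i2 := h.perH1.memLp.integrable_sq.const_mul (1 / (2 * (C + 1)))
  have h3 : ∫ y, -(F y * f y) ∂(cellMeasure d) ≤
      ∫ y, ((C + 1) / 2 * F y ^ 2 + 1 / (2 * (C + 1)) * f y ^ 2) ∂(cellMeasure d) := by
    refine integral_mono (integrable_mul_of_memLp_two hF h.perH1.memLp).neg (i1.add i2)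
      fun y => ?_
    have : (C + 1) / 2 * F y ^ 2 + 1 / (2 * (C + 1)) * f y ^ 2 + F y * f y =
        ((C + 1) * F y + f y) ^ 2 / (2 * (C + 1)) := by field_simp; ring
    have h4 : 0 ≤ ((C + 1) * F y + f y) ^ 2 / (2 * (C + 1)) := by positivity
    simp only
    linarith
  rw [integral_add i1 i2, integral_const_mul, integral_const_mul] at h3
  have h5 : 1 / (2 * (C + 1)) * ∫ y, f y ^ 2 ∂(cellMeasure d) ≤ S / 2 := by
    calc _ ≤ 1 / (2 * (C + 1)) * ((C + 1) * S) := by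
          gcongr; linarith
      _ = S / 2 := by field_simp
  linarith

lemma IsPerH1.integral_grad {u : Space d → ℝ} {Du : Fin d → Space d → ℝ} (h : IsPerH1 u Du)
    (k : Fin d) : ∫ y, Du k y ∂(cellMeasure d) = 0 := by
  have := h.weak_grad k (fun _ => 1) contDiff_const (isPeriodic_const 1)
  simpa [pderiv_const] using this

/-- For a divergence-free field, the potentials of its components form a divergence-free field. -/
lemma sum_integral_grad_mul_eq_zero {F f : Fin d → Space d → ℝ}
    {Df : Fin d → Fin d → Space d → ℝ}
    (hf : ∀ k, IsPoissonSolution (F k) (f k) (Df k))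
    (hdiv : ∀ (v : Space d → ℝ) (Dv : Fin d → Space d → ℝ), IsPerH1 v Dv →
      ∑ k, ∫ y, F k y * Dv k y ∂(cellMeasure d) = 0) (i : Fin d) {v : Space d → ℝ}
    {Dv : Fin d → Space d → ℝ} (hv : IsPerH1 v Dv) :
    ∑ k, ∫ y, Df k i y * Dv k y ∂(cellMeasure d) = 0 := by
  have hm : ∀ k, MemLp (Df k i) 2 (cellMeasure d) := fun k => (hf k).perH1.memLp_grad i
  let L : JetSpace d →L[ℝ] ℝ := ∑ k, innerSL ℝ ((hm k).toLp (Df k i)) ∘L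
    PiLp.proj 2 (𝕜 := ℝ) (fun _ => CellL2 d) (some k)
  have hL : ∀ {w : Space d → ℝ} {Dw : Fin d → Space d → ℝ} (h : IsPerH1 w Dw),
      L h.jet = ∑ k, ∫ y, Df k i y * Dw k y ∂(cellMeasure d) := fun h => by
    simp only [L, sum_apply, ContinuousLinearMap.comp_apply, PiLp.proj_apply, innerSL_apply_apply]
    refine Finset.sum_congr rfl fun k _ => ?_
    rw [IsPerH1.jet_some, CellL2.inner_toLp, integral_mul_congr_left (hm k).coeFn_toLp]
  have hle : trigSpan d ≤ L.ker := by
    rw [trigSpan, Submodule.span_le]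
    rintro _ ⟨⟨n, θ⟩, rfl⟩
    have htm : MemLp (trig n θ) 2 (cellMeasure d) := (isPerH1_trig n θ).memLp
    set I : Fin d → ℝ := fun k => ∫ y, f k y * trig n θ y ∂(cellMeasure d) with hI
    set N : Fin d → ℝ := fun k => 2 * Real.pi * n k with hN
    have e1 : ∀ k l, ∫ y, Df k l y * trig n (θ + Real.pi / 2) y ∂(cellMeasure d) =
        N l * I k := fun k l => by
      rw [(hf k).perH1.integral_grad_mul_trig]
      simp only [trig_add_pi, mul_neg, integral_neg, hN, hI]
      ring
    have e2 : ∀ (g : Space d → ℝ) k, ∫ y, g y * pderiv k (trig n θ) y ∂(cellMeasure d) =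
        N k * ∫ y, g y * trig n (θ + Real.pi / 2) y ∂(cellMeasure d) := fun g k => by
      rw [pderiv_trig, ← integral_const_mul]
      exact integral_congr_ae (ae_of_all _ fun y => by simp only [hN]; ring)
    -- The Poisson equation at one frequency: F_k has coefficient -|N|² I_k.
    have e3 : ∀ k, ∫ y, F k y * trig n θ y ∂(cellMeasure d) = -((∑ l, N l ^ 2) * I k) := fun k => by
      have := (hf k).weak_eq _ _ (isPerH1_trig n θ)
      rw [integral_finsetSum _ fun l _ => integrable_mul_of_memLp_two ((hf k).perH1.memLp_grad l)
        ((isPerH1_trig n θ).memLp_grad l)] at this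
      simp only [e2, e1] at this
      rw [← neg_eq_iff_eq_neg, ← this, Finset.sum_mul]
      exact Finset.sum_congr rfl fun l _ => by ring
    have e4 : ∑ k, N k * ∫ y, F k y * trig n θ y ∂(cellMeasure d) = 0 := by
      -- The phase θ - π/2 is chosen so that the derivative of the test function has phase θ.
      have := hdiv _ _ (isPerH1_trig n (θ - Real.pi / 2))
      rw [← this]
      refine Finset.sum_congr rfl fun k _ => ?_
      rw [pderiv_trig, sub_add_cancel, ← integral_const_mul]
      exact integral_congr_ae (ae_of_all _ fun y => by simp only [hN]; ring)
    have e5 : (∑ l, N l ^ 2) * ∑ k, N k * I k = 0 := by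
      rw [← neg_eq_zero, ← e4, Finset.mul_sum, ← Finset.sum_neg_distrib]
      exact Finset.sum_congr rfl fun k _ => by rw [e3]; ring
    rw [SetLike.mem_coe, LinearMap.mem_ker]
    refine (hL (isPerH1_trig n θ)).trans ?_
    simp only [e2, e1]
    have e6 : ∑ k, N k * (N i * I k) = N i * ∑ k, N k * I k := by
      rw [Finset.mul_sum]
      exact Finset.sum_congr rfl fun k _ => by ring
    rw [e6]
    -- At frequency zero the factor N_i vanishes; at all others N·I = 0.
    rcases mul_eq_zero.1 e5 with h | h
    · have := (Finset.sum_eq_zero_iff_of_nonneg fun l _ => sq_nonneg _).1 h i (Finset.mem_univ i)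
      rw [pow_eq_zero_iff two_ne_zero] at this
      rw [this, zero_mul]
    · rw [h, mul_zero]
  have hmem : hv.jet ∈ L.ker := Submodule.topologicalClosure_minimal _ hle
    (ContinuousLinearMap.isClosed_ker L) (by rw [trigSpan_topologicalClosure]; exact hv.jet_mem)
  rw [← hL hv]
  exact hmem

/-- The flux corrector of a square integrable divergence-free tensor satisfies the relations of a
flux corrector. -/
theorem IsFluxCorrector.isFluxTensor {F : Fin d → Fin d → Fin m → Fin m → Space d → ℝ}
    {Ψ : Fin d → Fin d → Fin d → Fin m → Fin m → Space d → ℝ} (h : IsFluxCorrector F Ψ)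
    (hdiv : ∀ j α β (v : Space d → ℝ) (Dv : Fin d → Space d → ℝ), IsPerH1 v Dv →
      ∑ k, ∫ y, F k j α β y * Dv k y ∂(cellMeasure d) = 0) : IsFluxTensor F Ψ := by
  obtain ⟨hp, f, Df, hf, hf0, hweq, hΨ⟩ := h
  have hm : ∀ k i j α β, MemLp (fun y => Df i j α β k y - Df k j α β i y) 2 (cellMeasure d) :=
    fun k i j α β => ((hf i j α β).memLp_grad k).sub ((hf k j α β).memLp_grad i)
  refine ⟨hp, fun k i j α β => (memLp_congr_ae (hΨ k i j α β)).2 (hm k i j α β),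
    fun k i j α β => ?_, fun i j α β φ hφ hφp => ?_⟩
  · filter_upwards [hΨ k i j α β, hΨ i k j α β] with y h1 h2
    rw [h1, h2]; ring
  · have hφ1 := isPerH1_of_contDiff hφp hφ
    have i1 : ∀ k, Integrable (fun y => Df i j α β k y * pderiv k φ y) (cellMeasure d) := fun k =>
      integrable_mul_of_memLp_two ((hf i j α β).memLp_grad k) (hφ1.memLp_grad k)
    have i2 : ∀ k, Integrable (fun y => Df k j α β i y * pderiv k φ y) (cellMeasure d) := fun k =>
      integrable_mul_of_memLp_two ((hf k j α β).memLp_grad i) (hφ1.memLp_grad k)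
    have e : ∫ y, ∑ k, Ψ k i j α β y * pderiv k φ y ∂(cellMeasure d) =
        ∫ y, (∑ k, Df i j α β k y * pderiv k φ y - ∑ k, Df k j α β i y * pderiv k φ y)
          ∂(cellMeasure d) := by
      refine integral_congr_ae ?_
      have : ∀ᵐ y ∂(cellMeasure d), ∀ k, Ψ k i j α β y = Df i j α β k y - Df k j α β i y :=
        eventually_all.2 fun k => hΨ k i j α β
      filter_upwards [this] with y hy
      simp only [hy, sub_mul, Finset.sum_sub_distrib]
    -- The first sum is the weak form of Δf_{ij} = F_{ij}; the second is that of ∂_i∂_k f_{kj} and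
    -- vanishes.
    rw [e, integral_sub (integrable_finsetSum _ fun k _ => i1 k)
      (integrable_finsetSum _ fun k _ => i2 k), hweq i j α β φ _ hφ1,
      integral_finsetSum _ fun k _ => i2 k,
      sum_integral_grad_mul_eq_zero (F := fun k => F k j α β)
        (fun k => ⟨hf k j α β, hf0 k j α β, hweq k j α β⟩) (hdiv j α β) i hφ1, sub_zero]

lemma exists_isFluxCorrector {F : Fin d → Fin d → Fin m → Fin m → Space d → ℝ}
    (hF : ∀ i j α β, MemLp (F i j α β) 2 (cellMeasure d))
    (h0 : ∀ i j α β, ∫ y, F i j α β y ∂(cellMeasure d) = 0) : ∃ Ψ, IsFluxCorrector F Ψ := by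
  choose f Df h using fun i j α β => exists_isPoissonSolution (hF i j α β) (h0 i j α β)
  exact ⟨fun k i j α β y => Df i j α β k y - Df k j α β i y,
    fun k i j α β => ((h i j α β).perH1.periodic_grad k).sub ((h k j α β).perH1.periodic_grad i),
    f, Df, fun i j α β => (h i j α β).perH1, fun i j α β => (h i j α β).mean_zero,
    fun i j α β => (h i j α β).weak_eq, fun k i j α β => ae_of_all _ fun y => rfl⟩

lemma eLpNorm_two_sq {X : Type*} [MeasurableSpace X] {ν : Measure X} {f : X → ℝ}
    (hf : MemLp f 2 ν) : eLpNorm f 2 ν ^ 2 = ENNReal.ofReal (∫ x, f x ^ 2 ∂ν) := by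
  rw [← lintegral_enorm_sq_eq hf]
  have := eLpNorm_nnreal_pow_eq_lintegral (f := f) (μ := ν) (p := 2) two_ne_zero
  simpa using this

lemma norm4_eq {G : Fin d → Fin d → Fin m → Fin m → Space d → ℝ}
    (hG : ∀ i j α β, MemLp (G i j α β) 2 (cellMeasure d)) :
    norm4 G = ENNReal.ofReal
      (√(∑ i, ∑ j, ∑ α, ∑ β, ∫ y, G i j α β y ^ 2 ∂(cellMeasure d))) := by
  have h0 : ∀ i j α β, 0 ≤ ∫ y, G i j α β y ^ 2 ∂(cellMeasure d) := fun i j α β =>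
    integral_nonneg fun y => sq_nonneg _
  simp only [norm4, eLpNorm_two_sq (hG _ _ _ _)]
  simp_rw [← ENNReal.ofReal_sum_of_nonneg fun β _ => h0 _ _ _ β]
  simp_rw [← ENNReal.ofReal_sum_of_nonneg fun α _ => Finset.sum_nonneg fun β _ => h0 _ _ α β]
  simp_rw [← ENNReal.ofReal_sum_of_nonneg fun j _ => Finset.sum_nonneg fun α _ =>
    Finset.sum_nonneg fun β _ => h0 _ j α β]
  rw [← ENNReal.ofReal_sum_of_nonneg fun i _ => Finset.sum_nonneg fun j _ =>
    Finset.sum_nonneg fun α _ => Finset.sum_nonneg fun β _ => h0 i j α β,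
    ENNReal.ofReal_rpow_of_nonneg (Finset.sum_nonneg fun i _ => Finset.sum_nonneg fun j _ =>
    Finset.sum_nonneg fun α _ => Finset.sum_nonneg fun β _ => h0 i j α β) (by norm_num),
    Real.sqrt_eq_rpow]

lemma norm5_eq {G : Fin d → Fin d → Fin d → Fin m → Fin m → Space d → ℝ}
    (hG : ∀ k i j α β, MemLp (G k i j α β) 2 (cellMeasure d)) :
    norm5 G = ENNReal.ofReal
      (√(∑ k, ∑ i, ∑ j, ∑ α, ∑ β, ∫ y, G k i j α β y ^ 2 ∂(cellMeasure d))) := by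
  have h0 : ∀ k, 0 ≤ ∑ i, ∑ j, ∑ α, ∑ β, ∫ y, G k i j α β y ^ 2 ∂(cellMeasure d) := fun k =>
    Finset.sum_nonneg fun i _ => Finset.sum_nonneg fun j _ => Finset.sum_nonneg fun α _ =>
      Finset.sum_nonneg fun β _ => integral_nonneg fun y => sq_nonneg _
  have h1 : ∀ k, ∑ i, ∑ j, ∑ α, ∑ β, eLpNorm (G k i j α β) 2 (cellMeasure d) ^ 2 =
      ENNReal.ofReal (∑ i, ∑ j, ∑ α, ∑ β, ∫ y, G k i j α β y ^ 2 ∂(cellMeasure d)) := fun k => by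
    have h2 := congrArg (· ^ 2) (norm4_eq (hG k))
    simp only [norm4, ← ENNReal.ofReal_pow (Real.sqrt_nonneg _), Real.sq_sqrt (h0 k)] at h2
    rw [← h2, ← ENNReal.rpow_natCast, ← ENNReal.rpow_mul]
    norm_num
  simp only [norm5, h1]
  rw [← ENNReal.ofReal_sum_of_nonneg fun k _ => h0 k, ENNReal.ofReal_rpow_of_nonneg
    (Finset.sum_nonneg fun k _ => h0 k) (by norm_num), Real.sqrt_eq_rpow]

end FluxCorrector

/-! ### From the total flux to F and its corrector -/

section UniformBounds

variable {d m : ℕ} {W : Set (Space d)} {M δ : ℝ} {A : Coeff d m}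
  {χ : Fin d → Fin m → Fin m → Space d → ℝ} {Dχ : Fin d → Fin m → Fin m → Fin d → Space d → ℝ}

lemma memLp_fluxF (hT : ∀ i j α β, MemLp (totalFlux W δ A Dχ i j α β) 2 (cellMeasure d))
    (i j : Fin d) (α β : Fin m) : MemLp (fluxF W δ A Dχ i j α β) 2 (cellMeasure d) :=
  (hT i j α β).sub (memLp_const _)

lemma integral_fluxF (hT : ∀ i j α β, MemLp (totalFlux W δ A Dχ i j α β) 2 (cellMeasure d))
    (i j : Fin d) (α β : Fin m) : ∫ y, fluxF W δ A Dχ i j α β y ∂(cellMeasure d) = 0 := by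
  simp only [fluxF]
  rw [integral_sub ((hT i j α β).integrable (by norm_num)) (integrable_const _)]
  simp [homogenized]

/-- Subtracting the mean does not increase the L² norm on a probability space. -/
lemma integral_fluxF_sq_le
    (hT : ∀ i j α β, MemLp (totalFlux W δ A Dχ i j α β) 2 (cellMeasure d))
    (i j : Fin d) (α β : Fin m) :
    ∫ y, fluxF W δ A Dχ i j α β y ^ 2 ∂(cellMeasure d) ≤
      ∫ y, totalFlux W δ A Dχ i j α β y ^ 2 ∂(cellMeasure d) := by
  have e : ∀ y, fluxF W δ A Dχ i j α β y ^ 2 = 1 * totalFlux W δ A Dχ i j α β y ^ 2 +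
      (-2 * homogenized W δ A Dχ i j α β) * totalFlux W δ A Dχ i j α β y +
      homogenized W δ A Dχ i j α β ^ 2 := fun y => by rw [fluxF]; ring
  simp_rw [e]
  rw [integral_quadratic (hT i j α β), ← homogenized]
  nlinarith [sq_nonneg (homogenized W δ A Dχ i j α β)]

/-- Test the cell problem with a field that has the single component α. The homogenized tensor is
constant, hence orthogonal to gradients, which have mean zero. -/
lemma IsCellSolution.sum_integral_fluxF_mul (h : IsCellSolution W δ A χ Dχ)
    (hT : ∀ i j α β, MemLp (totalFlux W δ A Dχ i j α β) 2 (cellMeasure d)) (j : Fin d)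
    (α β : Fin m) (v : Space d → ℝ) (Dv : Fin d → Space d → ℝ) (hv : IsPerH1 v Dv) :
    ∑ k, ∫ y, fluxF W δ A Dχ k j α β y * Dv k y ∂(cellMeasure d) = 0 := by
  have h1 := h.weak_eq j β _ _ fun γ => hv.const_mul (if γ = α then 1 else 0)
  have e : ∀ y, ∑ i, ∑ γ, totalFlux W δ A Dχ i j γ β y * ((if γ = α then 1 else 0) * Dv i y) =
      ∑ i, totalFlux W δ A Dχ i j α β y * Dv i y := fun y => by simp
  have i1 : ∀ i, Integrable (fun y => totalFlux W δ A Dχ i j α β y * Dv i y) (cellMeasure d) :=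
    fun i => integrable_mul_of_memLp_two (hT i j α β) (hv.memLp_grad i)
  simp_rw [e] at h1
  rw [integral_finsetSum _ fun i _ => i1 i] at h1
  rw [← h1]
  refine Finset.sum_congr rfl fun k _ => ?_
  simp only [fluxF, sub_mul]
  rw [integral_sub (i1 k) (((hv.memLp_grad k).integrable (by norm_num)).const_mul _),
    integral_const_mul, hv.integral_grad, mul_zero, sub_zero]

/-- The energy of a flux corrector is controlled by the energy of the flux. -/
lemma exists_fluxCorrector_bound (d m : ℕ) :
    ∃ C : ℝ, 0 ≤ C ∧ ∀ (F : Fin d → Fin d → Fin m → Fin m → Space d → ℝ)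
      (Ψ : Fin d → Fin d → Fin d → Fin m → Fin m → Space d → ℝ),
      (∀ i j α β, MemLp (F i j α β) 2 (cellMeasure d)) → IsFluxCorrector F Ψ →
      ∑ k, ∑ i, ∑ j, ∑ α, ∑ β, ∫ y, Ψ k i j α β y ^ 2 ∂(cellMeasure d) ≤
        C * ∑ i, ∑ j, ∑ α, ∑ β, ∫ y, F i j α β y ^ 2 ∂(cellMeasure d) := by
  obtain ⟨C, hC0, hC⟩ := exists_poisson_bound d
  refine ⟨4 * C, by positivity, fun F Ψ hF ⟨_, f, Df, hf, hf0, hweq, hΨ⟩ => ?_⟩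
  have hs : ∀ i j α β k, Integrable (fun y => Df i j α β k y ^ 2) (cellMeasure d) :=
    fun i j α β k => ((hf i j α β).memLp_grad k).integrable_sq
  set S : Fin d → Fin d → Fin d → Fin m → Fin m → ℝ := fun k i j α β =>
    ∫ y, Df i j α β k y ^ 2 ∂(cellMeasure d) with hS
  have h1 : ∀ k i j α β, ∫ y, Ψ k i j α β y ^ 2 ∂(cellMeasure d) ≤
      2 * S k i j α β + 2 * S i k j α β := fun k i j α β => by
    simp only [hS]
    rw [← integral_const_mul, ← integral_const_mul,
      ← integral_add ((hs _ _ _ _ _).const_mul 2) ((hs _ _ _ _ _).const_mul 2)]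
    have hm : MemLp (fun y => Df i j α β k y - Df k j α β i y) 2 (cellMeasure d) :=
      ((hf i j α β).memLp_grad k).sub ((hf k j α β).memLp_grad i)
    have hmΨ := (memLp_congr_ae (hΨ k i j α β)).2 hm
    refine integral_mono_ae hmΨ.integrable_sq
      (((hs _ _ _ _ _).const_mul 2).add ((hs _ _ _ _ _).const_mul 2)) ?_
    filter_upwards [hΨ k i j α β] with y hy
    rw [hy]
    nlinarith [sq_nonneg (Df i j α β k y + Df k j α β i y)]
  calc ∑ k, ∑ i, ∑ j, ∑ α, ∑ β, ∫ y, Ψ k i j α β y ^ 2 ∂(cellMeasure d)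
      ≤ ∑ k, ∑ i, ∑ j, ∑ α, ∑ β, (2 * S k i j α β + 2 * S i k j α β) := by
        gcongr; exact h1 _ _ _ _ _
    -- The two halves differ by exchanging k and i, so they have the same total.
    _ = 4 * ∑ i, ∑ j, ∑ α, ∑ β, ∑ k, S k i j α β := by
        simp only [Finset.sum_add_distrib, ← Finset.mul_sum]
        have e1 : ∑ k, ∑ i, ∑ j, ∑ α, ∑ β, S k i j α β =
            ∑ i, ∑ j, ∑ α, ∑ β, ∑ k, S k i j α β := by
          rw [Finset.sum_comm]
          refine Finset.sum_congr rfl fun i _ => ?_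
          rw [Finset.sum_comm]
          refine Finset.sum_congr rfl fun j _ => ?_
          rw [Finset.sum_comm]
          exact Finset.sum_congr rfl fun α _ => Finset.sum_comm
        have e2 : ∑ k, ∑ i, ∑ j, ∑ α, ∑ β, S i k j α β =
            ∑ k, ∑ i, ∑ j, ∑ α, ∑ β, S k i j α β := Finset.sum_comm
        rw [e2, e1]
        ring
    _ ≤ 4 * ∑ i, ∑ j, ∑ α, ∑ β, C * ∫ y, F i j α β y ^ 2 ∂(cellMeasure d) := by
        gcongr with i _ j _ α _ β _
        exact hC _ _ _ (hF i j α β) ⟨hf i j α β, hf0 i j α β, hweq i j α β⟩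
    _ = _ := by
        simp only [← Finset.mul_sum, mul_assoc]

end UniformBounds

end HighContrast

end

/-- The constant is fixed before the coefficients and δ are introduced. For symmetric coefficients M
= 0 is admissible, so that the constant then depends on d, m, μ and `W` alone. -/
theorem theorem3p6 (d m : ℕ) (hd : 2 ≤ d) (hm : 1 ≤ m)
    (W : Set (HighContrast.Space d)) (hW : HighContrast.IsInclusion W)
    (μ : ℝ) (hμ : 0 < μ) (M : ℝ) :
    ∃ C : ℝ, ∀ A : HighContrast.Coeff d m,
      (∀ i j α β, Measurable fun y => A y i j α β) →
      HighContrast.IsElliptic μ A →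
      HighContrast.IsPeriodic A →
      (HighContrast.IsSymm A ∨ ∀ y i j α β, |A y i j α β| ≤ M) →
      ∀ δ : ℝ, 0 < δ →
        (∃ χ Dχ, HighContrast.IsCellSolution W δ A χ Dχ) ∧
        ∀ χ Dχ, HighContrast.IsCellSolution W δ A χ Dχ →
          (∀ i j α β, MeasureTheory.MemLp (HighContrast.fluxF W δ A Dχ i j α β) 2
            (HighContrast.cellMeasure d)) ∧
          (∃ Ψ, HighContrast.IsFluxCorrector (HighContrast.fluxF W δ A Dχ) Ψ) ∧
          ∀ Ψ, HighContrast.IsFluxCorrector (HighContrast.fluxF W δ A Dχ) Ψ →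
            HighContrast.IsFluxTensor (HighContrast.fluxF W δ A Dχ) Ψ ∧
            HighContrast.norm4 (HighContrast.fluxF W δ A Dχ) + HighContrast.norm5 Ψ ≤
              ENNReal.ofReal C := by
  obtain ⟨C, hC⟩ := HighContrast.exists_totalFlux_bound hW hμ m (max M μ⁻¹)
  obtain ⟨C', hC'0, hC'⟩ := HighContrast.exists_fluxCorrector_bound d m
  -- C bounds the flux for one pair (j, β), and there are d · m such pairs; C' is the loss in
  -- passing to the corrector.
  refine ⟨√(d * (m * C)) + √(C' * (d * (m * C))), fun A hAm hA _ hAb δ hδ => ?_⟩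
  have hM := HighContrast.abs_coeffMatrix_le hμ hA hAb
  refine ⟨HighContrast.exists_isCellSolution hW hμ hδ hAm hA hM, fun χ Dχ h => ?_⟩
  have hT := h.memLp_totalFlux hW.isOpen hδ hAm hM
  have hF := HighContrast.memLp_fluxF hT
  refine ⟨hF, HighContrast.exists_isFluxCorrector hF (HighContrast.integral_fluxF hT),
    fun Ψ hΨ => ?_⟩
  have hΨ' := hΨ.isFluxTensor (h.sum_integral_fluxF_mul hT)
  refine ⟨hΨ', ?_⟩
  have h1 : ∑ i, ∑ j, ∑ α, ∑ β, ∫ y, HighContrast.fluxF W δ A Dχ i j α β y ^ 2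
      ∂(HighContrast.cellMeasure d) ≤ d * (m * C) := by
    calc _ ≤ ∑ i, ∑ j, ∑ α, ∑ β, ∫ y, HighContrast.totalFlux W δ A Dχ i j α β y ^ 2
          ∂(HighContrast.cellMeasure d) := by
          exact Finset.sum_le_sum fun i _ => Finset.sum_le_sum fun j _ =>
            Finset.sum_le_sum fun α _ => Finset.sum_le_sum fun β _ =>
              HighContrast.integral_fluxF_sq_le hT i j α β
      _ = ∑ j, ∑ β, ∑ i, ∑ α, ∫ y, HighContrast.totalFlux W δ A Dχ i j α β y ^ 2
          ∂(HighContrast.cellMeasure d) := by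
          rw [Finset.sum_comm]
          refine Finset.sum_congr rfl fun j _ => ?_
          rw [Finset.sum_comm (γ := Fin m)]
          exact Finset.sum_congr rfl fun i _ => Finset.sum_comm
      _ ≤ ∑ _j : Fin d, ∑ _β : Fin m, C := by
          gcongr
          exact hC A hAm hA hM δ hδ χ Dχ h _ _
      _ = d * (m * C) := by simp
  have h2 := (hC' _ Ψ hF hΨ).trans (mul_le_mul_of_nonneg_left h1 hC'0)
  rw [HighContrast.norm4_eq hF, HighContrast.norm5_eq hΨ'.memLp,
    ← ENNReal.ofReal_add (Real.sqrt_nonneg _) (Real.sqrt_nonneg _)]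
  exact ENNReal.ofReal_le_ofReal (add_le_add (Real.sqrt_le_sqrt h1) (Real.sqrt_le_sqrt h2))
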